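/- **Setting.** Let $d\ge 1$, $s\in(0,1]$, $r=|x|$, $\omega=x/r$, $\langle x\rangle=(1+|x|^2)^{1/2}$, and let $q\in C^\infty(\mathbb R^d;\mathbb R)$ be long-range: there are $\rho\in(0,1)$ and $C_k>0$ with, for all $k\ge 0$, $|\nabla^k q|\le C_k\langle x\rangle^{2s-k-\rho}$ if $s<1$, and $|\nabla^k q|\le C_k(\log\langle x\rangle)^{-1-\rho}\langle x\rangle^{2-k}$ (for $x\ne0$) if $s=1$. Let $H=-\tfrac{\hbar^2}{2}\Delta-\tfrac12|x|^{2s}+q$ on $L^2(\mathbb R^d)$, $\hbar>0$. Fix $\chi_1\in C^\infty(\mathbb R;[0,1])$ with $\chi_1(t)=0$ for $t\le1$ and $\chi_1(t)=1$ for $t\ge2$. For $R>0$ put $\chi_R(t)=\chi_1(t/R^{2s})$ and $$r_\theta=\begin{cases}(r^{2s}+2s\theta\chi_R(r^{2s}))^{1/(2s)}&(s<1),\\(r^2+2\theta\chi_R(r^2)\log r)^{1/2}&(s=1),\end{cases}\qquad J=(r_\theta/r)^{d-1}\,\partial_r r_\theta ,$$ with principal powers for complex $\theta$. We say that $q$ is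 analytic under the distortion if for some $\beta_0>0$ and every $x$, the function $\theta\mapsto q_\theta(x):=q(r_\theta\omega)$, defined for real $\theta$ near $0$, extends holomorphically to $|\theta|<\beta_0$, and $|q_\theta(x)-q(x)|$ is bounded uniformly in $x\in\mathbb R^d$ and $|\theta|<\beta_0$. For $\theta$ near $0$, $H_\theta$ is the closure in $L^2(\mathbb R^d)$ of the operator acting on $C_c^\infty(\mathbb R^d)$ by $$H_\theta=\tfrac{\hbar^2}{2}\,U_\theta(-\Delta)U_\theta^{-1}-\tfrac12 r_\theta^{2s}+q_\theta,$$ $$U_\theta(-\Delta)U_\theta^{-1}=-J^{1/2}(\partial_rr_\theta)^{-1}\partial_r(\partial_rr_\theta)^{-1}\partial_rJ^{-1/2}-(d-1)J^{1/2}r_\theta^{-1}(\partial_rr_\theta)^{-1}\partial_rJ^{-1/2}-r_\theta^{-2}\Delta_{\mathbb S^{d-1}} .$$ **Theorem 2.1.** Let $E\in\mathbb R$. Assume that there exist $\mu>0$ and $\chi,\tilde\chi\in C^1([0,\infty);[0,1])$ such that 1. $\chi^2+\tilde\chi^2=1$ and $\chi=1$ near $0$; if $s=1$, moreover $\operatorname{supp}\tilde\chi\subset\{r\ge\sqrt{\mathrm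 e}\}$; 2. there is $\alpha>0$ with $-\tfrac12r^{2s}+q-E\ge\alpha$ whenever $r=|x|\in\operatorname{supp}\chi$; 3. there is $\gamma>0$ such that, whenever $r=|x|\in\operatorname{supp}\tilde\chi$, $$\begin{cases}1-s-2(1-2s)r^{-2s}(q-E)-r^{1-2s}\partial_rq-\mu\ge\gamma&(s<1),\\1+2r^{-2}(\log r-1)(q-E)-r^{-1}(\log r)\,\partial_rq-\mu\ge\gamma&(s=1).\end{cases}$$ Take any $R>0$ such that $\chi_R(r^{2s})=1$ for $r\in\operatorname{supp}\tilde\chi$, and assume that $q$ is analytic under the corresponding distortion. Then there are constants $c,K>0$ and $\beta_1\in(0,\beta_0]$, independent of $\beta$ and $\hbar$, and numbers $C_{\beta,\hbar}$, such that for all $\beta\in(0,\beta_1)$ and all $\hbar>0$, with $\theta=\mathrm i\beta$ and $z=E-\mathrm i\beta\mu$, $$\|(H_\theta-z)u\|\ge C_{\beta,\hbar}\,\|u\|\quad\text{for all }u\in\mathcal D(H_\theta),\qquad \bigl|C_{\beta,\hbar}-(1-c\beta)\min\{\alpha,\beta\gamma\}\bigr|\le K\beta^2+K\hbar^2 .$$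 -/

import Mathlib

open MeasureTheory Set Filter Topology
open scoped ContDiff

noncomputable section

namespace RepulsiveResonance

/-- Support, relative to `[0, ∞)`, of a function of the radial variable. -/
def radialSupp (f : ℝ → ℝ) : Set ℝ := closure {r : ℝ | 0 ≤ r ∧ f r ≠ 0}

/-- The Japanese bracket `⟨x⟩ = (1 + |x|²)^{1/2}`. -/
def bracket {d : ℕ} (x : EuclideanSpace ℝ (Fin d)) : ℝ := Real.sqrt (1 + ‖x‖ ^ 2)

/-- The radial derivative `∂_r f = ω · ∇f`, `ω = x / |x|`. -/
def radialDeriv {d : ℕ} {F : Type*} [NormedAddCommGroup F] [NormedSpace ℝ F]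
    (f : EuclideanSpace ℝ (Fin d) → F) (x : EuclideanSpace ℝ (Fin d)) : F :=
  fderiv ℝ f x (‖x‖⁻¹ • x)

/-- Long-range type condition on the real perturbation `q`, for `s ∈ (0,1]`.
For `s = 1` the bound `|∇^k q| ≤ C_k (log⟨x⟩)^{-1-ρ} ⟨x⟩^{2-k}` is multiplied by
`(log⟨x⟩)^{1+ρ}`, so that it carries no information at `x = 0`, where `log⟨x⟩ = 0`. -/
def LongRange {d : ℕ} (s : ℝ) (q : EuclideanSpace ℝ (Fin d) → ℝ) : Prop :=
  ContDiff ℝ ∞ q ∧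
  ∃ ρ : ℝ, 0 < ρ ∧ ρ < 1 ∧ ∃ C : ℕ → ℝ, (∀ k, 0 < C k) ∧
    ∀ (k : ℕ) (x : EuclideanSpace ℝ (Fin d)),
      (s < 1 → ‖iteratedFDeriv ℝ k q x‖ ≤ C k * bracket x ^ (2 * s - (k : ℝ) - ρ)) ∧
      (s = 1 → Real.log (bracket x) ^ (1 + ρ) * ‖iteratedFDeriv ℝ k q x‖
          ≤ C k * bracket x ^ (2 - (k : ℝ)))

/-- The power `r_θ^{2s}` of the distorted radius, for complex `θ`:
`r^{2s} + 2 s θ χ_R(r^{2s})` if `s < 1` and `r² + 2 θ χ_R(r²) log r` if `s = 1`,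
where `χ_R(t) = χ₁(t / R^{2s})`. -/
def radiusPow (s R : ℝ) (χ₁ : ℝ → ℝ) (θ : ℂ) (r : ℝ) : ℂ :=
  ((r ^ (2 * s) : ℝ) : ℂ)
    + 2 * θ * ((χ₁ (r ^ (2 * s) / R ^ (2 * s)) : ℝ) : ℂ)
        * (((if s < 1 then s else Real.log r) : ℝ) : ℂ)

/-- The distorted radius `r_θ`. -/
def radius (s R : ℝ) (χ₁ : ℝ → ℝ) (θ : ℂ) (r : ℝ) : ℂ :=
  radiusPow s R χ₁ θ r ^ (((1 / (2 * s) : ℝ)) : ℂ)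

/-- `∂ r_θ / ∂ r`. -/
def radiusDeriv (s R : ℝ) (χ₁ : ℝ → ℝ) (θ : ℂ) (r : ℝ) : ℂ :=
  deriv (fun t : ℝ => radius s R χ₁ θ t) r

/-- The Jacobian `J(θ, r) = (r_θ / r)^{d-1} ∂r_θ/∂r` of `rω ↦ r_θ ω` in dimension `d ≥ 1`. -/
def jacobian (d : ℕ) (s R : ℝ) (χ₁ : ℝ → ℝ) (θ : ℂ) (r : ℝ) : ℂ :=
  (radius s R χ₁ θ r / (r : ℂ)) ^ (d - 1) * radiusDeriv s R χ₁ θ r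

/-- The Laplacian `Δ_{S^{d-1}}` on the unit sphere acting in the angular variable, i.e.
`Δ = ∂_r² + (d-1) r⁻¹ ∂_r + r⁻² Δ_{S^{d-1}}`. -/
def sphereLaplacian {d : ℕ} (φ : EuclideanSpace ℝ (Fin d) → ℂ)
    (x : EuclideanSpace ℝ (Fin d)) : ℂ :=
  (‖x‖ : ℂ) ^ 2 * Laplacian.laplacian φ x
    - (‖x‖ : ℂ) ^ 2 * radialDeriv (radialDeriv φ) x
    - ((d : ℂ) - 1) * (‖x‖ : ℂ) * radialDeriv φ x

/-- The distorted Laplacian `U_θ Δ U_θ⁻¹`, continued to complex `θ`, in polar coordinates: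
`J^{1/2} r_θ'⁻¹ ∂_r r_θ'⁻¹ ∂_r J^{-1/2} + (d-1) J^{1/2} r_θ⁻¹ r_θ'⁻¹ ∂_r J^{-1/2}
+ r_θ⁻² Δ_{S^{d-1}}` with `r_θ' = ∂r_θ/∂r`. -/
def distortedLaplacian {d : ℕ} (s R : ℝ) (χ₁ : ℝ → ℝ) (θ : ℂ)
    (φ : EuclideanSpace ℝ (Fin d) → ℂ) (x : EuclideanSpace ℝ (Fin d)) : ℂ :=
  let ψ : EuclideanSpace ℝ (Fin d) → ℂ :=
    fun y => jacobian d s R χ₁ θ ‖y‖ ^ (-(1 / 2) : ℂ) * φ y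
  jacobian d s R χ₁ θ ‖x‖ ^ (1 / 2 : ℂ) *
      ((radiusDeriv s R χ₁ θ ‖x‖)⁻¹ *
          radialDeriv (fun y => (radiusDeriv s R χ₁ θ ‖y‖)⁻¹ * radialDeriv ψ y) x
        + ((d : ℂ) - 1) * (radius s R χ₁ θ ‖x‖)⁻¹ * (radiusDeriv s R χ₁ θ ‖x‖)⁻¹
          * radialDeriv ψ x)
    + (radius s R χ₁ θ ‖x‖)⁻¹ ^ 2 * sphereLaplacian φ x

/-- `Q` is the analytic continuation of the distorted perturbation `q_θ(rω) = q(r_θ ω)` to the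
disc `|θ| < β₀`, uniformly in `x`: for each `x`, `θ ↦ Q θ x` is holomorphic there and coincides
with `q(r_θ ω)` for real `θ` near `0` (where `r_θ` is real), and `q_θ - q` is bounded
uniformly in `x` and `θ`. -/
structure IsAnalyticDistortion {d : ℕ} (s R : ℝ) (χ₁ : ℝ → ℝ)
    (q : EuclideanSpace ℝ (Fin d) → ℝ) (β₀ : ℝ)
    (Q : ℂ → EuclideanSpace ℝ (Fin d) → ℂ) : Prop where
  holomorphic : ∀ x, DifferentiableOn ℂ (fun θ => Q θ x) (Metric.ball 0 β₀)
  extends_real : ∀ x, ∀ᶠ t : ℝ in 𝓝 0,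
    Q (t : ℂ) x = ((q (((radius s R χ₁ (t : ℂ) ‖x‖).re / ‖x‖) • x) : ℝ) : ℂ)
  bounded : ∃ M : ℝ, ∀ θ ∈ Metric.ball (0 : ℂ) β₀, ∀ x, ‖Q θ x - (q x : ℂ)‖ ≤ M

/-- The differential expression
`H_θ = (ħ²/2) U_θ (-Δ) U_θ⁻¹ - ½ r_θ^{2s} + q_θ`. -/
def distortedExpr {d : ℕ} (s R : ℝ) (χ₁ : ℝ → ℝ)
    (Q : ℂ → EuclideanSpace ℝ (Fin d) → ℂ) (ħ : ℝ) (θ : ℂ)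
    (φ : EuclideanSpace ℝ (Fin d) → ℂ) (x : EuclideanSpace ℝ (Fin d)) : ℂ :=
  -((ħ : ℂ) ^ 2 / 2) * distortedLaplacian s R χ₁ θ φ x
    - (1 / 2) * radiusPow s R χ₁ θ ‖x‖ * φ x + Q θ x * φ x

/-- The graph of the closed operator `H_θ` on `L²(ℝ^d)`: the closure in `L² × L²` of the graph
of the differential expression on `C_c^∞(ℝ^d)`. Thus `(u, f)` belongs to it iff
`u ∈ D(H_θ)` and `H_θ u = f`. -/
def distortedGraph {d : ℕ} (s R : ℝ) (χ₁ : ℝ → ℝ)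
    (Q : ℂ → EuclideanSpace ℝ (Fin d) → ℂ) (ħ : ℝ) (θ : ℂ) :
    Set (Lp ℂ 2 (volume : Measure (EuclideanSpace ℝ (Fin d))) ×
      Lp ℂ 2 (volume : Measure (EuclideanSpace ℝ (Fin d)))) :=
  closure {p | ∃ φ : EuclideanSpace ℝ (Fin d) → ℂ,
    ContDiff ℝ ∞ φ ∧ HasCompactSupport φ ∧
    (p.1 : EuclideanSpace ℝ (Fin d) → ℂ) =ᵐ[volume] φ ∧
    (p.2 : EuclideanSpace ℝ (Fin d) → ℂ) =ᵐ[volume] distortedExpr s R χ₁ Q ħ θ φ}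

end RepulsiveResonance

end

/-! A positive commutator argument becomes a single pairing with a complex radial multiplier. For `θ
= iβ` write `∂_r r_θ = exp l`, `r_θ = r exp τ` and `κ = 2 Im l`. Let `M = χ² + i χ'² exp(iκ)`, where
`χ'` is the second member of the partition and not a derivative. Since `|M| ≤ 1`, `‖φ‖ ‖(H_θ - z)φ‖`
dominates the real part of the integral of `M φ̄ (H_θ - z)φ`, so a lower bound for that real part
suffices, on test functions and then on the closure.

Kinetic part. After conjugation by `J^{1/2}` the Laplacian has divergence form, with radial
coefficient `a = exp(-2l)`, angular coefficient `exp(-2τ)` and a bounded potential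
(`distortedLaplacian_eq`). The phase of `M` is the one that makes `M a` equal to `i|a|` where `χ' =
1`, so the radial energy there has no real part; where `χ` lives it is positive. The angular energy
has the right sign because the argument of `exp(l - τ)` is nonpositive on the support of `χ'`. The
derivative of the phase contributes a real coefficient times `φ̄ ∂_r φ`, whose real part is half a
derivative of `|φ|²` and integrates by parts; the derivative of the partition always carries a
factor `χ` and is absorbed by Young's inequality. Altogether the loss is `O(ħ²)`, uniformly in `β`
(`exists_kinetic_lower_bound`).

Potential part. Put `W = -½ r_θ^{2s} + q_θ - z`. Where `χ ≠ 0`, `Re W ≥ α - O(β)`. Where `χ' ≠ 0`,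
the contribution is `-Im(exp(iκ) W)`, whose first order coefficient in `β` is exactly the virial
expression, hence at least `βγ - O(β²)`. The growth of `W` at infinity is harmless because `κ² (1 +
r^{2s})` is `O(β²)` (`exists_potential_lower_bound`).

Thus `βγ - O(β²) - O(ħ²)` is an admissible constant, and for small `β` the minimum of `α` and `βγ`
is `βγ`. -/

noncomputable section

namespace RepulsiveResonance

/-! ### Divergence theorems for compactly supported fields -/

section Divergence

variable {E : Type*} [NormedAddCommGroup E] [InnerProductSpace ℝ E] [FiniteDimensional ℝ E]
  [MeasurableSpace E] [BorelSpace E]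

/-- Integration by parts against the constant function `1`. -/
theorem integral_fderiv_apply_eq_zero {f : E → ℂ} (hf : ContDiff ℝ 1 f)
    (hc : HasCompactSupport f) (v : E) : ∫ x, fderiv ℝ f x v = 0 := by
  have h := integral_mul_fderiv_eq_neg_fderiv_mul_of_integrable (𝕜 := ℂ) (f := fun _ : E => (1 : ℂ))
    (g := f) (v := v) (μ := (volume : Measure E)) (by simp)
    (by
      simp only [one_mul]
      exact ((hf.continuous_fderiv one_ne_zero).clm_apply continuous_const).integrable_of_hasCompactSupport
        (hc.fderiv_apply (𝕜 := ℝ) v))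
    (by simpa using hf.continuous.integrable_of_hasCompactSupport hc)
    (by intro x _; fun_prop) (fun x _ => (hf.differentiable one_ne_zero) x)
  simpa using h

theorem integrable_fderiv_apply {f : E → ℂ} (hf : ContDiff ℝ 1 f)
    (hc : HasCompactSupport f) (v : E) : Integrable (fun x => fderiv ℝ f x v) :=
  ((hf.continuous_fderiv one_ne_zero).clm_apply continuous_const).integrable_of_hasCompactSupport
        (hc.fderiv_apply (𝕜 := ℝ) v)

/-- Divergence theorem for the vector field `f(x) x`. -/
theorem integral_divergence_smul_id {f : E → ℂ} (hf : ContDiff ℝ 1 f) (hc : HasCompactSupport f) :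
    Integrable (fun x => (Module.finrank ℝ E : ℂ) * f x + fderiv ℝ f x x) ∧
    ∫ x, ((Module.finrank ℝ E : ℂ) * f x + fderiv ℝ f x x) = 0 := by
  set b := stdOrthonormalBasis ℝ E
  have hF : ∀ i, ContDiff ℝ 1 (fun x => ((inner ℝ (b i) x : ℝ) : ℂ) * f x) := fun i =>
    (Complex.ofRealCLM.contDiff.comp (contDiff_const.inner ℝ contDiff_id)).mul hf
  have hFc : ∀ i, HasCompactSupport (fun x => ((inner ℝ (b i) x : ℝ) : ℂ) * f x) := fun i =>
    hc.mul_left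
  have key : ∀ x, (Module.finrank ℝ E : ℂ) * f x + fderiv ℝ f x x
      = ∑ i, fderiv ℝ (fun x => ((inner ℝ (b i) x : ℝ) : ℂ) * f x) x (b i) := by
    intro x
    have h1 : ∀ i, fderiv ℝ (fun x => ((inner ℝ (b i) x : ℝ) : ℂ) * f x) x (b i)
        = f x + ((inner ℝ (b i) x : ℝ) : ℂ) * fderiv ℝ f x (b i) := by
      intro i
      have h2 : HasFDerivAt (fun x => ((inner ℝ (b i) x : ℝ) : ℂ))
          (Complex.ofRealCLM.comp (innerSL ℝ (b i))) x :=
        (Complex.ofRealCLM.comp (innerSL ℝ (b i))).hasFDerivAt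
      have h3 := h2.fun_mul ((hf.differentiable one_ne_zero) x).hasFDerivAt
      rw [h3.fderiv]
      simp [b.orthonormal.1 i]
      ring
    simp_rw [h1, Finset.sum_add_distrib]
    congr 1
    · simp
    · have h := congrArg (fderiv ℝ f x) (b.sum_repr' x)
      rw [map_sum] at h
      rw [← h]
      simp
  constructor
  · simp_rw [key]
    exact integrable_finsetSum _ fun i _ => integrable_fderiv_apply (hF i) (hFc i) _
  · simp_rw [key]
    rw [integral_finsetSum _ fun i _ => integrable_fderiv_apply (hF i) (hFc i) _]
    exact Finset.sum_eq_zero fun i _ => integral_fderiv_apply_eq_zero (hF i) (hFc i) _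

/-- Divergence theorem for the vector field `f ∇φ`. -/
theorem integral_divergence_mul_gradient {f φ : E → ℂ} (hf : ContDiff ℝ 1 f)
    (hφ : ContDiff ℝ 2 φ) (hc : HasCompactSupport f) :
    Integrable (fun x => f x * Laplacian.laplacian φ x + ∑ i,
      fderiv ℝ f x (stdOrthonormalBasis ℝ E i) * fderiv ℝ φ x (stdOrthonormalBasis ℝ E i)) ∧
    ∫ x, (f x * Laplacian.laplacian φ x + ∑ i,
      fderiv ℝ f x (stdOrthonormalBasis ℝ E i) * fderiv ℝ φ x (stdOrthonormalBasis ℝ E i)) = 0 := by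
  set b := stdOrthonormalBasis ℝ E
  have hφ' : ContDiff ℝ 1 (fderiv ℝ φ) := hφ.fderiv_right (by norm_num)
  have hφi : ∀ i, ContDiff ℝ 1 (fun x => fderiv ℝ φ x (b i)) := fun i =>
    hφ'.clm_apply contDiff_const
  have hF : ∀ i, ContDiff ℝ 1 (fun x => f x * fderiv ℝ φ x (b i)) := fun i => hf.mul (hφi i)
  have hFc : ∀ i, HasCompactSupport (fun x => f x * fderiv ℝ φ x (b i)) := fun i =>
    hc.mul_right
  have key : ∀ x, f x * Laplacian.laplacian φ x + ∑ i, fderiv ℝ f x (b i) * fderiv ℝ φ x (b i)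
      = ∑ i, fderiv ℝ (fun x => f x * fderiv ℝ φ x (b i)) x (b i) := by
    intro x
    rw [InnerProductSpace.laplacian_eq_iteratedFDeriv_orthonormalBasis φ b, Finset.mul_sum,
      ← Finset.sum_add_distrib]
    refine Finset.sum_congr rfl fun i _ => ?_
    have h2 : HasFDerivAt (fun x => fderiv ℝ φ x (b i))
        ((fderiv ℝ (fderiv ℝ φ) x).flip (b i)) x := by
      have := ((hφ'.differentiable one_ne_zero) x).hasFDerivAt.clm_apply
        (hasFDerivAt_const (b i) x)
      refine this.congr_fderiv ?_
      ext; simp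
    have h3 := ((hf.differentiable one_ne_zero) x).hasFDerivAt.fun_mul h2
    rw [h3.fderiv, iteratedFDeriv_two_apply]
    simp
    ring
  constructor
  · simp_rw [key]
    exact integrable_finsetSum _ fun i _ => integrable_fderiv_apply (hF i) (hFc i) _
  · simp_rw [key]
    rw [integral_finsetSum _ fun i _ => integrable_fderiv_apply (hF i) (hFc i) _]
    exact Finset.sum_eq_zero fun i _ => integral_fderiv_apply_eq_zero (hF i) (hFc i) _

end Divergence

/-! ### Radial functions and radial derivatives -/

section Radial

variable {E : Type*} [NormedAddCommGroup E] [InnerProductSpace ℝ E]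

theorem hasFDerivAt_norm_of_ne_zero {x : E} (hx : x ≠ 0) :
    HasFDerivAt (fun y : E => ‖y‖) (‖x‖⁻¹ • innerSL ℝ x) x := by
  have h1 : HasFDerivAt (fun y : E => ‖y‖ ^ 2) (2 • innerSL ℝ x) x :=
    (hasStrictFDerivAt_norm_sq x).hasFDerivAt
  have hn : ‖x‖ ≠ 0 := norm_ne_zero_iff.2 hx
  have h2 := (h1.sqrt (pow_ne_zero 2 hn))
  have h3 : (fun y : E => √(‖y‖ ^ 2)) = fun y => ‖y‖ := by
    ext y; exact Real.sqrt_sq (norm_nonneg y)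
  rw [h3, Real.sqrt_sq (norm_nonneg x)] at h2
  convert h2 using 1
  ext v
  simp
  field_simp

theorem hasFDerivAt_radial {F : Type*} [NormedAddCommGroup F] [NormedSpace ℝ F] {m : ℝ → F}
    {m' : F} {x : E} (hx : x ≠ 0) (hm : HasDerivAt m m' ‖x‖) :
    HasFDerivAt (fun y : E => m ‖y‖) ((‖x‖⁻¹ • innerSL ℝ x).smulRight m') x :=
  HasFDerivAt.congr_fderiv (hm.hasFDerivAt.comp x (hasFDerivAt_norm_of_ne_zero hx))
    (by ext; simp [mul_smul])

/-- A radial function which is `C¹` away from the origin and constant near the origin is `C¹`. -/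
theorem contDiff_radial {F : Type*} [NormedAddCommGroup F] [NormedSpace ℝ F] {m : ℝ → F} {n : ℕ∞}
    (hm : ContDiffOn ℝ n m (Ioi 0)) {ε : ℝ} (hε : 0 < ε) {c : F}
    (hc : ∀ r, 0 ≤ r → r < ε → m r = c) : ContDiff ℝ n (fun y : E => m ‖y‖) := by
  rw [contDiff_iff_contDiffAt]
  intro x
  by_cases hx : x = 0
  · have h : (fun y : E => m ‖y‖) =ᶠ[𝓝 x] fun _ => c := by
      filter_upwards [Metric.ball_mem_nhds x hε] with y hy
      subst hx
      exact hc _ (norm_nonneg y) (by simpa using hy)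
    exact contDiffAt_const.congr_of_eventuallyEq h
  · have h1 : ContDiffAt ℝ n m ‖x‖ := (hm _ (norm_pos_iff.2 hx)).contDiffAt
      (Ioi_mem_nhds (norm_pos_iff.2 hx))
    exact h1.comp x (contDiffAt_norm ℝ hx)

end Radial

theorem two_le_infty : (2 : WithTop ℕ∞) ≤ ∞ := by
  have : ((2 : ℕ∞) : WithTop ℕ∞) ≤ ((⊤ : ℕ∞) : WithTop ℕ∞) := WithTop.coe_le_coe.2 le_top
  exact this

theorem one_add_one_le_infty : (1 + 1 : WithTop ℕ∞) ≤ ∞ := by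
  rw [one_add_one_eq_two]; exact two_le_infty

section RadialDerivative

variable {d : ℕ} {F : Type*} [NormedAddCommGroup F] [NormedSpace ℝ F]

theorem radialDeriv_congr {f g : EuclideanSpace ℝ (Fin d) → F} {x : EuclideanSpace ℝ (Fin d)}
    (h : f =ᶠ[𝓝 x] g) : radialDeriv f x = radialDeriv g x := by
  rw [radialDeriv, radialDeriv, h.fderiv_eq]

theorem fderiv_self_eq_norm_smul_radialDeriv (f : EuclideanSpace ℝ (Fin d) → F)
    {x : EuclideanSpace ℝ (Fin d)} (hx : x ≠ 0) : fderiv ℝ f x x = ‖x‖ • radialDeriv f x := by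
  have hn : ‖x‖ ≠ 0 := norm_ne_zero_iff.2 hx
  rw [radialDeriv, map_smul, smul_smul, mul_inv_cancel₀ hn, one_smul]

theorem radialDeriv_add {f g : EuclideanSpace ℝ (Fin d) → F} {x : EuclideanSpace ℝ (Fin d)}
    (hf : DifferentiableAt ℝ f x) (hg : DifferentiableAt ℝ g x) :
    radialDeriv (fun y => f y + g y) x = radialDeriv f x + radialDeriv g x := by
  rw [radialDeriv, fderiv_fun_add hf hg]; rfl

theorem radialDeriv_mul {f g : EuclideanSpace ℝ (Fin d) → ℂ} {x : EuclideanSpace ℝ (Fin d)}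
    (hf : DifferentiableAt ℝ f x) (hg : DifferentiableAt ℝ g x) :
    radialDeriv (fun y => f y * g y) x = radialDeriv f x * g x + f x * radialDeriv g x := by
  rw [radialDeriv, fderiv_fun_mul hf hg]
  simp [radialDeriv]
  ring

theorem radialDeriv_conj {f : EuclideanSpace ℝ (Fin d) → ℂ} {x : EuclideanSpace ℝ (Fin d)}
    (hf : DifferentiableAt ℝ f x) :
    radialDeriv (fun y => (starRingEnd ℂ) (f y)) x = (starRingEnd ℂ) (radialDeriv f x) := by
  have h := (Complex.conjCLE.toContinuousLinearMap.hasFDerivAt (x := f x)).comp x hf.hasFDerivAt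
  have h' : HasFDerivAt (fun y => (starRingEnd ℂ) (f y))
    (Complex.conjCLE.toContinuousLinearMap.comp (fderiv ℝ f x)) x := h
  rw [radialDeriv, h'.fderiv]
  rfl

theorem radialDeriv_radial {m : ℝ → F} {m' : F} {x : EuclideanSpace ℝ (Fin d)} (hx : x ≠ 0)
    (hm : HasDerivAt m m' ‖x‖) : radialDeriv (fun y => m ‖y‖) x = m' := by
  have hn : ‖x‖ ≠ 0 := norm_ne_zero_iff.2 hx
  rw [radialDeriv, (hasFDerivAt_radial hx hm).fderiv]
  have : ‖x‖⁻¹ * (‖x‖⁻¹ * ‖x‖ ^ 2) = 1 := by field_simp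
  simp [smul_smul, this]

theorem radialDeriv_radial_mul {m : ℝ → ℂ} {m' : ℂ} {f : EuclideanSpace ℝ (Fin d) → ℂ}
    {x : EuclideanSpace ℝ (Fin d)} (hx : x ≠ 0) (hm : HasDerivAt m m' ‖x‖)
    (hf : DifferentiableAt ℝ f x) :
    radialDeriv (fun y => m ‖y‖ * f y) x = m' * f x + m ‖x‖ * radialDeriv f x := by
  rw [radialDeriv_mul (hasFDerivAt_radial hx hm).differentiableAt hf, radialDeriv_radial hx hm]

theorem differentiableAt_radialDeriv {φ : EuclideanSpace ℝ (Fin d) → F} (hφ : ContDiff ℝ ∞ φ)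
    {x : EuclideanSpace ℝ (Fin d)} (hx : x ≠ 0) : DifferentiableAt ℝ (radialDeriv φ) x := by
  have h1 : DifferentiableAt ℝ (fderiv ℝ φ) x :=
    (hφ.fderiv_right (m := 1) one_add_one_le_infty).differentiable one_ne_zero x
  have h2 : DifferentiableAt ℝ (fun y : EuclideanSpace ℝ (Fin d) => ‖y‖⁻¹ • y) x :=
    (((hasFDerivAt_norm_of_ne_zero hx).differentiableAt).inv (norm_ne_zero_iff.2 hx)).smul
      differentiableAt_id
  exact h1.clm_apply h2

/-- The Euler derivative of the Euler derivative, in terms of radial derivatives. -/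
theorem radialDeriv_fderiv_self {φ : EuclideanSpace ℝ (Fin d) → ℂ} (hφ : ContDiff ℝ ∞ φ)
    {x : EuclideanSpace ℝ (Fin d)} (hx : x ≠ 0) :
    radialDeriv (fun y => fderiv ℝ φ y y) x
      = radialDeriv φ x + (‖x‖ : ℂ) * radialDeriv (radialDeriv φ) x := by
  have h : (fun y => fderiv ℝ φ y y) =ᶠ[𝓝 x] fun y => ((‖y‖ : ℝ) : ℂ) * radialDeriv φ y := by
    filter_upwards [isOpen_ne.mem_nhds hx] with y hy
    rw [fderiv_self_eq_norm_smul_radialDeriv φ hy, Complex.real_smul]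
  rw [radialDeriv_congr h, radialDeriv_radial_mul (m := fun r => (r : ℂ)) hx
    (hasDerivAt_id _).ofReal_comp (differentiableAt_radialDeriv hφ hx)]
  simp

end RadialDerivative

/-! ### Integration by parts against a radial multiplier -/

/-- The squared Euclidean norm `|∇φ|²`. -/
def gradSq {d : ℕ} (φ : EuclideanSpace ℝ (Fin d) → ℂ) (x : EuclideanSpace ℝ (Fin d)) : ℝ :=
  ∑ i, ‖fderiv ℝ φ x (stdOrthonormalBasis ℝ (EuclideanSpace ℝ (Fin d)) i)‖ ^ 2

theorem fderiv_self_eq_sum {d : ℕ} (φ : EuclideanSpace ℝ (Fin d) → ℂ)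
    (x y : EuclideanSpace ℝ (Fin d)) :
    fderiv ℝ φ x y = ∑ i, ((inner ℝ (stdOrthonormalBasis ℝ (EuclideanSpace ℝ (Fin d)) i) y : ℝ) : ℂ)
      * fderiv ℝ φ x (stdOrthonormalBasis ℝ (EuclideanSpace ℝ (Fin d)) i) := by
  have h := congrArg (fderiv ℝ φ x)
    ((stdOrthonormalBasis ℝ (EuclideanSpace ℝ (Fin d))).sum_repr' y)
  rw [map_sum] at h
  rw [← h]
  simp

/-- Cauchy–Schwarz in the direction of the unit vector `x / |x|`. It makes the angular energy `|∇φ|²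
- |∂_r φ|²` nonnegative without angular coordinates. -/
theorem norm_radialDeriv_sq_le_gradSq {d : ℕ} (φ : EuclideanSpace ℝ (Fin d) → ℂ)
    {x : EuclideanSpace ℝ (Fin d)} (hx : x ≠ 0) : ‖radialDeriv φ x‖ ^ 2 ≤ gradSq φ x := by
  set b := stdOrthonormalBasis ℝ (EuclideanSpace ℝ (Fin d))
  have hn : ‖x‖ ≠ 0 := norm_ne_zero_iff.2 hx
  have hω : ‖‖x‖⁻¹ • x‖ = 1 := by rw [norm_smul, norm_inv, norm_norm, inv_mul_cancel₀ hn]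
  have h1 : ‖radialDeriv φ x‖ ≤ ∑ i, ‖(inner ℝ (b i) (‖x‖⁻¹ • x) : ℝ)‖ * ‖fderiv ℝ φ x (b i)‖ := by
    rw [radialDeriv, fderiv_self_eq_sum]
    refine (norm_sum_le _ _).trans (Finset.sum_le_sum fun i _ => ?_)
    rw [norm_mul, Complex.norm_real]
  calc ‖radialDeriv φ x‖ ^ 2
      ≤ (∑ i, ‖(inner ℝ (b i) (‖x‖⁻¹ • x) : ℝ)‖ * ‖fderiv ℝ φ x (b i)‖) ^ 2 := by gcongr
    _ ≤ (∑ i, ‖(inner ℝ (b i) (‖x‖⁻¹ • x) : ℝ)‖ ^ 2) * ∑ i, ‖fderiv ℝ φ x (b i)‖ ^ 2 :=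
        Finset.sum_mul_sq_le_sq_mul_sq _ _ _
    _ = gradSq φ x := by
        rw [b.sum_sq_norm_inner_right, hω, gradSq]; simp [b]

/-- The second order operator `a ∂_r² + (a' + (d-1) a / r) ∂_r + t r⁻² Δ_{S^{d-1}}`. -/
def radialOp {d : ℕ} (a t : ℝ → ℂ) (φ : EuclideanSpace ℝ (Fin d) → ℂ)
    (x : EuclideanSpace ℝ (Fin d)) : ℂ :=
  a ‖x‖ * radialDeriv (radialDeriv φ) x
    + (deriv a ‖x‖ + ((d : ℂ) - 1) * a ‖x‖ / ‖x‖) * radialDeriv φ x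
    + t ‖x‖ / (‖x‖ : ℂ) ^ 2 * sphereLaplacian φ x

theorem conj_mul_self_eq_ofReal (z : ℂ) : (starRingEnd ℂ) z * z = ((‖z‖ ^ 2 : ℝ) : ℂ) := by
  rw [mul_comm, Complex.mul_conj, Complex.normSq_eq_norm_sq]

/-- Integration by parts for `radialOp` against the multiplier `M`, with a free radial flux `m`. -/
theorem integral_multiplier_radialOp {d : ℕ} {M a t : ℝ → ℂ} {m : ℝ → ℝ}
    (hM : ContDiffOn ℝ 1 M (Ioi 0)) (ha : ContDiffOn ℝ 1 a (Ioi 0))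
    (ht : ContDiffOn ℝ 1 t (Ioi 0)) (hm : ContDiffOn ℝ 1 m (Ioi 0))
    {ε : ℝ} (hε : 0 < ε)
    (hM0 : ∀ r, 0 ≤ r → r < ε → M r = 1) (ha0 : ∀ r, 0 ≤ r → r < ε → a r = 1)
    (ht0 : ∀ r, 0 ≤ r → r < ε → t r = 1) (hm0 : ∀ r, 0 ≤ r → r < ε → m r = 0)
    {φ : EuclideanSpace ℝ (Fin d) → ℂ} (hφ : ContDiff ℝ ∞ φ) (hc : HasCompactSupport φ) :
    ∃ Z : EuclideanSpace ℝ (Fin d) → ℂ, Integrable Z ∧ ∫ x, Z x = 0 ∧ ∀ x, x ≠ 0 →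
      Z x = M ‖x‖ * (starRingEnd ℂ) (φ x) * radialOp a t φ x
        + deriv M ‖x‖ * a ‖x‖ * ((starRingEnd ℂ) (φ x) * radialDeriv φ x)
        + M ‖x‖ * t ‖x‖ * ((gradSq φ x - ‖radialDeriv φ x‖ ^ 2 : ℝ) : ℂ)
        + M ‖x‖ * a ‖x‖ * ((‖radialDeriv φ x‖ ^ 2 : ℝ) : ℂ)
        + (((1 / 2) * (‖x‖ * deriv m ‖x‖ + d * m ‖x‖) * ‖φ x‖ ^ 2 : ℝ) : ℂ)
        + ((m ‖x‖ * ‖x‖ * ((starRingEnd ℂ) (φ x) * radialDeriv φ x).re : ℝ) : ℂ) := by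
  -- The flux is `M φ̄ (t ∇φ + (a - t) ∂_r φ ω)` plus `½ m |φ|² x`. The part `t ∇φ` is the field `f₁
  -- ∇φ`. The remainder is radial and is written as `f₂(x) x`, using `∂_r φ ω = r^{-2} (x·∇φ) x`. As
  -- `a = t` near the origin, the singular factor `r^{-2}` is cut off and both fields are `C¹`.
  set f₁ : EuclideanSpace ℝ (Fin d) → ℂ :=
    fun x => (fun r => M r * t r) ‖x‖ * (starRingEnd ℂ) (φ x) with hf₁
  set m₂ : ℝ → ℂ := fun r => M r * (a r - t r) * ((r : ℂ) ^ 2)⁻¹ with hm₂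
  set T : EuclideanSpace ℝ (Fin d) → ℂ := fun y => fderiv ℝ φ y y with hT
  set f₂ : EuclideanSpace ℝ (Fin d) → ℂ :=
    fun x => m₂ ‖x‖ * ((starRingEnd ℂ) (φ x) * T x)
      + (fun r => (((1 / 2) * m r : ℝ) : ℂ)) ‖x‖ * ((starRingEnd ℂ) (φ x) * φ x) with hf₂
  have hφ1 : ContDiff ℝ 1 φ := hφ.of_le (by norm_num)
  have hφ2 : ContDiff ℝ 2 φ := hφ.of_le two_le_infty
  have hφc : ContDiff ℝ 1 (fun x => (starRingEnd ℂ) (φ x)) :=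
    Complex.conjCLE.toContinuousLinearMap.contDiff.comp hφ1
  have hTc : ContDiff ℝ 1 T := (hφ.fderiv_right (m := 1) one_add_one_le_infty).clm_apply contDiff_id
  have hcc : HasCompactSupport (fun x => (starRingEnd ℂ) (φ x)) :=
    hc.comp_left (g := starRingEnd ℂ) (map_zero _)
  have hr : ContDiffOn ℝ 1 (fun r : ℝ => ((r : ℂ) ^ 2)⁻¹) (Ioi 0) := by
    refine ContDiffOn.inv ((Complex.ofRealCLM.contDiff.pow 2).contDiffOn) fun r hr => ?_
    exact pow_ne_zero 2 (Complex.ofReal_ne_zero.2 (ne_of_gt hr))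
  have hm₂c : ContDiffOn ℝ 1 m₂ (Ioi 0) := (hM.mul (ha.sub ht)).mul hr
  have hf₁c : ContDiff ℝ 1 f₁ := by
    refine (contDiff_radial (n := 1) (m := fun r => M r * t r) (hM.mul ht) hε (c := 1) ?_).mul hφc
    intro r h0 h1; simp [hM0 r h0 h1, ht0 r h0 h1]
  have hf₂c : ContDiff ℝ 1 f₂ := by
    refine ((contDiff_radial (n := 1) hm₂c hε (c := 0) ?_).mul (hφc.mul hTc)).add
      ((contDiff_radial (n := 1) (m := fun r => (((1 / 2) * m r : ℝ) : ℂ))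
        (Complex.ofRealCLM.contDiff.comp_contDiffOn (contDiffOn_const.mul hm)) hε (c := 0) ?_).mul
        (hφc.mul hφ1))
    · intro r h0 h1; simp [hm₂, ha0 r h0 h1, ht0 r h0 h1]
    · intro r h0 h1; simp [hm0 r h0 h1]
  have hf₁s : HasCompactSupport f₁ := hcc.mul_left
  have hf₂s : HasCompactSupport f₂ := (hcc.mul_right.mul_left).add (hcc.mul_right.mul_left)
  obtain ⟨i1, e1⟩ := integral_divergence_mul_gradient hf₁c hφ2 hf₁s
  obtain ⟨i2, e2⟩ := integral_divergence_smul_id hf₂c hf₂s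
  refine ⟨_, i1.add i2, ?_, ?_⟩
  · simp only [Pi.add_apply]
    rw [integral_add i1 i2, e1, e2, add_zero]
  intro x hx
  have hn : 0 < ‖x‖ := norm_pos_iff.2 hx
  have hn' : (‖x‖ : ℂ) ≠ 0 := Complex.ofReal_ne_zero.2 hn.ne'
  have dM := ((hM.differentiableOn one_ne_zero _ hn).differentiableAt (Ioi_mem_nhds hn)).hasDerivAt
  have da := ((ha.differentiableOn one_ne_zero _ hn).differentiableAt (Ioi_mem_nhds hn)).hasDerivAt
  have dt := ((ht.differentiableOn one_ne_zero _ hn).differentiableAt (Ioi_mem_nhds hn)).hasDerivAt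
  have dm := ((hm.differentiableOn one_ne_zero _ hn).differentiableAt (Ioi_mem_nhds hn)).hasDerivAt
  have dφ : DifferentiableAt ℝ φ x := hφ1.differentiable one_ne_zero x
  have dφc : DifferentiableAt ℝ (fun x => (starRingEnd ℂ) (φ x)) x :=
    hφc.differentiable one_ne_zero x
  have dT : DifferentiableAt ℝ T x := hTc.differentiable one_ne_zero x
  have dr : HasDerivAt (fun r : ℝ => ((r : ℂ) ^ 2)⁻¹) (-2 / (‖x‖ : ℂ) ^ 3) ‖x‖ := by
    have h := (((hasDerivAt_id ‖x‖).ofReal_comp).fun_pow 2).fun_inv (pow_ne_zero 2 hn')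
    refine h.congr_deriv ?_
    simp only [id]
    field_simp
    simp
    ring
  have dm₂ := (dM.fun_mul (da.fun_sub dt)).fun_mul dr
  have dm3 : HasDerivAt (fun r => (((1 / 2) * m r : ℝ) : ℂ)) (((1 / 2) * deriv m ‖x‖ : ℝ) : ℂ) ‖x‖ :=
    (dm.const_mul (1 / 2 : ℝ)).ofReal_comp
  have eT : T x = ‖x‖ * radialDeriv φ x := by
    rw [hT, ← Complex.real_smul]; exact fderiv_self_eq_norm_smul_radialDeriv φ hx
  have E2 : fderiv ℝ f₂ x x = ‖x‖ * radialDeriv f₂ x := by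
    rw [fderiv_self_eq_norm_smul_radialDeriv f₂ hx, Complex.real_smul]
  have E3 : radialDeriv f₂ x = _ := radialDeriv_add
    ((hasFDerivAt_radial hx dm₂).differentiableAt.fun_mul (dφc.fun_mul dT))
    ((hasFDerivAt_radial hx dm3).differentiableAt.fun_mul (dφc.fun_mul dφ))
  rw [radialDeriv_radial_mul hx dm₂ (dφc.fun_mul dT),
    radialDeriv_radial_mul hx dm3 (dφc.fun_mul dφ), radialDeriv_mul dφc dT,
    radialDeriv_mul dφc dφ, radialDeriv_conj dφ, radialDeriv_fderiv_self hφ hx] at E3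
  have E1 : ∑ i, fderiv ℝ f₁ x (stdOrthonormalBasis ℝ (EuclideanSpace ℝ (Fin d)) i)
        * fderiv ℝ φ x (stdOrthonormalBasis ℝ (EuclideanSpace ℝ (Fin d)) i)
      = (deriv M ‖x‖ * t ‖x‖ + M ‖x‖ * deriv t ‖x‖) * (starRingEnd ℂ) (φ x) * radialDeriv φ x
        + M ‖x‖ * t ‖x‖ * ((gradSq φ x : ℝ) : ℂ) := by
    have hd1 := (hasFDerivAt_radial hx (dM.fun_mul dt)).fun_mul
      ((Complex.conjCLE.toContinuousLinearMap.hasFDerivAt (x := φ x)).comp x dφ.hasFDerivAt)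
    have hd2 : HasFDerivAt f₁ _ x := hd1
    rw [hd2.fderiv, radialDeriv, map_smul, fderiv_self_eq_sum φ x x, gradSq, Complex.ofReal_sum,
      Finset.smul_sum, Finset.mul_sum, Finset.mul_sum, ← Finset.sum_add_distrib]
    refine Finset.sum_congr rfl fun i _ => ?_
    rw [← conj_mul_self_eq_ofReal]
    simp only [Function.comp, _root_.add_apply, _root_.smul_apply,
      ContinuousLinearMap.smulRight_apply, ContinuousLinearMap.comp_apply, innerSL_apply_apply,
      smul_eq_mul, Complex.real_smul, ContinuousLinearEquiv.coe_coe, Complex.conjCLE_apply,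
      real_inner_comm]
    push_cast
    ring
  have E4 : f₂ x = m₂ ‖x‖ * ((starRingEnd ℂ) (φ x) * T x)
      + (((1 / 2) * m ‖x‖ : ℝ) : ℂ) * ((starRingEnd ℂ) (φ x) * φ x) := rfl
  have Ere : ((((starRingEnd ℂ) (φ x) * radialDeriv φ x).re : ℝ) : ℂ)
      = ((starRingEnd ℂ) (φ x) * radialDeriv φ x + (starRingEnd ℂ) (radialDeriv φ x) * φ x) / 2 := by
    rw [Complex.re_eq_add_conj]
    simp
    ring
  have hfin : (Module.finrank ℝ (EuclideanSpace ℝ (Fin d)) : ℂ) = d := by simp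
  simp only [Pi.add_apply]
  rw [E1, E2, E3, E4, hfin]
  have hf₁x : f₁ x = M ‖x‖ * t ‖x‖ * (starRingEnd ℂ) (φ x) := rfl
  rw [hf₁x, radialOp, sphereLaplacian, hm₂, eT]
  push_cast
  rw [Ere]
  have g1 : ((‖radialDeriv φ x‖ : ℝ) : ℂ) ^ 2
      = (starRingEnd ℂ) (radialDeriv φ x) * radialDeriv φ x := by
    rw [conj_mul_self_eq_ofReal]; push_cast; rfl
  have g2 : ((‖φ x‖ : ℝ) : ℂ) ^ 2 = (starRingEnd ℂ) (φ x) * φ x := by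
    rw [conj_mul_self_eq_ofReal]; push_cast; rfl
  rw [g1, g2]
  generalize (starRingEnd ℂ) (φ x) = A
  generalize (starRingEnd ℂ) (radialDeriv φ x) = B
  generalize φ x = A'
  generalize radialDeriv φ x = B'
  field_simp
  ring

/-! ### The distorted Laplacian in divergence form -/

/-- The bound on the imaginary part keeps `z` on the principal branch, so that the principal powers
`J^{±1/2}` are exponentials of half the exponent of `J`. -/
theorem exp_cpow_of_abs_im_lt {z : ℂ} (hz : |z.im| < Real.pi) (c : ℂ) :
    Complex.exp z ^ c = Complex.exp (c * z) := by
  rw [Complex.cpow_def_of_ne_zero (Complex.exp_ne_zero z),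
    Complex.log_exp (abs_lt.1 hz).1 (abs_lt.1 hz).2.le, mul_comm]

/-- The zeroth order term of the distorted Laplacian with `∂_r r_θ = exp ℓ` and
`r_θ = r exp τ`. -/
def distortionPotential (d : ℕ) (l τ : ℝ → ℂ) (r : ℝ) : ℂ :=
  let p : ℂ := -(1 / 2) * (deriv l r + ((d : ℂ) - 1) * deriv τ r)
  let p' : ℂ := -(1 / 2) * (deriv (deriv l) r + ((d : ℂ) - 1) * deriv (deriv τ) r)
  Complex.exp (-2 * l r) * (-deriv l r * p + p' + p ^ 2)
    + ((d : ℂ) - 1) * Complex.exp (-l r - τ r) * p / r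

theorem hasDerivAt_of_contDiffOn_two {f : ℝ → ℂ} (hf : ContDiffOn ℝ 2 f (Ioi 0)) {r : ℝ}
    (hr : 0 < r) : HasDerivAt f (deriv f r) r ∧ HasDerivAt (deriv f) (deriv (deriv f) r) r := by
  have h1 : ContDiffAt ℝ 2 f r := (hf r hr).contDiffAt (Ioi_mem_nhds hr)
  have h2 : ContDiffOn ℝ 1 (deriv f) (Ioi 0) :=
    ((contDiffOn_succ_iff_deriv_of_isOpen (n := 1) isOpen_Ioi).1
      (by simpa [one_add_one_eq_two] using hf)).2.2
  exact ⟨(h1.differentiableAt two_ne_zero).hasDerivAt,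
    (((h2 r hr).contDiffAt (Ioi_mem_nhds hr)).differentiableAt one_ne_zero).hasDerivAt⟩

/-- Conjugation by `J^{1/2}` is what makes the operator formally symmetric for real `θ`. In the
first order terms the derivatives of `τ` cancel by `hrel`, leaving `a' + (d-1) a / r`; what remains
is of order zero and is collected in `distortionPotential`. -/
theorem distortedLaplacian_eq {d : ℕ} (hd : 1 ≤ d) {s R : ℝ} {χ₁ : ℝ → ℝ} {θ : ℂ}
    {l τ : ℝ → ℂ} (hl : ContDiffOn ℝ 2 l (Ioi 0)) (hτ : ContDiffOn ℝ 2 τ (Ioi 0))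
    (hrad : ∀ r, 0 < r → radius s R χ₁ θ r = r * Complex.exp (τ r))
    (hder : ∀ r, 0 < r → radiusDeriv s R χ₁ θ r = Complex.exp (l r))
    (hrel : ∀ r, 0 < r → Complex.exp (l r) = Complex.exp (τ r) * (1 + r * deriv τ r))
    (him : ∀ r, 0 < r → |(l r + ((d : ℂ) - 1) * τ r).im| < Real.pi)
    {φ : EuclideanSpace ℝ (Fin d) → ℂ} (hφ : ContDiff ℝ ∞ φ)
    {x : EuclideanSpace ℝ (Fin d)} (hx : x ≠ 0) :
    distortedLaplacian s R χ₁ θ φ x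
      = radialOp (fun r => Complex.exp (-2 * l r)) (fun r => Complex.exp (-2 * τ r)) φ x
        + distortionPotential d l τ ‖x‖ * φ x := by
  set lam : ℝ → ℂ := fun r => l r + ((d : ℂ) - 1) * τ r with hlam
  set p : ℝ → ℂ := fun r => -(1 / 2) * (deriv l r + ((d : ℂ) - 1) * deriv τ r) with hp
  have hJ : ∀ r, 0 < r → jacobian d s R χ₁ θ r = Complex.exp (lam r) := by
    intro r hr
    have hr' : (r : ℂ) ≠ 0 := Complex.ofReal_ne_zero.2 hr.ne'
    rw [jacobian, hrad r hr, hder r hr, mul_div_cancel_left₀ _ hr', ← Complex.exp_nat_mul,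
      ← Complex.exp_add, hlam, Nat.cast_sub hd]
    push_cast
    ring_nf
  have dlam : ∀ r, 0 < r → HasDerivAt (fun r => Complex.exp (-(1 / 2) * lam r))
      (Complex.exp (-(1 / 2) * lam r) * p r) r := by
    intro r hr
    have h := (((hasDerivAt_of_contDiffOn_two hl hr).1.fun_add
      ((hasDerivAt_of_contDiffOn_two hτ hr).1.const_mul ((d : ℂ) - 1))).const_mul
        (-(1 / 2) : ℂ)).cexp
    exact h
  have dp : ∀ r, 0 < r → HasDerivAt p
      (-(1 / 2) * (deriv (deriv l) r + ((d : ℂ) - 1) * deriv (deriv τ) r)) r := by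
    intro r hr
    exact ((hasDerivAt_of_contDiffOn_two hl hr).2.fun_add
      ((hasDerivAt_of_contDiffOn_two hτ hr).2.const_mul ((d : ℂ) - 1))).const_mul (-(1 / 2) : ℂ)
  have dφ : ∀ y, DifferentiableAt ℝ φ y := fun y => hφ.differentiable (by simp) y
  set ψ : EuclideanSpace ℝ (Fin d) → ℂ :=
    fun y => jacobian d s R χ₁ θ ‖y‖ ^ (-(1 / 2) : ℂ) * φ y with hψ
  have hψ1 : ∀ y, y ≠ 0 → radialDeriv ψ y
      = Complex.exp (-(1 / 2) * lam ‖y‖) * (p ‖y‖ * φ y + radialDeriv φ y) := by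
    intro y hy
    have h : ψ =ᶠ[𝓝 y] fun y => (fun r => Complex.exp (-(1 / 2) * lam r)) ‖y‖ * φ y := by
      filter_upwards [isOpen_ne.mem_nhds hy] with z hz
      rw [hψ]
      simp only
      rw [hJ _ (norm_pos_iff.2 hz), exp_cpow_of_abs_im_lt (him _ (norm_pos_iff.2 hz))]
    rw [radialDeriv_congr h, radialDeriv_radial_mul hy (dlam _ (norm_pos_iff.2 hy)) (dφ y)]
    ring
  have hn : 0 < ‖x‖ := norm_pos_iff.2 hx
  have hn' : (‖x‖ : ℂ) ≠ 0 := Complex.ofReal_ne_zero.2 hn.ne'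
  have dl := (hasDerivAt_of_contDiffOn_two hl hn).1
  have h2 : (fun y => (radiusDeriv s R χ₁ θ ‖y‖)⁻¹ * radialDeriv ψ y) =ᶠ[𝓝 x]
      fun y => (fun r => Complex.exp (-l r) * Complex.exp (-(1 / 2) * lam r)) ‖y‖
        * (p ‖y‖ * φ y + radialDeriv φ y) := by
    filter_upwards [isOpen_ne.mem_nhds hx] with y hy
    rw [hψ1 y hy, hder _ (norm_pos_iff.2 hy), ← Complex.exp_neg]
    ring
  have dm := (dl.fun_neg.cexp).fun_mul (dlam _ hn)
  have dpf := (hasFDerivAt_radial hx (dp _ hn)).differentiableAt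
  have dφr := differentiableAt_radialDeriv hφ hx
  have h3 := (radialDeriv_congr h2).trans
    (radialDeriv_radial_mul hx dm ((dpf.fun_mul (dφ x)).fun_add dφr))
  rw [radialDeriv_add (dpf.fun_mul (dφ x)) dφr, radialDeriv_radial_mul hx (dp _ hn) (dφ x)] at h3
  have da : deriv (fun r => Complex.exp (-2 * l r)) ‖x‖
      = Complex.exp (-2 * l ‖x‖) * (-2 * deriv l ‖x‖) := (dl.const_mul (-2 : ℂ)).cexp.deriv
  have e1 : Complex.exp ((1 / 2) * lam ‖x‖) * Complex.exp (-(1 / 2) * lam ‖x‖) = 1 := by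
    rw [← Complex.exp_add]; simp
  have e2 : Complex.exp (-2 * l ‖x‖) = Complex.exp (-l ‖x‖) ^ 2 := by
    rw [← Complex.exp_nat_mul]; push_cast; ring_nf
  have e3 : Complex.exp (-2 * τ ‖x‖) = Complex.exp (-τ ‖x‖) ^ 2 := by
    rw [← Complex.exp_nat_mul]; push_cast; ring_nf
  have e4 : Complex.exp (-l ‖x‖ - τ ‖x‖) = Complex.exp (-l ‖x‖) * Complex.exp (-τ ‖x‖) := by
    rw [← Complex.exp_add]; ring_nf
  -- This relation between `r_θ` and `∂_r r_θ` is what cancels the `τ'` terms.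
  have e5 : Complex.exp (-τ ‖x‖) = Complex.exp (-l ‖x‖) * (1 + ‖x‖ * deriv τ ‖x‖) := by
    have h := hrel _ hn
    rw [Complex.exp_neg, Complex.exp_neg, h]
    have h0 : (1 + ‖x‖ * deriv τ ‖x‖ : ℂ) ≠ 0 := by
      intro h0; rw [h0, mul_zero] at h; exact Complex.exp_ne_zero _ h
    field_simp
  rw [distortedLaplacian]
  rw [h3, hψ1 x hx, hJ _ hn, exp_cpow_of_abs_im_lt (him _ hn), hder _ hn, hrad _ hn, radialOp,
    distortionPotential, da, mul_inv, ← Complex.exp_neg, ← Complex.exp_neg, e2, e3, e4]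
  simp only [hp]
  generalize radialDeriv (radialDeriv φ) x = φ2
  generalize radialDeriv φ x = φ1
  generalize φ x = φ0
  generalize sphereLaplacian φ x = S
  rw [show l ‖x‖ + ((d : ℂ) - 1) * τ ‖x‖ = lam ‖x‖ from rfl]
  generalize Complex.exp (-(1 / 2) * lam ‖x‖) = X at *
  generalize Complex.exp (1 / 2 * lam ‖x‖) = Y at *
  rw [e5]
  generalize Complex.exp (-l ‖x‖) = b at *
  generalize deriv l ‖x‖ = l1
  generalize deriv τ ‖x‖ = t1
  generalize (deriv (deriv l) ‖x‖) = l2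
  generalize (deriv (deriv τ) ‖x‖) = t2
  have hX : X = Y⁻¹ := eq_inv_of_mul_eq_one_right e1
  have hY : Y ≠ 0 := left_ne_zero_of_mul_eq_one e1
  subst hX
  field_simp
  ring

/-! ### Exponents, partition of unity and the multiplier -/

/-- A `C²` function of the radius, vanishing on `[0, R)`, bounded by `B` together with its first
two derivatives. -/
structure IsExponent (R B : ℝ) (f : ℝ → ℂ) : Prop where
  contDiffOn : ContDiffOn ℝ 2 f (Ioi 0)
  eq_zero : ∀ r, 0 ≤ r → r < R → f r = 0
  norm_le : ∀ r, 0 < r → ‖f r‖ ≤ B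
  norm_deriv_le : ∀ r, 0 < r → ‖deriv f r‖ ≤ B
  norm_deriv_deriv_le : ∀ r, 0 < r → ‖deriv (deriv f) r‖ ≤ B

theorem IsExponent.deriv_eq_zero {R B : ℝ} {f : ℝ → ℂ} (hf : IsExponent R B f) {r : ℝ}
    (h0 : 0 < r) (h1 : r < R) : deriv f r = 0 := by
  have h : f =ᶠ[𝓝 r] fun _ => 0 := by
    filter_upwards [Ioo_mem_nhds h0 h1] with t ht
    exact hf.eq_zero t ht.1.le ht.2
  rw [h.deriv_eq]; simp

/-- The singularity of `1/r` is never met: the derivative vanishes for `r < R`, and beyond that `1/r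
≤ 1/R`. -/
theorem IsExponent.norm_deriv_div_le {R B : ℝ} (hR : 0 < R) {f : ℝ → ℂ} (hf : IsExponent R B f)
    {r : ℝ} (hr : 0 < r) : ‖deriv f r‖ / r ≤ B / R := by
  rcases lt_or_ge r R with h | h
  · have hB : 0 ≤ B := (norm_nonneg _).trans (hf.norm_le r hr)
    rw [hf.deriv_eq_zero hr h]
    simp
    positivity
  · have hB : 0 ≤ B := (norm_nonneg _).trans (hf.norm_le r hr)
    exact div_le_div₀ hB (hf.norm_deriv_le r hr) hR h

/-- The pair `χ`, `χ'` is a `C¹` quadratic partition of unity with `χ = 1` near `0`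
and `|∂_r χ| ≤ D` where `χ` does not vanish. -/
structure IsPartition (χ χ' : ℝ → ℝ) (ε D : ℝ) : Prop where
  contDiffOn : ContDiffOn ℝ 1 χ (Ioi 0)
  contDiffOn' : ContDiffOn ℝ 1 χ' (Ioi 0)
  sq_add_sq : ∀ r, 0 ≤ r → χ r ^ 2 + χ' r ^ 2 = 1
  pos : 0 < ε
  eq_one : ∀ r, 0 ≤ r → r < ε → χ r = 1
  abs_deriv_le : ∀ r, 0 < r → χ r ≠ 0 → |deriv χ r| ≤ D
  nonneg : 0 ≤ D

theorem IsPartition.sq_le {χ χ' : ℝ → ℝ} {ε D : ℝ} (h : IsPartition χ χ' ε D) {r : ℝ}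
    (hr : 0 ≤ r) : χ r ^ 2 ≤ 1 ∧ χ' r ^ 2 ≤ 1 := by
  have := h.sq_add_sq r hr
  constructor <;> nlinarith [sq_nonneg (χ r), sq_nonneg (χ' r)]

theorem IsPartition.abs_mul_deriv_le {χ χ' : ℝ → ℝ} {ε D : ℝ} (h : IsPartition χ χ' ε D) {r : ℝ}
    (hr : 0 < r) : |χ r * deriv χ r| ≤ D := by
  by_cases h0 : χ r = 0
  · simp [h0, h.nonneg]
  · rw [abs_mul]
    have h1 : |χ r| ≤ 1 := by
      rw [← sq_le_one_iff_abs_le_one]; exact (h.sq_le hr.le).1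
    calc |χ r| * |deriv χ r| ≤ 1 * D :=
          mul_le_mul h1 (h.abs_deriv_le r hr h0) (abs_nonneg _) zero_le_one
      _ = D := one_mul _

theorem hasDerivAt_of_contDiffOn_one {F : Type*} [NormedAddCommGroup F] [NormedSpace ℝ F]
    {f : ℝ → F} (hf : ContDiffOn ℝ 1 f (Ioi 0)) {r : ℝ}
    (hr : 0 < r) : HasDerivAt f (deriv f r) r :=
  ((hf.differentiableOn one_ne_zero r hr).differentiableAt (Ioi_mem_nhds hr)).hasDerivAt

/-- Half the derivative of the identity `χ² + χ'² = 1`. It trades the derivative of `χ'`, on which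
no bound is assumed, for that of `χ`. -/
theorem IsPartition.mul_deriv_add {χ χ' : ℝ → ℝ} {ε D : ℝ} (h : IsPartition χ χ' ε D) {r : ℝ}
    (hr : 0 < r) : χ' r * deriv χ' r = -(χ r * deriv χ r) := by
  have h1 := ((hasDerivAt_of_contDiffOn_one h.contDiffOn hr).fun_pow 2).fun_add
    ((hasDerivAt_of_contDiffOn_one h.contDiffOn' hr).fun_pow 2)
  have h2 : (fun r => χ r ^ 2 + χ' r ^ 2) =ᶠ[𝓝 r] fun _ => 1 := by
    filter_upwards [Ioi_mem_nhds hr] with t ht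
    exact h.sq_add_sq t (le_of_lt ht)
  have h3 := (h1.congr_of_eventuallyEq h2.symm).unique (hasDerivAt_const r (1 : ℝ))
  ring_nf at h3 ⊢
  linarith

/-- The multiplier `χ² + i χ'² exp(2i Im l)`. -/
def multiplier (χ χ' : ℝ → ℝ) (l : ℝ → ℂ) (r : ℝ) : ℂ :=
  ((χ r ^ 2 : ℝ) : ℂ) + Complex.I * ((χ' r ^ 2 : ℝ) : ℂ) * Complex.exp (((2 * (l r).im : ℝ) : ℂ)
    * Complex.I)

theorem norm_multiplier_le {χ χ' : ℝ → ℝ} {ε D : ℝ} (h : IsPartition χ χ' ε D) (l : ℝ → ℂ)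
    {r : ℝ} (hr : 0 ≤ r) : ‖multiplier χ χ' l r‖ ≤ 1 := by
  refine (norm_add_le _ _).trans ?_
  rw [norm_mul, norm_mul, Complex.norm_exp_ofReal_mul_I, Complex.norm_I, Complex.norm_real,
    Complex.norm_real, Real.norm_of_nonneg (sq_nonneg _), Real.norm_of_nonneg (sq_nonneg _)]
  linarith [h.sq_add_sq r hr]

/-- The phase in the multiplier is chosen for this: it turns `a = exp(-2l)` into its modulus. -/
theorem exp_phase_mul_exp (z : ℂ) :
    Complex.exp (((2 * z.im : ℝ) : ℂ) * Complex.I) * Complex.exp (-2 * z)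
      = ((Real.exp (-2 * z.re) : ℝ) : ℂ) := by
  rw [← Complex.exp_add, Complex.ofReal_exp]
  congr 1
  apply Complex.ext <;> simp

/-- The cosine of an angle of size at most `1` is at least `1/2`. -/
theorem half_exp_le_re_exp {z : ℂ} (hz : |2 * z.im| ≤ 1) :
    Real.exp (-2 * z.re) / 2 ≤ (Complex.exp (-2 * z)).re := by
  rw [Complex.exp_re]
  have h1 : (-2 * z).re = -2 * z.re := by simp
  have h2 : (-2 * z).im = -(2 * z.im) := by simp
  rw [h1, h2, Real.cos_neg]
  have h3 := Real.one_sub_sq_div_two_le_cos (x := 2 * z.im)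
  have h4 : (2 * z.im) ^ 2 ≤ 1 := (sq_le_one_iff_abs_le_one _).2 hz
  nlinarith [Real.exp_pos (-2 * z.re)]

theorem multiplier_mul_re {χ χ' : ℝ → ℝ} (l : ℝ → ℂ) (r : ℝ) (w : ℂ) :
    (multiplier χ χ' l r * w).re = χ r ^ 2 * w.re
      - χ' r ^ 2 * (Complex.exp (((2 * (l r).im : ℝ) : ℂ) * Complex.I) * w).im := by
  rw [multiplier, add_mul, Complex.add_re, Complex.re_ofReal_mul, mul_assoc, mul_assoc,
    Complex.I_mul_re, Complex.im_ofReal_mul]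
  ring

/-- Sign of the angular energy. On the rotated part the coefficient becomes `|exp(-2l)|` times
`exp(2(l - τ))`, and multiplication by `i` turns its nonpositive imaginary part into a nonnegative
real part. -/
theorem multiplier_mul_exp_re_nonneg {χ χ' : ℝ → ℝ} {l τ : ℝ → ℂ} {r : ℝ}
    (hτ : |2 * (τ r).im| ≤ 1)
    (hang : χ' r ≠ 0 → (Complex.exp (l r - τ r) ^ 2).im ≤ 0) :
    0 ≤ (multiplier χ χ' l r * Complex.exp (-2 * τ r)).re := by
  rw [multiplier_mul_re]
  have h1 : 0 ≤ (Complex.exp (-2 * τ r)).re :=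
    (by positivity : (0 : ℝ) ≤ Real.exp (-2 * (τ r).re) / 2).trans (half_exp_le_re_exp hτ)
  have h2 : Complex.exp (((2 * (l r).im : ℝ) : ℂ) * Complex.I) * Complex.exp (-2 * τ r)
      = ((Real.exp (-2 * (l r).re) : ℝ) : ℂ) * Complex.exp (l r - τ r) ^ 2 := by
    rw [← exp_phase_mul_exp]
    simp only [← Complex.exp_nat_mul, ← Complex.exp_add]
    congr 1
    push_cast; ring
  have h3 : 0 ≤ -(χ' r ^ 2 * (Complex.exp (((2 * (l r).im : ℝ) : ℂ) * Complex.I)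
      * Complex.exp (-2 * τ r)).im) := by
    by_cases h0 : χ' r = 0
    · simp [h0]
    · rw [h2, Complex.im_ofReal_mul]
      have := mul_nonneg (sq_nonneg (χ' r)) (mul_nonneg (Real.exp_pos (-2 * (l r).re)).le
        (neg_nonneg.2 (hang h0)))
      linarith
  have := mul_nonneg (sq_nonneg (χ r)) h1
  linarith

/-! ### Lower bound for the kinetic energy -/

section Kinetic

variable {χ χ' : ℝ → ℝ} {ε D R B : ℝ} {l : ℝ → ℂ}

/-- The radial flux `χ'² (2 Im l') |a| / r`, where `a = exp (-2 l)`, which compensates the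
derivative of the phase of the multiplier. -/
def phaseFlux (χ' : ℝ → ℝ) (l : ℝ → ℂ) (r : ℝ) : ℝ :=
  χ' r ^ 2 * (2 * (deriv l r).im) * Real.exp (-2 * (l r).re) * r⁻¹

theorem hasDerivAt_im {f : ℝ → ℂ} {f' : ℂ} {r : ℝ} (h : HasDerivAt f f' r) :
    HasDerivAt (fun t => (f t).im) f'.im r :=
  Complex.imCLM.hasFDerivAt.comp_hasDerivAt r h

theorem hasDerivAt_re {f : ℝ → ℂ} {f' : ℂ} {r : ℝ} (h : HasDerivAt f f' r) :
    HasDerivAt (fun t => (f t).re) f'.re r :=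
  Complex.reCLM.hasFDerivAt.comp_hasDerivAt r h

theorem contDiffOn_phaseFlux (hχ : IsPartition χ χ' ε D) (hl : IsExponent R B l) :
    ContDiffOn ℝ 1 (phaseFlux χ' l) (Ioi 0) := by
  have h1 : ContDiffOn ℝ 1 (deriv l) (Ioi 0) :=
    ((contDiffOn_succ_iff_deriv_of_isOpen (n := 1) isOpen_Ioi).1
      (by simpa [one_add_one_eq_two] using hl.contDiffOn)).2.2
  have h2 : ContDiffOn ℝ 1 l (Ioi 0) := hl.contDiffOn.of_le (by norm_num)
  have h3 : ContDiffOn ℝ 1 (fun r => (deriv l r).im) (Ioi 0) :=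
    Complex.imCLM.contDiff.comp_contDiffOn h1
  have h4 : ContDiffOn ℝ 1 (fun r => (l r).re) (Ioi 0) :=
    Complex.reCLM.contDiff.comp_contDiffOn h2
  refine (((hχ.contDiffOn'.pow 2).mul (contDiffOn_const.mul h3)).mul
    (Real.contDiff_exp.comp_contDiffOn (contDiffOn_const.mul h4))).mul ?_
  exact contDiffOn_id.inv fun r hr => ne_of_gt hr

/-- The combination `r m' + m` differentiates everything except the factor `1/r`, so no singular
term survives. Only `χ ∂_rχ` occurs, again thanks to the partition identity. -/
theorem hasDerivAt_phaseFlux (hχ : IsPartition χ χ' ε D) (hl : IsExponent R B l) {r : ℝ}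
    (hr : 0 < r) : r * deriv (phaseFlux χ' l) r + phaseFlux χ' l r
      = (-2 * (χ r * deriv χ r) * (2 * (deriv l r).im)
        + χ' r ^ 2 * (2 * (deriv (deriv l) r).im)
        + χ' r ^ 2 * (2 * (deriv l r).im) * (-2 * (deriv l r).re)) * Real.exp (-2 * (l r).re) := by
  obtain ⟨d1, d2⟩ := hasDerivAt_of_contDiffOn_two hl.contDiffOn hr
  have h := (((((hasDerivAt_of_contDiffOn_one hχ.contDiffOn' hr).fun_pow 2).fun_mul
    ((hasDerivAt_im d2).const_mul 2)).fun_mul ((hasDerivAt_re d1).const_mul (-2)).exp).fun_mul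
    (hasDerivAt_inv hr.ne'))
  have h' : deriv (phaseFlux χ' l) r = _ := h.deriv
  rw [h', phaseFlux]
  have e := hχ.mul_deriv_add hr
  simp only [Nat.cast_ofNat]
  have e' : χ r * deriv χ r = -(χ' r * deriv χ' r) := by rw [e, neg_neg]
  rw [e']
  field_simp
  ring

theorem contDiffOn_multiplier (hχ : IsPartition χ χ' ε D) (hl : IsExponent R B l) :
    ContDiffOn ℝ 1 (multiplier χ χ' l) (Ioi 0) := by
  have h2 : ContDiffOn ℝ 1 l (Ioi 0) := hl.contDiffOn.of_le (by norm_num)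
  have h3 : ContDiffOn ℝ 1 (fun r => (l r).im) (Ioi 0) :=
    Complex.imCLM.contDiff.comp_contDiffOn h2
  have o : ∀ {f : ℝ → ℝ}, ContDiffOn ℝ 1 f (Ioi 0) → ContDiffOn ℝ 1 (fun r => (f r : ℂ)) (Ioi 0) :=
    fun hf => Complex.ofRealCLM.contDiff.comp_contDiffOn hf
  exact (o (hχ.contDiffOn.pow 2)).add ((contDiffOn_const.mul (o (hχ.contDiffOn'.pow 2))).mul
    ((o (contDiffOn_const.mul h3)).mul contDiffOn_const).cexp)

/-- Differentiating the phase gives `i · 2i Im l' = -2 Im l'` times `χ'² |a|`: a real coefficient,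
cancelled by the flux. Differentiating the partition leaves only terms with a factor `χ ∂_rχ`. -/
theorem deriv_multiplier_mul_exp (hχ : IsPartition χ χ' ε D) (hl : IsExponent R B l) {r : ℝ}
    (hr : 0 < r) : deriv (multiplier χ χ' l) r * Complex.exp (-2 * l r)
      = ((2 * (χ r * deriv χ r) : ℝ) : ℂ)
          * (Complex.exp (-2 * l r) - Complex.I * (Real.exp (-2 * (l r).re) : ℝ))
        - ((phaseFlux χ' l r * r : ℝ) : ℂ) := by
  obtain ⟨d1, d2⟩ := hasDerivAt_of_contDiffOn_two hl.contDiffOn hr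
  have h := (((hasDerivAt_of_contDiffOn_one hχ.contDiffOn hr).fun_pow 2).ofReal_comp).fun_add
    ((((((hasDerivAt_of_contDiffOn_one hχ.contDiffOn' hr).fun_pow 2).ofReal_comp).const_mul
      Complex.I)).fun_mul
      ((((hasDerivAt_im d1).const_mul 2).ofReal_comp.mul_const Complex.I).cexp))
  have h' : deriv (multiplier χ χ' l) r = _ := h.deriv
  have e := hχ.mul_deriv_add hr
  have e' : ((χ r : ℂ) * (deriv χ r : ℝ)) + (χ' r : ℂ) * (deriv χ' r : ℝ) = 0 := by
    rw [← Complex.ofReal_mul, ← Complex.ofReal_mul, e]; simp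
  have e2 := exp_phase_mul_exp (l r)
  have hp : phaseFlux χ' l r * r
      = χ' r ^ 2 * (2 * (deriv l r).im) * Real.exp (-2 * (l r).re) := by
    rw [phaseFlux]; field_simp
  rw [h', hp]
  generalize Complex.exp (((2 * (l r).im : ℝ) : ℂ) * Complex.I) = P at *
  generalize Complex.exp (-2 * l r) = X at *
  generalize Real.exp (-2 * (l r).re) = y at *
  push_cast
  linear_combination (2 * Complex.I * P * X) * e'
    + (χ' r : ℂ) ^ 2 * 2 * ((deriv l r).im : ℂ) * P * X * Complex.I_sq
    - (2 * (χ r : ℂ) * (deriv χ r : ℝ) * Complex.I + (χ' r : ℂ) ^ 2 * 2 * ((deriv l r).im : ℂ)) * e2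

end Kinetic

theorem abs_phaseFlux_bound {χ χ' : ℝ → ℝ} {ε D R B : ℝ} {l : ℝ → ℂ} (hR : 0 < R)
    (hχ : IsPartition χ χ' ε D) (hl : IsExponent R B l) (d : ℕ) {r : ℝ} (hr : 0 < r) :
    |r * deriv (phaseFlux χ' l) r + d * phaseFlux χ' l r|
      ≤ (2 * D * (2 * B) + 2 * B + 2 * B * (2 * B) + (d + 1) * (2 * (B / R))) * Real.exp (2 * B) := by
  have hB : 0 ≤ B := (norm_nonneg _).trans (hl.norm_le r hr)
  have hD := hχ.nonneg
  have hA : Real.exp (-2 * (l r).re) ≤ Real.exp (2 * B) := by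
    apply Real.exp_le_exp.2
    have := (abs_le.1 ((Complex.abs_re_le_norm (l r)).trans (hl.norm_le r hr))).1
    linarith
  have h1 : |(deriv l r).im| ≤ B := (Complex.abs_im_le_norm _).trans (hl.norm_deriv_le r hr)
  have h1' : |(deriv l r).re| ≤ B := (Complex.abs_re_le_norm _).trans (hl.norm_deriv_le r hr)
  have h2 : |(deriv (deriv l) r).im| ≤ B :=
    (Complex.abs_im_le_norm _).trans (hl.norm_deriv_deriv_le r hr)
  have h3 : |(deriv l r).im| / r ≤ B / R :=
    (div_le_div_of_nonneg_right (Complex.abs_im_le_norm _) hr.le).trans (hl.norm_deriv_div_le hR hr)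
  have h4 := hχ.abs_mul_deriv_le hr
  have h5 := (hχ.sq_le hr.le).2
  have h6 := sq_nonneg (χ' r)
  have e : r * deriv (phaseFlux χ' l) r + d * phaseFlux χ' l r
      = (-2 * (χ r * deriv χ r) * (2 * (deriv l r).im)
        + χ' r ^ 2 * (2 * (deriv (deriv l) r).im)
        + χ' r ^ 2 * (2 * (deriv l r).im) * (-2 * (deriv l r).re)
        + ((d : ℝ) - 1) * (χ' r ^ 2 * (2 * ((deriv l r).im / r)))) * Real.exp (-2 * (l r).re) := by
    have := hasDerivAt_phaseFlux hχ hl hr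
    have e2 : phaseFlux χ' l r
        = χ' r ^ 2 * (2 * ((deriv l r).im / r)) * Real.exp (-2 * (l r).re) := by
      rw [phaseFlux]; ring
    rw [show r * deriv (phaseFlux χ' l) r + d * phaseFlux χ' l r
      = (r * deriv (phaseFlux χ' l) r + phaseFlux χ' l r) + ((d : ℝ) - 1) * phaseFlux χ' l r by ring,
      this, e2]
    ring
  rw [e, abs_mul, abs_of_pos (Real.exp_pos _)]
  refine mul_le_mul ?_ hA (Real.exp_pos _).le (by positivity)
  refine (abs_add_le _ _).trans (add_le_add ((abs_add_le _ _).trans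
    (add_le_add ((abs_add_le _ _).trans (add_le_add ?_ ?_)) ?_)) ?_)
  · rw [abs_mul, abs_mul, abs_neg, abs_two, abs_mul 2, abs_two]; gcongr
  · rw [abs_mul, abs_mul, abs_two, abs_of_nonneg h6]
    calc χ' r ^ 2 * (2 * |(deriv (deriv l) r).im|) ≤ 1 * (2 * B) := by gcongr
      _ = 2 * B := one_mul _
  · rw [abs_mul, abs_mul, abs_mul, abs_mul, abs_neg, abs_two, abs_of_nonneg h6]
    calc χ' r ^ 2 * (2 * |(deriv l r).im|) * (2 * |(deriv l r).re|)
        ≤ 1 * (2 * B) * (2 * B) := by gcongr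
      _ = 2 * B * (2 * B) := by ring
  · rw [abs_mul, abs_mul, abs_mul, abs_two, abs_div, abs_of_pos hr, abs_of_nonneg h6]
    have hd : |(d : ℝ) - 1| ≤ d + 1 := by
      have : (0 : ℝ) ≤ d := d.cast_nonneg
      rw [abs_le]; constructor <;> linarith
    calc |(d : ℝ) - 1| * (χ' r ^ 2 * (2 * (|(deriv l r).im| / r)))
        ≤ (d + 1) * (1 * (2 * (B / R))) := by gcongr
      _ = (d + 1) * (2 * (B / R)) := by ring

/-- The real part of the kinetic energy paired with the multiplier is bounded below, up to an
exact divergence, by a constant that only depends on the bounds of the data. -/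
theorem exists_kinetic_lower_bound (d : ℕ) {χ χ' : ℝ → ℝ} {ε D R : ℝ} (hR : 0 < R)
    (hχ : IsPartition χ χ' ε D) (B : ℝ) :
    ∃ K : ℝ, 0 ≤ K ∧ ∀ l τ : ℝ → ℂ, IsExponent R B l → IsExponent R B τ →
      (∀ r, 0 < r → |2 * (l r).im| ≤ 1) → (∀ r, 0 < r → |2 * (τ r).im| ≤ 1) →
      (∀ r, 0 < r → χ' r ≠ 0 → (Complex.exp (l r - τ r) ^ 2).im ≤ 0) →
      ∀ φ : EuclideanSpace ℝ (Fin d) → ℂ, ContDiff ℝ ∞ φ → HasCompactSupport φ →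
      ∃ Z : EuclideanSpace ℝ (Fin d) → ℝ, Integrable Z ∧ ∫ x, Z x = 0 ∧ ∀ x, x ≠ 0 →
        Z x - K * ‖φ x‖ ^ 2 ≤ -(multiplier χ χ' l ‖x‖ * (starRingEnd ℂ) (φ x)
          * radialOp (fun r => Complex.exp (-2 * l r)) (fun r => Complex.exp (-2 * τ r)) φ x).re := by
  have hD := hχ.nonneg
  set K₁ := (2 * D * (2 * |B|) + 2 * |B| + 2 * |B| * (2 * |B|) + (d + 1) * (2 * (|B| / R)))
    * Real.exp (2 * |B|) with hK₁
  -- `K₁` bounds the divergence of the phase flux; `8 D² exp(2|B|)` is the cost of Young's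
  -- inequality for the cross term. Both are independent of the exponents, hence of `β`.
  refine ⟨K₁ + 8 * D ^ 2 * Real.exp (2 * |B|), by positivity, ?_⟩
  intro l τ hl hτ hlim hτim hang φ hφ hc
  have hB : 0 ≤ B := (norm_nonneg _).trans (hl.norm_le 1 one_pos)
  have hexp : ∀ {f : ℝ → ℂ}, IsExponent R B f →
      ContDiffOn ℝ 1 (fun r => Complex.exp (-2 * f r)) (Ioi 0) := fun hf =>
    (contDiffOn_const.mul (hf.contDiffOn.of_le (by norm_num))).cexp
  have h0 : ∀ {f : ℝ → ℂ}, IsExponent R B f →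
      ∀ r, 0 ≤ r → r < min ε R → Complex.exp (-2 * f r) = 1 := fun hf r h0 h1 => by
    rw [hf.eq_zero r h0 (h1.trans_le (min_le_right _ _))]; simp
  have hχ'0 : ∀ r, 0 ≤ r → r < ε → χ' r = 0 := by
    intro r h0 h1
    have h2 := hχ.sq_add_sq r h0
    rw [hχ.eq_one r h0 h1] at h2
    have : χ' r ^ 2 = 0 := by linarith
    exact pow_eq_zero_iff two_ne_zero |>.1 this
  obtain ⟨Z, hZi, hZ0, hZ⟩ := integral_multiplier_radialOp (contDiffOn_multiplier hχ hl) (hexp hl)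
    (hexp hτ) (contDiffOn_phaseFlux hχ hl) (lt_min hχ.pos hR)
    (fun r h0 h1 => by
      have h1' := h1.trans_le (min_le_left _ _)
      simp [multiplier, hχ.eq_one r h0 h1', hχ'0 r h0 h1'])
    (h0 hl) (h0 hτ)
    (fun r h0 h1 => by simp [phaseFlux, hχ'0 r h0 (h1.trans_le (min_le_left _ _))])
    hφ hc
  refine ⟨fun x => -(Z x).re, hZi.re.neg, ?_, ?_⟩
  · rw [integral_neg]
    have h2 : ∫ x, (Z x).re = (∫ x, Z x).re := integral_re hZi
    rw [h2, hZ0]; simp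
  intro x hx
  have hr : 0 < ‖x‖ := norm_pos_iff.2 hx
  set r := ‖x‖ with hrdef
  have hZx := congrArg Complex.re (hZ x hx)
  rw [deriv_multiplier_mul_exp hχ hl hr] at hZx
  simp only [Complex.add_re, Complex.ofReal_re, Complex.re_mul_ofReal, sub_mul, Complex.sub_re]
    at hZx
  set w := (starRingEnd ℂ) (φ x) * radialDeriv φ x with hw
  have hwn : ‖w‖ = ‖φ x‖ * ‖radialDeriv φ x‖ := by rw [hw, norm_mul, RCLike.norm_conj]
  -- Angular energy: a nonnegative coefficient times `|∇φ|² - |∂_r φ|²`.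
  have hT := mul_nonneg (multiplier_mul_exp_re_nonneg (χ := χ) (χ' := χ') (hτim r hr) (hang r hr))
    (sub_nonneg.2 (norm_radialDeriv_sq_le_gradSq φ hx))
  set A := Real.exp (-2 * (l r).re) with hA
  have hApos : 0 < A := Real.exp_pos _
  have hAle : A ≤ Real.exp (2 * |B|) := by
    apply Real.exp_le_exp.2
    have := (abs_le.1 ((Complex.abs_re_le_norm (l r)).trans (hl.norm_le r hr))).1
    have := le_abs_self B
    linarith
  -- The rotated part of `M a` is `i χ'² |a|`, purely imaginary, so only the `χ²` part has a real
  -- contribution.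
  have hMa : χ r ^ 2 * (A / 2) ≤ (multiplier χ χ' l r * Complex.exp (-2 * l r)).re := by
    rw [multiplier_mul_re, exp_phase_mul_exp, Complex.ofReal_im]
    have := mul_le_mul_of_nonneg_left (half_exp_le_re_exp (hlim r hr)) (sq_nonneg (χ r))
    linarith
  have hMa' := mul_le_mul_of_nonneg_right hMa (sq_nonneg ‖radialDeriv φ x‖)
  have hflux := abs_phaseFlux_bound hR hχ hl d hr
  have hflux' : |r * deriv (phaseFlux χ' l) r + d * phaseFlux χ' l r| ≤ K₁ := by
    rw [hK₁, abs_of_nonneg hB]; exact hflux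
  have hcross : -(4 * D * |χ r| * A * (‖φ x‖ * ‖radialDeriv φ x‖))
      ≤ (((2 * (χ r * deriv χ r) : ℝ) : ℂ) * (Complex.exp (-2 * l r) - Complex.I * (A : ℝ)) * w).re := by
    have h1 : ‖Complex.exp (-2 * l r) - Complex.I * (A : ℝ)‖ ≤ 2 * A := by
      refine (norm_sub_le _ _).trans ?_
      rw [Complex.norm_exp, norm_mul, Complex.norm_I, Complex.norm_real,
        Real.norm_of_nonneg hApos.le, hA]
      have : (-2 * l r).re = -2 * (l r).re := by simp
      rw [this]; linarith
    have h2 : |χ r * deriv χ r| ≤ D * |χ r| := by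
      by_cases h0 : χ r = 0
      · simp [h0]
      · rw [abs_mul, mul_comm]
        exact mul_le_mul_of_nonneg_right (hχ.abs_deriv_le r hr h0) (abs_nonneg _)
    have h3 : ‖((2 * (χ r * deriv χ r) : ℝ) : ℂ) * (Complex.exp (-2 * l r) - Complex.I * (A : ℝ)) * w‖
        ≤ 2 * (D * |χ r|) * (2 * A) * (‖φ x‖ * ‖radialDeriv φ x‖) := by
      rw [norm_mul, norm_mul, hwn, Complex.norm_real, Real.norm_eq_abs, abs_mul, abs_two]
      gcongr
    have h4 := (abs_le.1 ((Complex.abs_re_le_norm _).trans h3)).1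
    linarith
  have hφ2 := sq_nonneg ‖φ x‖
  -- The weights are such that the derivative term is exactly the energy available in `hMa'`: the
  -- difference of the two sides is `(A/2)(|χ||∂_rφ| - 4D|φ|)²`.
  have hsq : 4 * D * |χ r| * A * (‖φ x‖ * ‖radialDeriv φ x‖)
      ≤ χ r ^ 2 * (A / 2) * ‖radialDeriv φ x‖ ^ 2 + 8 * D ^ 2 * A * ‖φ x‖ ^ 2 := by
    have h1 := mul_nonneg hApos.le (sq_nonneg (|χ r| * ‖radialDeriv φ x‖ - 4 * D * ‖φ x‖))
    have h2 : χ r ^ 2 = |χ r| ^ 2 := (sq_abs _).symm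
    rw [h2]
    nlinarith [h1]
  have h8 : 8 * D ^ 2 * A * ‖φ x‖ ^ 2 ≤ 8 * D ^ 2 * Real.exp (2 * |B|) * ‖φ x‖ ^ 2 := by gcongr
  have hfl := mul_le_mul_of_nonneg_right ((abs_le.1 hflux').1) hφ2
  have hK₁n : 0 ≤ K₁ := by positivity
  have hfl2 := mul_nonneg hK₁n hφ2
  have hcr : (((phaseFlux χ' l r * r : ℝ) : ℂ) * w).re = phaseFlux χ' l r * r * w.re :=
    Complex.re_ofReal_mul _ _
  rw [hcr] at hZx
  show -(Z x).re - _ ≤ _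
  rw [hZx]
  linarith [hT, hMa', hcross, hsq, h8, hfl, hfl2]

/-! ### The profile of the distortion -/

/-- A smooth function on `(0, ∞)` vanishing on `(0, R)` and equal to `(A + B log r) r^{-k}` for
large `r`. -/
structure HasLogPowTail (R k : ℝ) (f : ℝ → ℝ) : Prop where
  contDiffOn : ContDiffOn ℝ ∞ f (Ioi 0)
  eq_zero : ∀ r, 0 < r → r < R → f r = 0
  eq_tail : ∃ A B N : ℝ, ∀ r, N < r → f r = (A + B * Real.log r) * r ^ (-k)

namespace HasLogPowTail

variable {R k : ℝ} {f g : ℝ → ℝ}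

/-- Differentiating the logarithm produces a pure power, so both terms of the tail are needed for a
class stable under derivatives. Stability, with a gain of one power, yields bounds on all
derivatives from `bounded` alone. -/
theorem deriv (hf : HasLogPowTail R k f) : HasLogPowTail R (k + 1) (_root_.deriv f) where
  contDiffOn := ((contDiffOn_infty_iff_deriv_of_isOpen isOpen_Ioi).1 hf.contDiffOn).2
  eq_zero := by
    intro r h0 h1
    have h : f =ᶠ[𝓝 r] fun _ => 0 := by
      filter_upwards [Ioo_mem_nhds h0 h1] with t ht
      exact hf.eq_zero t ht.1 ht.2
    rw [h.deriv_eq]; simp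
  eq_tail := by
    obtain ⟨A, B, N, h⟩ := hf.eq_tail
    refine ⟨B - k * A, -k * B, max N 0, fun r hr => ?_⟩
    have hr0 : 0 < r := (le_max_right _ _).trans_lt hr
    have e : f =ᶠ[𝓝 r] fun t => (A + B * Real.log t) * t ^ (-k) := by
      filter_upwards [Ioi_mem_nhds ((le_max_left _ _).trans_lt hr)] with t ht
      exact h t ht
    rw [e.deriv_eq]
    have d := (((Real.hasDerivAt_log hr0.ne').const_mul B).const_add A).fun_mul
      (Real.hasDerivAt_rpow_const (p := -k) (Or.inl hr0.ne'))
    rw [d.deriv]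
    have e2 : r ^ (-(k + 1)) = r ^ (-k - 1) := by congr 1; ring
    have e3 : r ^ (-k) = r * r ^ (-k - 1) := by rw [Real.rpow_sub_one hr0.ne']; field_simp
    rw [e2, e3]
    field_simp
    ring

theorem id_mul (hf : HasLogPowTail R (k + 1) f) : HasLogPowTail R k (fun r => r * f r) where
  contDiffOn := contDiffOn_id.mul hf.contDiffOn
  eq_zero := fun r h0 h1 => by simp [hf.eq_zero r h0 h1]
  eq_tail := by
    obtain ⟨A, B, N, h⟩ := hf.eq_tail
    refine ⟨A, B, max N 0, fun r hr => ?_⟩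
    have hr0 : 0 < r := (le_max_right _ _).trans_lt hr
    rw [h r ((le_max_left _ _).trans_lt hr), show -k = -(k + 1) + 1 by ring,
      Real.rpow_add_one hr0.ne']
    ring

theorem add_const_mul (hf : HasLogPowTail R k f) (hg : HasLogPowTail R k g) (c : ℝ) :
    HasLogPowTail R k (fun r => f r + c * g r) where
  contDiffOn := hf.contDiffOn.add (contDiffOn_const.mul hg.contDiffOn)
  eq_zero := fun r h0 h1 => by simp [hf.eq_zero r h0 h1, hg.eq_zero r h0 h1]
  eq_tail := by
    obtain ⟨A, B, N, h⟩ := hf.eq_tail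
    obtain ⟨A', B', N', h'⟩ := hg.eq_tail
    refine ⟨A + c * A', B + c * B', max N N', fun r hr => ?_⟩
    rw [h r ((le_max_left _ _).trans_lt hr), h' r ((le_max_right _ _).trans_lt hr)]
    ring

/-- Zero below `R`, continuous on a compact interval, and tending to `0` at infinity because `log r`
is negligible against `r^k`. -/
theorem bounded (hR : 0 < R) (hk : 0 < k) (hf : HasLogPowTail R k f) :
    ∃ C, ∀ r, 0 < r → |f r| ≤ C := by
  obtain ⟨A, B, N, h⟩ := hf.eq_tail
  have h1 : Tendsto (fun r : ℝ => (A + B * Real.log r) * r ^ (-k)) atTop (𝓝 0) := by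
    have h2 : Tendsto (fun r : ℝ => r ^ (-k)) atTop (𝓝 0) := tendsto_rpow_neg_atTop hk
    have h3 : Tendsto (fun r : ℝ => Real.log r / r ^ k) atTop (𝓝 0) :=
      (isLittleO_log_rpow_atTop hk).tendsto_div_nhds_zero
    have h4 := (h2.const_mul A).add (h3.const_mul B)
    simp only [mul_zero, add_zero] at h4
    refine h4.congr' ?_
    filter_upwards [eventually_gt_atTop 0] with r hr
    rw [Real.rpow_neg hr.le]
    ring
  have h5 : ∀ᶠ r : ℝ in atTop, |(A + B * Real.log r) * r ^ (-k)| < 1 := by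
    have := h1.abs
    rw [abs_zero] at this
    exact this.eventually (gt_mem_nhds one_pos)
  obtain ⟨N', hN'⟩ := eventually_atTop.1 h5
  obtain ⟨C, hC⟩ := (isCompact_Icc (a := R) (b := max N N' + 1)).exists_bound_of_continuousOn
    (hf.contDiffOn.continuousOn.mono fun r hr => hR.trans_le hr.1)
  refine ⟨max 1 C, fun r hr => ?_⟩
  rcases lt_or_ge r R with h6 | h6
  · rw [hf.eq_zero r hr h6, abs_zero]; positivity
  rcases le_or_gt r (max N N' + 1) with h7 | h7
  · exact (hC r ⟨h6, h7⟩).trans (le_max_right _ _)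
  · have h8 : N < r := by linarith [le_max_left N N']
    rw [h r h8]
    exact (hN' r (by linarith [le_max_right N N'])).le.trans (le_max_left _ _)

end HasLogPowTail

/-- The relative radial displacement: `r_θ^{2s} = r^{2s} (1 + θ g(r))`. -/
def profile (s R : ℝ) (χ₁ : ℝ → ℝ) (r : ℝ) : ℝ :=
  2 * χ₁ (r ^ (2 * s) / R ^ (2 * s)) * (if s < 1 then s else Real.log r) * r ^ (-(2 * s))

/-- The function `g₁ = g + r g' / (2s)`, so that
`∂_r r_θ = (1 + θ g)^{1/(2s) - 1} (1 + θ g₁)`. -/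
def profileDeriv (s R : ℝ) (χ₁ : ℝ → ℝ) (r : ℝ) : ℝ :=
  profile s R χ₁ r + 1 / (2 * s) * (r * deriv (profile s R χ₁) r)

section Profile

variable {s R : ℝ} {χ₁ : ℝ → ℝ}

theorem hasLogPowTail_profile (hs0 : 0 < s) (hR : 0 < R) (hχ₁ : ContDiff ℝ ∞ χ₁)
    (h0 : ∀ t, t ≤ 1 → χ₁ t = 0) (h1 : ∀ t, 2 ≤ t → χ₁ t = 1) :
    HasLogPowTail R (2 * s) (profile s R χ₁) where
  contDiffOn := by
    have hp : ∀ p : ℝ, ContDiffOn ℝ ∞ (fun r : ℝ => r ^ p) (Ioi 0) := fun p r hr =>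
      (Real.contDiffAt_rpow_const_of_ne (ne_of_gt hr)).contDiffWithinAt
    refine ((contDiffOn_const.mul (hχ₁.comp_contDiffOn ((hp _).div_const _))).mul ?_).mul (hp _)
    split_ifs
    · exact contDiffOn_const
    · exact fun r hr => (Real.contDiffAt_log.2 (ne_of_gt hr)).contDiffWithinAt
  eq_zero := by
    intro r hr hrR
    have : r ^ (2 * s) / R ^ (2 * s) ≤ 1 := by
      rw [div_le_one (by positivity)]
      exact Real.rpow_le_rpow hr.le hrR.le (by positivity)
    simp [profile, h0 _ this]
  eq_tail := by
    refine ⟨if s < 1 then 2 * s else 0, if s < 1 then 0 else 2, (2 * R ^ (2 * s)) ^ (1 / (2 * s)),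
      fun r hr => ?_⟩
    have h2 : 2 ≤ r ^ (2 * s) / R ^ (2 * s) := by
      rw [le_div_iff₀ (by positivity)]
      have h3 := Real.rpow_le_rpow (by positivity) hr.le (by positivity : 0 ≤ 2 * s)
      rwa [← Real.rpow_mul (by positivity), one_div, inv_mul_cancel₀ (by positivity),
        Real.rpow_one] at h3
    rw [profile, h1 _ h2]
    split_ifs <;> ring

theorem profile_eq_zero (hs0 : 0 < s) (hR : 0 < R) (hχ₁ : ContDiff ℝ ∞ χ₁)
    (h0 : ∀ t, t ≤ 1 → χ₁ t = 0) (h1 : ∀ t, 2 ≤ t → χ₁ t = 1) {r : ℝ} (hr : 0 ≤ r) (hrR : r < R) :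
    profile s R χ₁ r = 0 := by
  rcases hr.eq_or_lt with rfl | hr
  · rw [profile, Real.zero_rpow (by positivity), zero_div, h0 0 zero_le_one]; simp
  · exact (hasLogPowTail_profile hs0 hR hχ₁ h0 h1).eq_zero r hr hrR

theorem hasLogPowTail_profileDeriv (hs0 : 0 < s) (hR : 0 < R) (hχ₁ : ContDiff ℝ ∞ χ₁)
    (h0 : ∀ t, t ≤ 1 → χ₁ t = 0) (h1 : ∀ t, 2 ≤ t → χ₁ t = 1) :
    HasLogPowTail R (2 * s) (profileDeriv s R χ₁) :=
  (hasLogPowTail_profile hs0 hR hχ₁ h0 h1).add_const_mul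
    (hasLogPowTail_profile hs0 hR hχ₁ h0 h1).deriv.id_mul _

theorem profileDeriv_eq_zero (hs0 : 0 < s) (hR : 0 < R) (hχ₁ : ContDiff ℝ ∞ χ₁)
    (h0 : ∀ t, t ≤ 1 → χ₁ t = 0) (h1 : ∀ t, 2 ≤ t → χ₁ t = 1) {r : ℝ} (hr : 0 ≤ r) (hrR : r < R) :
    profileDeriv s R χ₁ r = 0 := by
  rcases hr.eq_or_lt with rfl | hr
  · rw [profileDeriv, profile_eq_zero hs0 hR hχ₁ h0 h1 le_rfl hR]; simp
  · exact (hasLogPowTail_profileDeriv hs0 hR hχ₁ h0 h1).eq_zero r hr hrR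

/-- Where the cut-off equals `1`, `g₁ = B r^{-2s} / (2s)` with `B` the coefficient of `log r`. -/
theorem profileDeriv_eq_of_cutoff_eq_one (hs0 : 0 < s) (hχ₁ : ContDiff ℝ ∞ χ₁)
    (hmem : ∀ t, χ₁ t ∈ Set.Icc (0 : ℝ) 1) {r : ℝ} (hr : 0 < r)
    (h : χ₁ (r ^ (2 * s) / R ^ (2 * s)) = 1) :
    profileDeriv s R χ₁ r = (if s < 1 then 0 else 1 / s) * r ^ (-(2 * s)) := by
  -- The value `1` is the maximum of `χ₁`, so its derivative vanishes there even if `χ₁ = 1` on no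
  -- neighbourhood.
  have hmax : IsLocalMax χ₁ (r ^ (2 * s) / R ^ (2 * s)) := by
    refine Eventually.of_forall fun t => ?_
    rw [h]; exact (hmem t).2
  have dχ : HasDerivAt χ₁ 0 (r ^ (2 * s) / R ^ (2 * s)) := by
    rw [← hmax.deriv_eq_zero]
    exact (hχ₁.differentiable (by simp) _).hasDerivAt
  have dp : HasDerivAt (fun r : ℝ => r ^ (2 * s) / R ^ (2 * s)) _ r :=
    (Real.hasDerivAt_rpow_const (p := 2 * s) (Or.inl hr.ne')).div_const _
  have dn := Real.hasDerivAt_rpow_const (p := -(2 * s)) (Or.inl hr.ne')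
  have dm : HasDerivAt (fun r : ℝ => if s < 1 then s else Real.log r)
      (if s < 1 then 0 else r⁻¹) r := by
    split_ifs
    · exact hasDerivAt_const r s
    · exact Real.hasDerivAt_log hr.ne'
  have dg : deriv (profile s R χ₁) r = _ :=
    ((((dχ.comp r dp).const_mul 2).fun_mul dm).fun_mul dn).deriv
  have e2 : r * r ^ (-(2 * s) - 1) = r ^ (-(2 * s)) := by
    rw [Real.rpow_sub_one hr.ne']; field_simp
  rw [profileDeriv, dg, profile, h]
  simp only [Function.comp, h]
  split_ifs
  · rw [show ∀ a b c d : ℝ, r * ((2 * a * s + 2 * 1 * 0) * b + c * (d * r ^ (-(2 * s) - 1)))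
      = r * (2 * a * s * b) + c * d * (r * r ^ (-(2 * s) - 1)) by intros; ring, e2]
    field_simp
    ring
  · rw [show ∀ a b c d : ℝ, r * ((2 * a * Real.log r + 2 * 1 * r⁻¹) * b
      + c * (d * r ^ (-(2 * s) - 1)))
      = r * (2 * a * Real.log r * b) + 2 * (r * r⁻¹) * b + c * d * (r * r ^ (-(2 * s) - 1)) by
        intros; ring, e2, mul_inv_cancel₀ hr.ne']
    field_simp
    ring

end Profile

/-! ### Logarithmic exponents and their uniform bounds -/

/-- `log (1 + i β f)`. -/
def logExponent (β : ℝ) (f : ℝ → ℝ) (r : ℝ) : ℂ := Complex.log (1 + Complex.I * β * f r)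

/-- A `C²` function of the radius, vanishing on `[0, R)`, bounded by `C` together with its first
two derivatives. -/
structure IsBoundedProfile (R C : ℝ) (f : ℝ → ℝ) : Prop where
  contDiffOn : ContDiffOn ℝ 2 f (Ioi 0)
  eq_zero : ∀ r, 0 ≤ r → r < R → f r = 0
  abs_le : ∀ r, 0 < r → |f r| ≤ C
  abs_deriv_le : ∀ r, 0 < r → |deriv f r| ≤ C
  abs_deriv_deriv_le : ∀ r, 0 < r → |deriv (deriv f) r| ≤ C

theorem HasLogPowTail.exists_isBoundedProfile {R k : ℝ} {f : ℝ → ℝ} (hR : 0 < R) (hk : 0 < k)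
    (hf : HasLogPowTail R k f) (h0 : ∀ r, 0 ≤ r → r < R → f r = 0) :
    ∃ C, 0 ≤ C ∧ IsBoundedProfile R C f := by
  obtain ⟨C₀, h₀⟩ := hf.bounded hR hk
  obtain ⟨C₁, h₁⟩ := hf.deriv.bounded hR (by linarith)
  obtain ⟨C₂, h₂⟩ := hf.deriv.deriv.bounded hR (by linarith)
  refine ⟨max C₀ (max C₁ C₂), ((abs_nonneg _).trans (h₀ 1 one_pos)).trans (le_max_left _ _),
    hf.contDiffOn.of_le two_le_infty, h0, ?_, ?_, ?_⟩
  · exact fun r hr => (h₀ r hr).trans (le_max_left _ _)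
  · exact fun r hr => (h₁ r hr).trans ((le_max_left _ _).trans (le_max_right _ _))
  · exact fun r hr => (h₂ r hr).trans ((le_max_right _ _).trans (le_max_right _ _))

theorem IsBoundedProfile.mono {R C C' : ℝ} {f : ℝ → ℝ} (h : IsBoundedProfile R C f) (hC : C ≤ C') :
    IsBoundedProfile R C' f :=
  ⟨h.contDiffOn, h.eq_zero, fun r hr => (h.abs_le r hr).trans hC,
    fun r hr => (h.abs_deriv_le r hr).trans hC, fun r hr => (h.abs_deriv_deriv_le r hr).trans hC⟩

/-- The real part is `1` whatever the size of `βy`; all denominators below are therefore harmless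
and the principal logarithm is smooth. -/
theorem one_le_norm_one_add_I_mul (β y : ℝ) : 1 ≤ ‖1 + Complex.I * β * y‖ := by
  have h := Complex.abs_re_le_norm (1 + Complex.I * β * y)
  simpa using h

theorem one_add_I_mul_ne_zero (β y : ℝ) : 1 + Complex.I * β * y ≠ 0 := by
  intro h
  have := one_le_norm_one_add_I_mul β y
  rw [h, norm_zero] at this
  linarith

theorem one_add_I_mul_mem_slitPlane (β y : ℝ) : 1 + Complex.I * β * y ∈ Complex.slitPlane := by
  left; simp

theorem exp_logExponent (β : ℝ) (f : ℝ → ℝ) (r : ℝ) :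
    Complex.exp (logExponent β f r) = 1 + Complex.I * β * f r :=
  Complex.exp_log (one_add_I_mul_ne_zero β _)

theorem hasDerivAt_logExponent {f : ℝ → ℝ} {f' r : ℝ} (β : ℝ) (hf : HasDerivAt f f' r) :
    HasDerivAt (logExponent β f) (Complex.I * β * f' / (1 + Complex.I * β * f r)) r := by
  have h : HasDerivAt (fun r => 1 + Complex.I * β * f r) (Complex.I * β * f') r :=
    (hf.ofReal_comp.const_mul (Complex.I * (β : ℂ))).const_add 1
  exact h.clog_real (one_add_I_mul_mem_slitPlane β _)

theorem IsBoundedProfile.hasDerivAt {R C : ℝ} {f : ℝ → ℝ} (hf : IsBoundedProfile R C f) {r : ℝ}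
    (hr : 0 < r) : HasDerivAt f (deriv f r) r ∧ HasDerivAt (deriv f) (deriv (deriv f) r) r := by
  have h1 : ContDiffAt ℝ 2 f r := (hf.contDiffOn r hr).contDiffAt (Ioi_mem_nhds hr)
  have h2 : ContDiffOn ℝ 1 (deriv f) (Ioi 0) :=
    ((contDiffOn_succ_iff_deriv_of_isOpen (n := 1) isOpen_Ioi).1
      (by simpa [one_add_one_eq_two] using hf.contDiffOn)).2.2
  exact ⟨(h1.differentiableAt two_ne_zero).hasDerivAt,
    (((h2 r hr).contDiffAt (Ioi_mem_nhds hr)).differentiableAt one_ne_zero).hasDerivAt⟩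

theorem norm_logExponent_le {β y C : ℝ} (hβ : 0 ≤ β) (hy : |y| ≤ C) (hC : β * C ≤ 1 / 2) :
    ‖Complex.log (1 + Complex.I * β * y)‖ ≤ 3 / 2 * (β * C) := by
  have h1 : ‖Complex.I * β * y‖ ≤ β * C := by
    rw [norm_mul, norm_mul, Complex.norm_I, Complex.norm_real, Complex.norm_real,
      Real.norm_of_nonneg hβ, Real.norm_eq_abs, one_mul]
    gcongr
  refine (Complex.norm_log_one_add_half_le_self (h1.trans hC)).trans ?_
  gcongr

/-- With `|1 + iβf| ≥ 1` and `β ≤ 1`, the first derivative is at most `C` and the second at most `C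
+ C²`; the value itself is at most `3/4`. The bound does not involve `β`. -/
theorem isExponent_logExponent {R C β : ℝ} {f : ℝ → ℝ} (hf : IsBoundedProfile R C f)
    (hβ : 0 ≤ β) (hβ1 : β ≤ 1) (hC : β * C ≤ 1 / 2) :
    IsExponent R (1 + C + C ^ 2) (logExponent β f) := by
  have hC0 : 0 ≤ C := (abs_nonneg _).trans (hf.abs_le 1 one_pos)
  have hder : ∀ r, 0 < r → deriv (logExponent β f) r
      = Complex.I * β * (deriv f r : ℝ) / (1 + Complex.I * β * f r) := fun r hr =>
    (hasDerivAt_logExponent β (hf.hasDerivAt hr).1).deriv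
  have hn : ∀ y : ℝ, |y| ≤ C → ‖Complex.I * β * y‖ ≤ C := by
    intro y hy
    rw [norm_mul, norm_mul, Complex.norm_I, Complex.norm_real, Complex.norm_real,
      Real.norm_of_nonneg hβ, Real.norm_eq_abs, one_mul]
    calc β * |y| ≤ 1 * C := by gcongr
      _ = C := one_mul C
  refine ⟨?_, ?_, ?_, ?_, ?_⟩
  · intro r hr
    have h1 : ContDiffWithinAt ℝ 2 (fun r => 1 + Complex.I * β * f r) (Ioi 0) r :=
      contDiffWithinAt_const.add (contDiffWithinAt_const.mul
        (Complex.ofRealCLM.contDiff.contDiffAt.comp_contDiffWithinAt r (hf.contDiffOn r hr)))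
    exact ((Complex.contDiffAt_log (one_add_I_mul_mem_slitPlane β _)).restrict_scalars
      ℝ).comp_contDiffWithinAt r h1
  · intro r h0 h1
    simp [logExponent, hf.eq_zero r h0 h1]
  · intro r hr
    have := norm_logExponent_le hβ (hf.abs_le r hr) hC
    exact this.trans (by nlinarith)
  · intro r hr
    rw [hder r hr, norm_div]
    refine (div_le_self (norm_nonneg _) (one_le_norm_one_add_I_mul β _)).trans ?_
    exact (hn _ (hf.abs_deriv_le r hr)).trans (by nlinarith)
  · intro r hr
    have e : deriv (logExponent β f) =ᶠ[𝓝 r]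
        fun r => Complex.I * β * (deriv f r : ℝ) / (1 + Complex.I * β * f r) := by
      filter_upwards [Ioi_mem_nhds hr] with t ht
      exact hder t ht
    obtain ⟨d1, d2⟩ := hf.hasDerivAt hr
    have h := (d2.ofReal_comp.const_mul (Complex.I * (β : ℂ))).fun_div
      ((d1.ofReal_comp.const_mul (Complex.I * (β : ℂ))).const_add 1) (one_add_I_mul_ne_zero β _)
    rw [e.deriv_eq, h.deriv]
    have hne := one_add_I_mul_ne_zero β (f r)
    have e2 : (Complex.I * β * (deriv (deriv f) r : ℝ) * (1 + Complex.I * β * f r)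
        - Complex.I * β * (deriv f r : ℝ) * (Complex.I * β * (deriv f r : ℝ)))
          / (1 + Complex.I * β * f r) ^ 2
        = Complex.I * β * (deriv (deriv f) r : ℝ) / (1 + Complex.I * β * f r)
          - (Complex.I * β * (deriv f r : ℝ) / (1 + Complex.I * β * f r)) ^ 2 := by
      field_simp
    rw [e2]
    have h1 : ∀ w : ℂ, ‖w / (1 + Complex.I * β * f r)‖ ≤ ‖w‖ := fun w => by
      rw [norm_div]; exact div_le_self (norm_nonneg _) (one_le_norm_one_add_I_mul β _)
    have h2 := (h1 _).trans (hn _ (hf.abs_deriv_deriv_le r hr))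
    have h3 := (h1 _).trans (hn _ (hf.abs_deriv_le r hr))
    refine (norm_sub_le _ _).trans ?_
    rw [norm_pow]
    have h4 := pow_le_pow_left₀ (norm_nonneg _) h3 2
    linarith

theorem IsExponent.linear_comb {R B : ℝ} {f g : ℝ → ℂ} (hf : IsExponent R B f)
    (hg : IsExponent R B g) (a b : ℝ) :
    IsExponent R ((|a| + |b|) * B) (fun r => (a : ℂ) * f r + (b : ℂ) * g r) := by
  have hder : ∀ r, 0 < r → deriv (fun r => (a : ℂ) * f r + (b : ℂ) * g r) r
      = (a : ℂ) * deriv f r + (b : ℂ) * deriv g r := fun r hr =>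
    (((hasDerivAt_of_contDiffOn_two hf.contDiffOn hr).1.const_mul (a : ℂ)).fun_add
      ((hasDerivAt_of_contDiffOn_two hg.contDiffOn hr).1.const_mul (b : ℂ))).deriv
  have hn : ∀ z w : ℂ, ‖z‖ ≤ B → ‖w‖ ≤ B → ‖(a : ℂ) * z + (b : ℂ) * w‖ ≤ (|a| + |b|) * B := by
    intro z w hz hw
    refine (norm_add_le _ _).trans ?_
    rw [norm_mul, norm_mul, Complex.norm_real, Complex.norm_real, Real.norm_eq_abs,
      Real.norm_eq_abs, add_mul]
    gcongr
  refine ⟨(contDiffOn_const.mul hf.contDiffOn).add (contDiffOn_const.mul hg.contDiffOn), ?_, ?_,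
    ?_, ?_⟩
  · intro r h0 h1
    simp [hf.eq_zero r h0 h1, hg.eq_zero r h0 h1]
  · exact fun r hr => hn _ _ (hf.norm_le r hr) (hg.norm_le r hr)
  · intro r hr
    rw [hder r hr]
    exact hn _ _ (hf.norm_deriv_le r hr) (hg.norm_deriv_le r hr)
  · intro r hr
    have e : deriv (fun r => (a : ℂ) * f r + (b : ℂ) * g r) =ᶠ[𝓝 r]
        fun r => (a : ℂ) * deriv f r + (b : ℂ) * deriv g r := by
      filter_upwards [Ioi_mem_nhds hr] with t ht
      exact hder t ht
    rw [e.deriv_eq, (((hasDerivAt_of_contDiffOn_two hf.contDiffOn hr).2.const_mul (a : ℂ)).fun_add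
      ((hasDerivAt_of_contDiffOn_two hg.contDiffOn hr).2.const_mul (b : ℂ))).deriv]
    exact hn _ _ (hf.norm_deriv_deriv_le r hr) (hg.norm_deriv_deriv_le r hr)

theorem IsExponent.mono {R B B' : ℝ} {f : ℝ → ℂ} (h : IsExponent R B f) (hB : B ≤ B') :
    IsExponent R B' f :=
  ⟨h.contDiffOn, h.eq_zero, fun r hr => (h.norm_le r hr).trans hB,
    fun r hr => (h.norm_deriv_le r hr).trans hB, fun r hr => (h.norm_deriv_deriv_le r hr).trans hB⟩

theorem exists_norm_distortionPotential_le (d : ℕ) {R : ℝ} (hR : 0 < R) (B : ℝ) :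
    ∃ K : ℝ, 0 ≤ K ∧ ∀ l τ : ℝ → ℂ, IsExponent R B l → IsExponent R B τ → ∀ r, 0 < r →
      ‖distortionPotential d l τ r‖ ≤ K := by
  set P := (1 / 2) * (|B| + (d + 1) * |B|) with hP
  have hP0 : 0 ≤ P := by positivity
  refine ⟨Real.exp (2 * |B|) * (|B| * P + P + P ^ 2) + (d + 1) * Real.exp (2 * |B|) * (P / R),
    by positivity, ?_⟩
  intro l τ hl hτ r hr
  have hB : 0 ≤ B := (norm_nonneg _).trans (hl.norm_le 1 one_pos)
  rw [abs_of_nonneg hB] at hP ⊢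
  have hd : ‖(d : ℂ) - 1‖ ≤ d + 1 := by
    refine (norm_sub_le _ _).trans ?_
    simp
  have hp : ∀ z w : ℂ, ∀ b, ‖z‖ ≤ b → ‖w‖ ≤ b →
      ‖-(1 / 2 : ℂ) * (z + ((d : ℂ) - 1) * w)‖ ≤ (1 / 2) * (b + (d + 1) * b) := by
    intro z w b hz hw
    rw [norm_mul]
    have h1 : ‖-(1 / 2 : ℂ)‖ = 1 / 2 := by simp
    rw [h1]
    refine mul_le_mul_of_nonneg_left ((norm_add_le _ _).trans ?_) (by norm_num)
    rw [norm_mul]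
    gcongr
  have p1 := hp _ _ _ (hl.norm_deriv_le r hr) (hτ.norm_deriv_le r hr)
  have p2 := hp _ _ _ (hl.norm_deriv_deriv_le r hr) (hτ.norm_deriv_deriv_le r hr)
  rw [← hP] at p1 p2
  have p3 : ‖-(1 / 2 : ℂ) * (deriv l r + ((d : ℂ) - 1) * deriv τ r) / r‖ ≤ P / R := by
    have h1 := hp (deriv l r / r) (deriv τ r / r) (B / R)
      (by rw [norm_div, Complex.norm_real, Real.norm_of_nonneg hr.le]; exact hl.norm_deriv_div_le hR hr)
      (by rw [norm_div, Complex.norm_real, Real.norm_of_nonneg hr.le]; exact hτ.norm_deriv_div_le hR hr)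
    have hr' : (r : ℂ) ≠ 0 := Complex.ofReal_ne_zero.2 hr.ne'
    calc _ = ‖-(1 / 2 : ℂ) * (deriv l r / r + ((d : ℂ) - 1) * (deriv τ r / r))‖ := by
          congr 1; field_simp
      _ ≤ _ := h1
      _ = P / R := by rw [hP]; ring
  have x1 : ‖Complex.exp (-2 * l r)‖ ≤ Real.exp (2 * B) := by
    rw [Complex.norm_exp]
    apply Real.exp_le_exp.2
    have := (abs_le.1 ((Complex.abs_re_le_norm (l r)).trans (hl.norm_le r hr))).1
    have e : (-2 * l r).re = -2 * (l r).re := by simp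
    rw [e]; linarith
  have x2 : ‖Complex.exp (-l r - τ r)‖ ≤ Real.exp (2 * B) := by
    rw [Complex.norm_exp]
    apply Real.exp_le_exp.2
    have h1 := (abs_le.1 ((Complex.abs_re_le_norm (l r)).trans (hl.norm_le r hr))).1
    have h2 := (abs_le.1 ((Complex.abs_re_le_norm (τ r)).trans (hτ.norm_le r hr))).1
    simp only [Complex.sub_re, Complex.neg_re]
    linarith
  rw [distortionPotential]
  refine (norm_add_le _ _).trans (add_le_add ?_ ?_)
  · rw [norm_mul]
    refine mul_le_mul x1 ?_ (norm_nonneg _) (Real.exp_pos _).le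
    refine (norm_add_le _ _).trans (add_le_add ((norm_add_le _ _).trans (add_le_add ?_ ?_)) ?_)
    · rw [norm_mul, norm_neg]
      exact mul_le_mul (hl.norm_deriv_le r hr) p1 (norm_nonneg _) hB
    · exact p2
    · rw [norm_pow]
      exact pow_le_pow_left₀ (norm_nonneg _) p1 2
  · rw [mul_div_assoc, norm_mul, norm_mul]
    gcongr

/-! ### The distorted radius as an exponential -/

section Radius

variable {s R : ℝ} {χ₁ : ℝ → ℝ}

theorem radiusPow_eq (θ : ℂ) {r : ℝ} (hr : 0 < r) :
    radiusPow s R χ₁ θ r = ((r ^ (2 * s) : ℝ) : ℂ) * (1 + θ * (profile s R χ₁ r : ℝ)) := by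
  have h : r ^ (2 * s) * r ^ (-(2 * s)) = 1 := by rw [← Real.rpow_add hr]; simp
  have h' : ((r ^ (2 * s) : ℝ) : ℂ) * ((r ^ (-(2 * s)) : ℝ) : ℂ) = 1 := by
    rw [← Complex.ofReal_mul, h, Complex.ofReal_one]
  rw [radiusPow, profile]
  simp only [Complex.ofReal_mul]
  rw [Complex.ofReal_ofNat]
  linear_combination (-2 * θ * ((χ₁ (r ^ (2 * s) / R ^ (2 * s)) : ℝ) : ℂ)
    * (((if s < 1 then s else Real.log r) : ℝ) : ℂ)) * h'

theorem radius_eq (hs0 : 0 < s) {θ : ℂ} {r : ℝ} (hr : 0 < r)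
    (hθ : 1 + θ * (profile s R χ₁ r : ℝ) ≠ 0) :
    radius s R χ₁ θ r = r * Complex.exp (((1 / (2 * s) : ℝ) : ℂ)
      * Complex.log (1 + θ * (profile s R χ₁ r : ℝ))) := by
  have hp : 0 < r ^ (2 * s) := by positivity
  rw [radius, radiusPow_eq θ hr, Complex.cpow_def_of_ne_zero
    (mul_ne_zero (Complex.ofReal_ne_zero.2 hp.ne') hθ), Complex.log_ofReal_mul hp hθ,
    Real.log_rpow hr, add_mul, Complex.exp_add]
  congr 1
  · rw [← Complex.ofReal_mul, ← Complex.ofReal_exp]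
    congr 1
    rw [show 2 * s * Real.log r * (1 / (2 * s)) = Real.log r by field_simp, Real.exp_log hr]
  · rw [mul_comm]

theorem radius_I_mul (hs0 : 0 < s) (β : ℝ) {r : ℝ} (hr : 0 < r) :
    radius s R χ₁ (Complex.I * β) r
      = r * Complex.exp (((1 / (2 * s) : ℝ) : ℂ) * logExponent β (profile s R χ₁) r) :=
  radius_eq hs0 hr (one_add_I_mul_ne_zero β _)

/-- This is where `profileDeriv` comes from: `1 + r τ'` is the quotient `(1 + iβ g₁) / (1 + iβ g)`,
so that `l - τ` is a difference of logarithms. -/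
theorem one_add_mul_deriv_logExponent (β : ℝ) {r : ℝ}
    (hg : DifferentiableAt ℝ (profile s R χ₁) r) :
    1 + r * (((1 / (2 * s) : ℝ) : ℂ) * deriv (logExponent β (profile s R χ₁)) r)
      = Complex.exp (logExponent β (profileDeriv s R χ₁) r - logExponent β (profile s R χ₁) r) := by
  rw [Complex.exp_sub, exp_logExponent, exp_logExponent,
    (hasDerivAt_logExponent β hg.hasDerivAt).deriv, profileDeriv]
  have h := one_add_I_mul_ne_zero β (profile s R χ₁ r)
  push_cast
  field_simp
  ring

theorem radiusDeriv_I_mul (hs0 : 0 < s) (β : ℝ) {r : ℝ} (hr : 0 < r)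
    (hg : DifferentiableAt ℝ (profile s R χ₁) r) :
    radiusDeriv s R χ₁ (Complex.I * β) r
      = Complex.exp (((1 / (2 * s) : ℝ) : ℂ) * logExponent β (profile s R χ₁) r
        + (logExponent β (profileDeriv s R χ₁) r - logExponent β (profile s R χ₁) r)) := by
  have e : (fun t : ℝ => radius s R χ₁ (Complex.I * β) t) =ᶠ[𝓝 r] fun t : ℝ =>
      (t : ℂ) * Complex.exp (((1 / (2 * s) : ℝ) : ℂ) * logExponent β (profile s R χ₁) t) := by
    filter_upwards [Ioi_mem_nhds hr] with t ht
    exact radius_I_mul hs0 β ht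
  have hL := hasDerivAt_logExponent β hg.hasDerivAt
  have h := ((hasDerivAt_id r).ofReal_comp).fun_mul
    (hL.const_mul ((1 / (2 * s) : ℝ) : ℂ)).cexp
  rw [radiusDeriv, e.deriv_eq]
  refine h.deriv.trans ?_
  rw [Complex.exp_add, ← one_add_mul_deriv_logExponent β hg, hL.deriv]
  simp only [id]
  push_cast
  ring

end Radius

/-! ### First order expansion of the distorted perturbation -/

/-- The Schwarz lemma applied twice: to `f`, and then to the difference quotient `f(z)/z`, which is
holomorphic, bounded by `M/ρ`, and equal to `f'(0)` at the origin. The constants depend only on `M`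
and `ρ`, hence are uniform in the parameter `x`. -/
theorem norm_le_and_norm_sub_deriv_le_of_bounded {f : ℂ → ℂ} {ρ M : ℝ} (hρ : 0 < ρ)
    (hf : DifferentiableOn ℂ f (Metric.ball 0 ρ)) (h0 : f 0 = 0)
    (hM : ∀ z ∈ Metric.ball (0 : ℂ) ρ, ‖f z‖ ≤ M) {z : ℂ} (hz : z ∈ Metric.ball (0 : ℂ) ρ) :
    ‖f z‖ ≤ M / ρ * ‖z‖ ∧ ‖f z - z * deriv f 0‖ ≤ 2 * M / ρ ^ 2 * ‖z‖ ^ 2 := by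
  have hmap : MapsTo f (Metric.ball 0 ρ) (Metric.closedBall (f 0) M) := fun w hw => by
    rw [h0]; simpa using hM w hw
  have h1 := Complex.dist_le_div_mul_dist_of_mapsTo_ball hf hmap hz
  refine ⟨by simpa [h0] using h1, ?_⟩
  have hg : DifferentiableOn ℂ (dslope f 0) (Metric.ball 0 ρ) :=
    (Complex.differentiableOn_dslope (Metric.ball_mem_nhds 0 hρ)).2 hf
  have hgM : ∀ w ∈ Metric.ball (0 : ℂ) ρ, ‖dslope f 0 w‖ ≤ M / ρ := fun w hw =>
    Complex.norm_dslope_le_div_of_mapsTo_ball hf hmap hw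
  have hmap2 : MapsTo (dslope f 0) (Metric.ball 0 ρ)
      (Metric.closedBall (dslope f 0 0) (2 * (M / ρ))) := fun w hw => by
    rw [Metric.mem_closedBall, dist_eq_norm]
    refine (norm_sub_le _ _).trans ?_
    linarith [hgM w hw, hgM 0 (Metric.mem_ball_self hρ)]
  have h2 := Complex.dist_le_div_mul_dist_of_mapsTo_ball hg hmap2 hz
  rw [dist_eq_norm, dist_zero_right, dslope_same] at h2
  have h3 : f z = z * dslope f 0 z := by
    have := sub_smul_dslope f 0 z
    simpa [h0] using this.symm
  rw [h3, ← mul_sub, norm_mul]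
  calc ‖z‖ * ‖dslope f 0 z - deriv f 0‖ ≤ ‖z‖ * (2 * (M / ρ) / ρ * ‖z‖) := by gcongr
    _ = 2 * M / ρ ^ 2 * ‖z‖ ^ 2 := by field_simp

section Analytic

variable {d : ℕ} {s R : ℝ} {χ₁ : ℝ → ℝ} {q : EuclideanSpace ℝ (Fin d) → ℝ} {β₀ : ℝ}
  {Q : ℂ → EuclideanSpace ℝ (Fin d) → ℂ}

theorem radius_ofReal_re_div (hs0 : 0 < s) {t r : ℝ} (hr : 0 < r)
    (ht : 0 < 1 + t * profile s R χ₁ r) :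
    (radius s R χ₁ (t : ℂ) r).re / r
      = Real.exp (1 / (2 * s) * Real.log (1 + t * profile s R χ₁ r)) := by
  have e : (1 + (t : ℂ) * (profile s R χ₁ r : ℝ)) = ((1 + t * profile s R χ₁ r : ℝ) : ℂ) := by
    push_cast; ring
  rw [radius_eq hs0 hr (by rw [e]; exact Complex.ofReal_ne_zero.2 ht.ne'), e,
    ← Complex.ofReal_log ht.le, ← Complex.ofReal_mul, ← Complex.ofReal_exp, ← Complex.ofReal_mul,
    Complex.ofReal_re]
  field_simp

theorem IsAnalyticDistortion.eventually_eq (hs0 : 0 < s)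
    (hQ : IsAnalyticDistortion s R χ₁ q β₀ Q) {x : EuclideanSpace ℝ (Fin d)} (hx : x ≠ 0) :
    ∀ᶠ t : ℝ in 𝓝 0, Q (t : ℂ) x
      = ((q (Real.exp (1 / (2 * s) * Real.log (1 + t * profile s R χ₁ ‖x‖)) • x) : ℝ) : ℂ) := by
  have h : ∀ᶠ t : ℝ in 𝓝 0, 0 < 1 + t * profile s R χ₁ ‖x‖ := by
    have hc : ContinuousAt (fun t : ℝ => 1 + t * profile s R χ₁ ‖x‖) 0 := by fun_prop
    exact hc.eventually (lt_mem_nhds (by simp))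
  filter_upwards [h, hQ.extends_real x] with t ht hx'
  rw [hx', radius_ofReal_re_div hs0 (norm_pos_iff.2 hx) ht]

theorem IsAnalyticDistortion.apply_zero (hs0 : 0 < s)
    (hQ : IsAnalyticDistortion s R χ₁ q β₀ Q) {x : EuclideanSpace ℝ (Fin d)} (hx : x ≠ 0) :
    Q 0 x = (q x : ℂ) := by
  have h := (hQ.eventually_eq hs0 hx).self_of_nhds
  simpa using h

/-- The complex derivative at `0` can be computed along the real axis, where `q_θ` is `q` composed
with a real dilation and the chain rule gives a radial derivative. -/
theorem IsAnalyticDistortion.deriv_eq (hs0 : 0 < s) (hβ₀ : 0 < β₀)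
    (hQ : IsAnalyticDistortion s R χ₁ q β₀ Q) (hq : Differentiable ℝ q)
    {x : EuclideanSpace ℝ (Fin d)} (hx : x ≠ 0) :
    deriv (fun θ => Q θ x) 0
      = ((1 / (2 * s) * (‖x‖ * profile s R χ₁ ‖x‖) * radialDeriv q x : ℝ) : ℂ) := by
  have h1 : HasDerivAt (fun θ => Q θ x) (deriv (fun θ => Q θ x) 0) ((0 : ℝ) : ℂ) := by
    rw [Complex.ofReal_zero]
    exact ((hQ.holomorphic x).differentiableAt (Metric.ball_mem_nhds 0 hβ₀)).hasDerivAt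
  have h2 := h1.comp_ofReal
  set g := profile s R χ₁ ‖x‖
  have h3 : HasDerivAt (fun t : ℝ => Real.exp (1 / (2 * s) * Real.log (1 + t * g)) • x)
      ((1 / (2 * s) * g) • x) 0 := by
    have a : HasDerivAt (fun t : ℝ => 1 + t * g) g 0 := by
      simpa using ((hasDerivAt_id (0 : ℝ)).mul_const g).const_add 1
    have b := (((a.log (by simp)).const_mul (1 / (2 * s))).exp).smul_const x
    refine b.congr_deriv ?_
    simp
  have h4 : HasDerivAt (fun t : ℝ => q (Real.exp (1 / (2 * s) * Real.log (1 + t * g)) • x))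
      (1 / (2 * s) * (‖x‖ * g) * radialDeriv q x) 0 := by
    have hqx : HasFDerivAt q (fderiv ℝ q x)
        (Real.exp (1 / (2 * s) * Real.log (1 + (0 : ℝ) * g)) • x) := by
      simpa using (hq x).hasFDerivAt
    refine (hqx.comp_hasDerivAt (0 : ℝ) h3).congr_deriv ?_
    rw [map_smul, fderiv_self_eq_norm_smul_radialDeriv q hx]
    simp only [smul_eq_mul]; ring
  have h5 := h4.ofReal_comp
  exact h2.unique (h5.congr_of_eventuallyEq (hQ.eventually_eq hs0 hx))

/-- First order expansion of the distorted perturbation, uniformly in `x`. -/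
theorem IsAnalyticDistortion.exists_expansion (hs0 : 0 < s) (hβ₀ : 0 < β₀)
    (hQ : IsAnalyticDistortion s R χ₁ q β₀ Q) (hq : Differentiable ℝ q) :
    ∃ C : ℝ, 0 ≤ C ∧ ∀ β, 0 < β → β < β₀ → ∀ x, x ≠ 0 →
      ‖Q (Complex.I * β) x - q x‖ ≤ C * β ∧
      |(Q (Complex.I * β) x).im
        - β * (1 / (2 * s) * (‖x‖ * profile s R χ₁ ‖x‖) * radialDeriv q x)| ≤ C * β ^ 2 := by
  obtain ⟨M, hM⟩ := hQ.bounded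
  refine ⟨max (|M| / β₀) (2 * |M| / β₀ ^ 2), by positivity, ?_⟩
  intro β hβ hβ' x hx
  have hz : Complex.I * β ∈ Metric.ball (0 : ℂ) β₀ := by
    simpa [abs_of_pos hβ] using hβ'
  have hn : ‖Complex.I * (β : ℂ)‖ = β := by simp [abs_of_pos hβ]
  obtain ⟨h1, h2⟩ := norm_le_and_norm_sub_deriv_le_of_bounded (f := fun θ => Q θ x - q x) hβ₀
    ((hQ.holomorphic x).sub_const _) (by simp [hQ.apply_zero hs0 hx])
    (fun z hz => (hM z hz x).trans (le_abs_self M)) hz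
  rw [hn] at h1 h2
  constructor
  · refine h1.trans ?_
    gcongr
    exact le_max_left _ _
  · have hd : deriv (fun θ => Q θ x - q x) 0 = deriv (fun θ => Q θ x) 0 := by
      rw [deriv_sub_const]
    rw [hd, hQ.deriv_eq hs0 hβ₀ hq hx] at h2
    have h3 := (Complex.abs_im_le_norm _).trans h2
    simp only [Complex.sub_im, Complex.ofReal_im, sub_zero, Complex.im_mul_ofReal, Complex.I_im,
      one_mul] at h3
    refine h3.trans ?_
    gcongr
    exact le_max_right _ _

end Analytic

/-! ### Growth of the perturbation and the forbidden region -/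

section Growth

variable {d : ℕ} {s : ℝ} {q : EuclideanSpace ℝ (Fin d) → ℝ}

theorem le_bracket (x : EuclideanSpace ℝ (Fin d)) : ‖x‖ ≤ bracket x :=
  Real.le_sqrt_of_sq_le (by linarith)

theorem bracket_le {x : EuclideanSpace ℝ (Fin d)} (hx : 1 ≤ ‖x‖) : bracket x ≤ 2 * ‖x‖ := by
  rw [bracket, Real.sqrt_le_left (by linarith)]
  nlinarith

/-- A long-range perturbation is `o(|x|^{2s})`. -/
theorem LongRange.exists_abs_le (hs0 : 0 < s) (hs1 : s ≤ 1) (hq : LongRange s q) {ε : ℝ}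
    (hε : 0 < ε) : ∃ N : ℝ, 0 < N ∧ ∀ x, N ≤ ‖x‖ → |q x| ≤ ε * ‖x‖ ^ (2 * s) := by
  obtain ⟨-, ρ, hρ0, hρ1, C, hC, h⟩ := hq
  have hC0 := hC 0
  rcases hs1.lt_or_eq with hs | rfl
  · obtain ⟨N, hN⟩ := eventually_atTop.1 ((tendsto_rpow_atTop hρ0).eventually_ge_atTop
      (C 0 * 2 ^ (2 * s) / ε))
    refine ⟨max N 1, by positivity, fun x hx => ?_⟩
    have hx1 : 1 ≤ ‖x‖ := (le_max_right _ _).trans hx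
    have hx0 : 0 < ‖x‖ := by linarith
    have h1 := (h 0 x).1 hs
    rw [norm_iteratedFDeriv_zero, Real.norm_eq_abs] at h1
    have hb0 : 0 < bracket x := hx0.trans_le (le_bracket x)
    have h2 : bracket x ^ (2 * s - ((0 : ℕ) : ℝ) - ρ) ≤ (2 * ‖x‖) ^ (2 * s) / ‖x‖ ^ ρ := by
      rw [Nat.cast_zero, sub_zero, Real.rpow_sub hb0]
      exact div_le_div₀ (by positivity) (Real.rpow_le_rpow hb0.le (bracket_le hx1) (by positivity))
        (by positivity) (Real.rpow_le_rpow hx0.le (le_bracket x) hρ0.le)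
    have h3 := hN ‖x‖ ((le_max_left _ _).trans hx)
    rw [div_le_iff₀ hε] at h3
    refine h1.trans ((mul_le_mul_of_nonneg_left h2 hC0.le).trans ?_)
    rw [← mul_div_assoc, div_le_iff₀ (by positivity), Real.mul_rpow (by norm_num) hx0.le]
    have h4 := mul_le_mul_of_nonneg_right h3 (by positivity : (0 : ℝ) ≤ ‖x‖ ^ (2 * s))
    linarith
  · obtain ⟨N, hN⟩ := eventually_atTop.1 (((tendsto_rpow_atTop (by linarith : 0 < 1 + ρ)).comp
      Real.tendsto_log_atTop).eventually_ge_atTop (C 0 * 4 / ε))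
    refine ⟨max N 1, by positivity, fun x hx => ?_⟩
    have hx1 : 1 ≤ ‖x‖ := (le_max_right _ _).trans hx
    have hx0 : 0 < ‖x‖ := by linarith
    have h1 := (h 0 x).2 rfl
    rw [norm_iteratedFDeriv_zero, Real.norm_eq_abs, Nat.cast_zero, sub_zero] at h1
    have hb0 : 0 < bracket x := hx0.trans_le (le_bracket x)
    have h2 : bracket x ^ (2 : ℝ) ≤ 4 * ‖x‖ ^ (2 : ℝ) := by
      rw [Real.rpow_two, Real.rpow_two]
      have := bracket_le hx1
      nlinarith
    have h3 := hN ‖x‖ ((le_max_left _ _).trans hx)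
    simp only [Function.comp] at h3
    have h4 : Real.log ‖x‖ ^ (1 + ρ) ≤ Real.log (bracket x) ^ (1 + ρ) :=
      Real.rpow_le_rpow (Real.log_nonneg hx1) (Real.log_le_log hx0 (le_bracket x)) (by linarith)
    have h5 : C 0 * 4 / ε * |q x| ≤ C 0 * (4 * ‖x‖ ^ (2 : ℝ)) :=
      (mul_le_mul_of_nonneg_right (h3.trans h4) (abs_nonneg _)).trans
        (h1.trans (mul_le_mul_of_nonneg_left h2 hC0.le))
    rw [div_mul_eq_mul_div, div_le_iff₀ hε] at h5
    rw [mul_one]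
    have h6 : (C 0 * 4) * |q x| ≤ (C 0 * 4) * (ε * ‖x‖ ^ (2 : ℝ)) := by linarith
    exact le_of_mul_le_mul_left h6 (by positivity)

theorem LongRange.exists_abs_le_one_add (hs0 : 0 < s) (hs1 : s ≤ 1) (hq : LongRange s q) :
    ∃ C : ℝ, 0 ≤ C ∧ ∀ x, |q x| ≤ C * (1 + ‖x‖ ^ (2 * s)) := by
  obtain ⟨N, -, hN⟩ := hq.exists_abs_le hs0 hs1 one_pos
  obtain ⟨C, hC⟩ := (isCompact_closedBall (0 : EuclideanSpace ℝ (Fin d)) N).exists_bound_of_continuousOn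
    hq.1.continuous.continuousOn
  refine ⟨max 1 C, by positivity, fun x => ?_⟩
  have hp : 0 ≤ ‖x‖ ^ (2 * s) := by positivity
  rcases le_total N ‖x‖ with h | h
  · refine (hN x h).trans (mul_le_mul (le_max_left _ _) (by linarith) hp (by positivity))
  · have h1 := hC x (by simpa using h)
    rw [Real.norm_eq_abs] at h1
    calc |q x| ≤ C := h1
      _ ≤ max 1 C := le_max_right _ _
      _ ≤ max 1 C * (1 + ‖x‖ ^ (2 * s)) := le_mul_of_one_le_right (by positivity) (by linarith)

theorem exists_norm_eq (hd : 1 ≤ d) {r : ℝ} (hr : 0 ≤ r) :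
    ∃ x : EuclideanSpace ℝ (Fin d), ‖x‖ = r :=
  ⟨EuclideanSpace.single ⟨0, hd⟩ r, by simp [abs_of_nonneg hr]⟩

/-- The classically forbidden region is bounded. -/
theorem LongRange.exists_forbidden_subset (hd : 1 ≤ d) (hs0 : 0 < s) (hs1 : s ≤ 1)
    (hq : LongRange s q) {χ : ℝ → ℝ} {E α : ℝ} (hα : 0 < α)
    (hforbidden : ∀ x : EuclideanSpace ℝ (Fin d), ‖x‖ ∈ radialSupp χ →
      α ≤ -(1 / 2) * ‖x‖ ^ (2 * s) + q x - E) :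
    ∃ N : ℝ, ∀ r, 0 ≤ r → χ r ≠ 0 → r ≤ N := by
  obtain ⟨N, hN0, hN⟩ := hq.exists_abs_le hs0 hs1 (by norm_num : (0 : ℝ) < 1 / 4)
  obtain ⟨N', hN'⟩ := eventually_atTop.1 ((tendsto_rpow_atTop
    (by positivity : 0 < 2 * s)).eventually_ge_atTop (4 * |E|))
  refine ⟨max N N', fun r hr hχ => ?_⟩
  by_contra hlt
  push Not at hlt
  obtain ⟨x, hx⟩ := exists_norm_eq hd hr
  have h1 := hforbidden x (by rw [hx]; exact subset_closure ⟨hr, hχ⟩)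
  have h2 := hN x (by rw [hx]; exact (le_max_left _ _).trans hlt.le)
  have h3 := hN' ‖x‖ (by rw [hx]; exact (le_max_right _ _).trans hlt.le)
  -- Far out, `|q| ≤ r^{2s}/4` and `|E| ≤ r^{2s}/4`, so `-½ r^{2s} + q - E ≤ 0 < α`.
  have := le_abs_self (q x)
  have := neg_abs_le E
  linarith

/-- The bound on the derivative comes from compactness: `χ` is nonzero only on a bounded set of
radii. -/
theorem exists_isPartition {χ χ' : ℝ → ℝ} (hχ : ContDiffOn ℝ 1 χ (Set.Ici 0))
    (hχ' : ContDiffOn ℝ 1 χ' (Set.Ici 0)) (hsq : ∀ r, 0 ≤ r → χ r ^ 2 + χ' r ^ 2 = 1)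
    (hχ_near : ∀ᶠ r in 𝓝[≥] (0 : ℝ), χ r = 1) {N : ℝ} (hN : ∀ r, 0 ≤ r → χ r ≠ 0 → r ≤ N) :
    ∃ ε D, IsPartition χ χ' ε D := by
  obtain ⟨ε, hε, h⟩ := mem_nhdsGE_iff_exists_Ico_subset.1 hχ_near
  have hc : ContinuousOn (derivWithin χ (Ici 0)) (Ici 0) :=
    hχ.continuousOn_derivWithin (uniqueDiffOn_Ici 0) le_rfl
  obtain ⟨D, hD⟩ := (isCompact_Icc (a := (0 : ℝ)) (b := N)).exists_bound_of_continuousOn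
    (hc.mono Icc_subset_Ici_self)
  refine ⟨ε, max D 0, hχ.mono Ioi_subset_Ici_self, hχ'.mono Ioi_subset_Ici_self, hsq, hε,
    fun r h0 h1 => h ⟨h0, h1⟩, fun r hr h0 => ?_, le_max_right _ _⟩
  have h1 := hD r ⟨hr.le, hN r hr.le h0⟩
  rw [derivWithin_of_mem_nhds (Ici_mem_nhds hr)] at h1
  exact h1.trans (le_max_left _ _)

end Growth

/-! ### Rotated potential, phase expansion and virial identity -/

theorem abs_sin_sub_le {x : ℝ} (hx : |x| ≤ 1) : |Real.sin x - x| ≤ x ^ 2 := by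
  have h := Real.sin_bound hx
  have h0 := abs_nonneg x
  have h1 : |x| ^ 4 ≤ |x| ^ 2 := pow_le_pow_of_le_one h0 hx (by norm_num)
  have h2 : |x ^ 3| ≤ |x| ^ 2 := by
    rw [abs_pow]; exact pow_le_pow_of_le_one h0 hx (by norm_num)
  have h3 : |Real.sin x - x| ≤ |Real.sin x - (x - x ^ 3 / 6)| + |x ^ 3| / 6 := by
    have e : Real.sin x - x = (Real.sin x - (x - x ^ 3 / 6)) + -(x ^ 3 / 6) := by ring
    rw [e]
    refine (abs_add_le _ _).trans ?_
    rw [abs_neg, abs_div, abs_of_pos (by norm_num : (0 : ℝ) < 6)]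
  rw [← sq_abs x]
  nlinarith [sq_nonneg |x|]

/-- The rotated imaginary part of the distorted potential is positive to first order in `β` under
the virial condition. All constants are uniform. -/
theorem rotated_potential_lower_bound {β P g κ κ₁ u q₀ rq iq E μ γ C c Λ G : ℝ} (hβ : 0 < β)
    (hβ1 : β ≤ 1) (hP : 0 ≤ P) (hμ : 0 ≤ μ) (hC : 0 ≤ C) (hc : 0 ≤ c) (hG : 0 ≤ G)
    (hvirial : γ ≤ 1 / 2 * (g * P) - κ₁ * (-(1 / 2) * P + q₀ - E) - u - μ)
    (hrq : |rq - q₀| ≤ C * β) (hiq : |iq| ≤ C * β) (hu : |iq - β * u| ≤ C * β ^ 2)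
    (hκ : |κ| ≤ 1) (hκκ : |κ - β * κ₁| ≤ c * β ^ 2 * G) (hκ2 : κ ^ 2 ≤ c * β ^ 2 * G)
    (hκ₁ : |κ₁| ≤ c) (hg : |g| ≤ c) (hq₀ : |q₀| ≤ C * (1 + P)) (hΛ : G * (1 + P) ≤ Λ) :
    β * γ - (c * Λ * (c + C + μ) + C + 2 * c * Λ * (1 + 2 * C + |E|) + c * C) * β ^ 2
      ≤ -(Real.cos κ * (-(1 / 2) * (β * (P * g)) + iq + β * μ))
        - Real.sin κ * (-(1 / 2) * P + rq - E) := by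
  set I := -(1 / 2) * (β * (P * g)) + iq + β * μ with hI
  set W := -(1 / 2) * P + rq - E with hW
  have hIb : |I| ≤ (c + C + μ) * (1 + P) := by
    have h1 : |-(1 / 2) * (β * (P * g))| ≤ c * (1 + P) := by
      rw [abs_mul, abs_mul, abs_mul, abs_of_pos hβ, abs_of_nonneg hP, abs_neg,
        abs_of_pos (by norm_num : (0 : ℝ) < 1 / 2)]
      have h2 : β * (P * |g|) ≤ 1 * (P * c) := by gcongr
      have := mul_nonneg hP hc
      nlinarith
    have h2 : |iq| ≤ C * (1 + P) := by
      have := mul_nonneg hC hP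
      nlinarith
    have h3 : |β * μ| ≤ μ * (1 + P) := by
      rw [abs_of_nonneg (by positivity)]
      have := mul_nonneg hμ hP
      nlinarith
    calc |I| ≤ |-(1 / 2) * (β * (P * g))| + |iq| + |β * μ| :=
          (abs_add_le _ _).trans (add_le_add (abs_add_le _ _) le_rfl)
      _ ≤ _ := by linarith
  have hWb : |W| ≤ (1 + 2 * C + |E|) * (1 + P) := by
    have h1 : |rq| ≤ C + C * (1 + P) := by
      have : |rq| ≤ |rq - q₀| + |q₀| := by simpa using abs_add_le (rq - q₀) q₀
      nlinarith
    have h2 := mul_nonneg hC hP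
    have h3 := mul_nonneg (abs_nonneg E) hP
    have h4 : |W| ≤ 1 / 2 * P + |rq| + |E| := by
      rw [abs_le]
      have := neg_abs_le rq
      have := le_abs_self rq
      have := neg_abs_le E
      have := le_abs_self E
      constructor <;> linarith
    nlinarith
  have hcos : |1 - Real.cos κ| ≤ c * β ^ 2 * G := by
    have h1 := Real.one_sub_sq_div_two_le_cos (x := κ)
    have h2 := Real.cos_le_one κ
    rw [abs_of_nonneg (by linarith)]
    nlinarith [sq_nonneg κ]
  have hsin : |Real.sin κ - β * κ₁| ≤ 2 * (c * β ^ 2 * G) := by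
    have h1 := abs_add_le (Real.sin κ - κ) (κ - β * κ₁)
    have h2 := abs_sin_sub_le hκ
    rw [sub_add_sub_cancel] at h1
    linarith
  have t1 : |(1 - Real.cos κ) * I| ≤ c * Λ * (c + C + μ) * β ^ 2 := by
    rw [abs_mul]
    calc |1 - Real.cos κ| * |I| ≤ (c * β ^ 2 * G) * ((c + C + μ) * (1 + P)) := by gcongr
      _ = c * β ^ 2 * (c + C + μ) * (G * (1 + P)) := by ring
      _ ≤ c * β ^ 2 * (c + C + μ) * Λ := by gcongr
      _ = _ := by ring
  have t2 : |(Real.sin κ - β * κ₁) * W| ≤ 2 * c * Λ * (1 + 2 * C + |E|) * β ^ 2 := by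
    rw [abs_mul]
    calc |Real.sin κ - β * κ₁| * |W|
        ≤ (2 * (c * β ^ 2 * G)) * ((1 + 2 * C + |E|) * (1 + P)) := by gcongr
      _ = 2 * c * β ^ 2 * (1 + 2 * C + |E|) * (G * (1 + P)) := by ring
      _ ≤ 2 * c * β ^ 2 * (1 + 2 * C + |E|) * Λ := by gcongr
      _ = _ := by ring
  have t3 : |β * κ₁ * (rq - q₀)| ≤ c * C * β ^ 2 := by
    rw [abs_mul, abs_mul, abs_of_pos hβ]
    calc β * |κ₁| * |rq - q₀| ≤ β * c * (C * β) := by gcongr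
      _ = _ := by ring
  have hv := mul_le_mul_of_nonneg_left hvirial hβ.le
  -- The virial expression times `β`, plus four errors, each `O(β²)`. Those multiplying `I` and `W`,
  -- which may grow like `1 + P`, carry a factor `G` with `G (1 + P) ≤ Λ`.
  have e : -(Real.cos κ * I) - Real.sin κ * W
      = β * (1 / 2 * (g * P) - κ₁ * (-(1 / 2) * P + q₀ - E) - u - μ)
        + (1 - Real.cos κ) * I - (iq - β * u) - (Real.sin κ - β * κ₁) * W
        - β * κ₁ * (rq - q₀) := by
    rw [hI, hW]; ring
  rw [e]
  have := (abs_le.1 t1).1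
  have := (abs_le.1 hu).2
  have := (abs_le.1 t2).2
  have := (abs_le.1 t3).2
  linarith

/-- `τ` with `r_θ = r exp τ` for `θ = iβ`. -/
def radiusExponent (s R : ℝ) (χ₁ : ℝ → ℝ) (β r : ℝ) : ℂ :=
  ((1 / (2 * s) : ℝ) : ℂ) * logExponent β (profile s R χ₁) r
    + ((0 : ℝ) : ℂ) * logExponent β (profileDeriv s R χ₁) r

/-- `l` with `∂_r r_θ = exp l` for `θ = iβ`. -/
def derivExponent (s R : ℝ) (χ₁ : ℝ → ℝ) (β r : ℝ) : ℂ :=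
  ((1 / (2 * s) - 1 : ℝ) : ℂ) * logExponent β (profile s R χ₁) r
    + ((1 : ℝ) : ℂ) * logExponent β (profileDeriv s R χ₁) r

section Exponents

variable {s R : ℝ} {χ₁ : ℝ → ℝ}

theorem derivExponent_sub_radiusExponent (β r : ℝ) :
    derivExponent s R χ₁ β r - radiusExponent s R χ₁ β r
      = logExponent β (profileDeriv s R χ₁) r - logExponent β (profile s R χ₁) r := by
  rw [derivExponent, radiusExponent]
  push_cast
  ring

theorem abs_im_linear_comb_le {a b e : ℝ} {z w : ℂ} (hz : ‖z‖ ≤ e) (hw : ‖w‖ ≤ e) :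
    |((a : ℂ) * z + (b : ℂ) * w).im| ≤ (|a| + |b|) * e := by
  refine (Complex.abs_im_le_norm _).trans ((norm_add_le _ _).trans ?_)
  rw [norm_mul, norm_mul, Complex.norm_real, Complex.norm_real, Real.norm_eq_abs, Real.norm_eq_abs,
    add_mul]
  gcongr

/-- The quotient `(1 + iβg) / (1 + iβf)` has nonnegative real part and, since `g ≤ f`, nonpositive
imaginary part; its square then has nonpositive imaginary part. -/
theorem im_sq_exp_sub_nonpos {β : ℝ} (hβ : 0 ≤ β) {f g : ℝ → ℝ} {r : ℝ} (hg : 0 ≤ g r)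
    (hfg : g r ≤ f r) :
    (Complex.exp (logExponent β g r - logExponent β f r) ^ 2).im ≤ 0 := by
  rw [Complex.exp_sub, exp_logExponent, exp_logExponent]
  have hf : 0 ≤ f r := hg.trans hfg
  have e : (1 + Complex.I * β * g r) / (1 + Complex.I * β * f r)
      = (((1 + β ^ 2 * (g r * f r)) / (1 + β ^ 2 * f r ^ 2) : ℝ) : ℂ)
        + ((β * (g r - f r) / (1 + β ^ 2 * f r ^ 2) : ℝ) : ℂ) * Complex.I := by
    have h1 := one_add_I_mul_ne_zero β (f r)
    have h2 : (1 + (β : ℂ) ^ 2 * (f r : ℂ) ^ 2) ≠ 0 := by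
      have : (0 : ℝ) < 1 + β ^ 2 * f r ^ 2 := by positivity
      exact_mod_cast this.ne'
    push_cast
    field_simp
    linear_combination (-(β : ℂ) ^ 2 * f r * (g r - f r)) * Complex.I_sq
  rw [e, sq, Complex.mul_im]
  simp only [Complex.add_re, Complex.add_im, Complex.ofReal_re, Complex.ofReal_im,
    Complex.re_ofReal_mul, Complex.im_ofReal_mul, Complex.I_re, Complex.I_im]
  have h1 : 0 ≤ (1 + β ^ 2 * (g r * f r)) / (1 + β ^ 2 * f r ^ 2) := by positivity
  have h2 : β * (g r - f r) / (1 + β ^ 2 * f r ^ 2) ≤ 0 :=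
    div_nonpos_of_nonpos_of_nonneg (mul_nonpos_of_nonneg_of_nonpos hβ (by linarith)) (by positivity)
  nlinarith [mul_nonneg h1 (neg_nonneg.2 h2)]

theorem abs_im_logExponent_sub_le {β C y : ℝ} (hβ : 0 ≤ β) (hy : |y| ≤ C) (hC : β * C ≤ 1 / 2) :
    |(Complex.log (1 + Complex.I * β * y)).im - β * y| ≤ β ^ 2 * y ^ 2 ∧
    |(Complex.log (1 + Complex.I * β * y)).im| ≤ 2 * (β * |y|) := by
  have hn : ‖Complex.I * β * y‖ = β * |y| := by
    rw [norm_mul, norm_mul, Complex.norm_I, Complex.norm_real, Complex.norm_real,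
      Real.norm_of_nonneg hβ, Real.norm_eq_abs, one_mul]
  have hle : β * |y| ≤ 1 / 2 := (mul_le_mul_of_nonneg_left hy hβ).trans hC
  have h1 := Complex.norm_log_one_add_sub_self_le (z := Complex.I * β * y) (by rw [hn]; linarith)
  rw [hn] at h1
  have h2 : (1 - β * |y|)⁻¹ ≤ 2 := by
    rw [inv_le_comm₀ (by linarith) (by norm_num)]; linarith
  have h3 : |(Complex.log (1 + Complex.I * β * y)).im - β * y| ≤ (β * |y|) ^ 2 := by
    have h4 := (Complex.abs_im_le_norm _).trans h1
    have h5 : (Complex.log (1 + Complex.I * β * y) - Complex.I * β * y).im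
        = (Complex.log (1 + Complex.I * β * y)).im - β * y := by simp
    rw [h5] at h4
    nlinarith [sq_nonneg (β * |y|)]
  have h6 : (β * |y|) ^ 2 = β ^ 2 * y ^ 2 := by rw [mul_pow, sq_abs]
  refine ⟨by rw [← h6]; exact h3, ?_⟩
  have h7 : |(Complex.log (1 + Complex.I * β * y)).im|
      ≤ |(Complex.log (1 + Complex.I * β * y)).im - β * y| + |β * y| := by
    simpa using abs_add_le ((Complex.log (1 + Complex.I * β * y)).im - β * y) (β * y)
  rw [abs_mul, abs_of_nonneg hβ] at h7
  have h8 : 0 ≤ β * |y| := by positivity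
  nlinarith

/-- First order expansion of the phase `2 Im l`. -/
theorem phase_expansion {β C : ℝ} (hβ : 0 ≤ β) (hC : β * C ≤ 1 / 2) {r : ℝ}
    (hg : |profile s R χ₁ r| ≤ C) (hg₁ : |profileDeriv s R χ₁ r| ≤ C) :
    |2 * (derivExponent s R χ₁ β r).im
        - β * (2 * ((1 / (2 * s) - 1) * profile s R χ₁ r + profileDeriv s R χ₁ r))|
      ≤ 32 * (|1 / (2 * s) - 1| + 1) ^ 2 * β ^ 2
        * (profile s R χ₁ r ^ 2 + profileDeriv s R χ₁ r ^ 2) ∧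
    (2 * (derivExponent s R χ₁ β r).im) ^ 2
      ≤ 32 * (|1 / (2 * s) - 1| + 1) ^ 2 * β ^ 2
        * (profile s R χ₁ r ^ 2 + profileDeriv s R χ₁ r ^ 2) := by
  obtain ⟨a1, a2⟩ := abs_im_logExponent_sub_le hβ hg hC
  obtain ⟨b1, b2⟩ := abs_im_logExponent_sub_le hβ hg₁ hC
  have him : (derivExponent s R χ₁ β r).im
      = (1 / (2 * s) - 1) * (Complex.log (1 + Complex.I * β * (profile s R χ₁ r : ℝ))).im
        + (Complex.log (1 + Complex.I * β * (profileDeriv s R χ₁ r : ℝ))).im := by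
    rw [derivExponent, Complex.add_im, Complex.im_ofReal_mul, Complex.im_ofReal_mul, one_mul]
    rfl
  rw [him]
  generalize (Complex.log (1 + Complex.I * β * (profile s R χ₁ r : ℝ))).im = A at *
  generalize (Complex.log (1 + Complex.I * β * (profileDeriv s R χ₁ r : ℝ))).im = B at *
  generalize profile s R χ₁ r = g at *
  generalize profileDeriv s R χ₁ r = g₁ at *
  generalize 1 / (2 * s) - 1 = σ at *
  have hσ := abs_nonneg σ
  constructor
  · have e : 2 * (σ * A + B) - β * (2 * (σ * g + g₁)) = 2 * (σ * (A - β * g) + (B - β * g₁)) := by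
      ring
    rw [e, abs_mul, abs_two]
    have h1 : |σ * (A - β * g) + (B - β * g₁)| ≤ |σ| * (β ^ 2 * g ^ 2) + β ^ 2 * g₁ ^ 2 := by
      refine (abs_add_le _ _).trans (add_le_add ?_ b1)
      rw [abs_mul]
      gcongr
    have h2 : 0 ≤ β ^ 2 * g ^ 2 := by positivity
    have h3 : 0 ≤ β ^ 2 * g₁ ^ 2 := by positivity
    have h4 : |σ| * (β ^ 2 * g ^ 2) + β ^ 2 * g₁ ^ 2
        ≤ (|σ| + 1) * (β ^ 2 * g ^ 2 + β ^ 2 * g₁ ^ 2) := by nlinarith [mul_nonneg hσ h3]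
    have h5 : (|σ| + 1) * (β ^ 2 * g ^ 2 + β ^ 2 * g₁ ^ 2)
        ≤ (|σ| + 1) ^ 2 * (β ^ 2 * g ^ 2 + β ^ 2 * g₁ ^ 2) :=
      mul_le_mul_of_nonneg_right (by nlinarith) (by positivity)
    have h6 : 0 ≤ (|σ| + 1) ^ 2 * (β ^ 2 * g ^ 2 + β ^ 2 * g₁ ^ 2) := by positivity
    -- The constant `2` is enough here; `32 = 4² · 2` is what the bound on the square of the phase
    -- needs.
    calc _ ≤ 2 * ((|σ| + 1) ^ 2 * (β ^ 2 * g ^ 2 + β ^ 2 * g₁ ^ 2)) := by linarith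
      _ ≤ 32 * ((|σ| + 1) ^ 2 * (β ^ 2 * g ^ 2 + β ^ 2 * g₁ ^ 2)) := by linarith
      _ = _ := by ring
  · have h1 : |2 * (σ * A + B)| ≤ 4 * (|σ| + 1) * (β * (|g| + |g₁|)) := by
      rw [abs_mul, abs_two]
      have h2 : |σ * A + B| ≤ |σ| * (2 * (β * |g|)) + 2 * (β * |g₁|) := by
        refine (abs_add_le _ _).trans (add_le_add ?_ b2)
        rw [abs_mul]
        gcongr
      have h3 : 0 ≤ |σ| * (β * |g₁|) := by positivity
      have h4 : 0 ≤ β * |g| := by positivity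
      nlinarith
    rw [← sq_abs]
    have h5 : (|g| + |g₁|) ^ 2 ≤ 2 * (g ^ 2 + g₁ ^ 2) := by
      rw [← sq_abs g, ← sq_abs g₁]
      nlinarith [sq_nonneg (|g| - |g₁|)]
    calc |2 * (σ * A + B)| ^ 2 ≤ (4 * (|σ| + 1) * (β * (|g| + |g₁|))) ^ 2 := by gcongr
      _ = 16 * (|σ| + 1) ^ 2 * β ^ 2 * (|g| + |g₁|) ^ 2 := by ring
      _ ≤ 16 * (|σ| + 1) ^ 2 * β ^ 2 * (2 * (g ^ 2 + g₁ ^ 2)) := by gcongr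
      _ = _ := by ring

theorem HasLogPowTail.mul_rpow {k : ℝ} {f : ℝ → ℝ} (hf : HasLogPowTail R k f) (p : ℝ) :
    HasLogPowTail R (k - p) (fun r => f r * r ^ p) where
  contDiffOn := hf.contDiffOn.mul fun r hr =>
    (Real.contDiffAt_rpow_const_of_ne (ne_of_gt hr)).contDiffWithinAt
  eq_zero := fun r h0 h1 => by simp [hf.eq_zero r h0 h1]
  eq_tail := by
    obtain ⟨A, B, N, h⟩ := hf.eq_tail
    refine ⟨A, B, max N 0, fun r hr => ?_⟩
    have hr0 : 0 < r := (le_max_right _ _).trans_lt hr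
    rw [h r ((le_max_left _ _).trans_lt hr), mul_assoc, ← Real.rpow_add hr0]
    congr 2
    ring

/-- Both `f` and `f r^s` are bounded, because the tail decays like `r^{-2s} log r`. Hence squares of
the phase compensate the growth `r^{2s}` of the potential. -/
theorem exists_sq_mul_one_add_le {f : ℝ → ℝ} (hs0 : 0 < s) (hR : 0 < R)
    (hf : HasLogPowTail R (2 * s) f) :
    ∃ C : ℝ, ∀ r, 0 < r → f r ^ 2 * (1 + r ^ (2 * s)) ≤ C := by
  obtain ⟨C₁, h₁⟩ := hf.bounded hR (by linarith)
  obtain ⟨C₂, h₂⟩ := (hf.mul_rpow s).bounded hR (by linarith)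
  refine ⟨C₁ ^ 2 + C₂ ^ 2, fun r hr => ?_⟩
  have e : r ^ (2 * s) = r ^ s * r ^ s := by rw [← Real.rpow_add hr]; congr 1; ring
  have a := pow_le_pow_left₀ (abs_nonneg _) (h₁ r hr) 2
  have b := pow_le_pow_left₀ (abs_nonneg _) (h₂ r hr) 2
  rw [sq_abs] at a b
  rw [e]
  nlinarith

end Exponents

section Virial

variable {d : ℕ} {s R : ℝ} {χ₁ : ℝ → ℝ} {q : EuclideanSpace ℝ (Fin d) → ℝ}

theorem profile_of_cutoff_eq_one {r : ℝ} (h : χ₁ (r ^ (2 * s) / R ^ (2 * s)) = 1) :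
    profile s R χ₁ r = 2 * (if s < 1 then s else Real.log r) * r ^ (-(2 * s)) := by
  rw [profile, h, mul_one]

/-- Both forms of the virial condition, written with the profile of the distortion. -/
theorem virial_eq (hs0 : 0 < s) (hs1 : s ≤ 1) (hχ₁ : ContDiff ℝ ∞ χ₁)
    (hmem : ∀ t, χ₁ t ∈ Set.Icc (0 : ℝ) 1) {E μ γ : ℝ} {x : EuclideanSpace ℝ (Fin d)} (hx : x ≠ 0)
    (h : χ₁ (‖x‖ ^ (2 * s) / R ^ (2 * s)) = 1)
    (hlt : s < 1 → γ ≤ 1 - s - 2 * (1 - 2 * s) * ‖x‖ ^ (-(2 * s)) * (q x - E)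
        - ‖x‖ ^ (1 - 2 * s) * radialDeriv q x - μ)
    (hone : s = 1 → γ ≤ 1 + 2 * (‖x‖ ^ 2)⁻¹ * (Real.log ‖x‖ - 1) * (q x - E)
        - ‖x‖⁻¹ * Real.log ‖x‖ * radialDeriv q x - μ) :
    γ ≤ 1 / 2 * (profile s R χ₁ ‖x‖ * ‖x‖ ^ (2 * s))
      - 2 * ((1 / (2 * s) - 1) * profile s R χ₁ ‖x‖ + profileDeriv s R χ₁ ‖x‖)
        * (-(1 / 2) * ‖x‖ ^ (2 * s) + q x - E)
      - 1 / (2 * s) * (‖x‖ * profile s R χ₁ ‖x‖) * radialDeriv q x - μ := by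
  have hr : 0 < ‖x‖ := norm_pos_iff.2 hx
  -- For `s < 1` the constant `1 - s` arises as `s` from `½ g r^{2s}` plus `1 - 2s` from the phase
  -- acting on `-½ r^{2s}`; for `s = 1` it is `log r + (1 - log r) = 1`.
  rw [profileDeriv_eq_of_cutoff_eq_one hs0 hχ₁ hmem hr h, profile_of_cutoff_eq_one h]
  have e1 : ‖x‖ ^ (-(2 * s)) * ‖x‖ ^ (2 * s) = 1 := by rw [← Real.rpow_add hr]; simp
  rcases hs1.lt_or_eq with hs | rfl
  · refine (hlt hs).trans (le_of_eq ?_)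
    simp only [hs, if_true]
    have e2 : ‖x‖ ^ (1 - 2 * s) = ‖x‖ * ‖x‖ ^ (-(2 * s)) := by
      rw [show (1 : ℝ) - 2 * s = 1 + -(2 * s) by ring, Real.rpow_add hr, Real.rpow_one]
    rw [e2]
    generalize ‖x‖ ^ (-(2 * s)) = y at *
    generalize ‖x‖ ^ (2 * s) = P at *
    generalize radialDeriv q x = w
    have e3 : 1 / (2 * s) * s = 1 / 2 := by field_simp
    linear_combination (-(1 - s)) * e1 - (2 * y * (-(1 / 2) * P + q x - E) + ‖x‖ * y * w) * (-2 * e3)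
  · refine (hone rfl).trans (le_of_eq ?_)
    simp only [lt_irrefl, if_false]
    have e2 : (‖x‖ ^ 2)⁻¹ = ‖x‖ ^ (-(2 * (1 : ℝ))) := by
      rw [Real.rpow_neg hr.le, mul_one, Real.rpow_two]
    have e4 : ‖x‖⁻¹ = ‖x‖ * ‖x‖ ^ (-(2 * (1 : ℝ))) := by
      rw [← e2]; field_simp
    rw [e2, e4]
    generalize ‖x‖ ^ (-(2 * (1 : ℝ))) = y at *
    generalize ‖x‖ ^ (2 * (1 : ℝ)) = P at *
    generalize radialDeriv q x = w
    linear_combination (-1) * e1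

end Virial

theorem exists_exponent_bounds (d : ℕ) {s R : ℝ} {χ₁ : ℝ → ℝ} (hs0 : 0 < s) (hR : 0 < R)
    (hχ₁ : ContDiff ℝ ∞ χ₁) (h0 : ∀ t, t ≤ 1 → χ₁ t = 0) (h1 : ∀ t, 2 ≤ t → χ₁ t = 1) :
    ∃ B C β₂ : ℝ, 0 ≤ C ∧ 0 < β₂ ∧ β₂ ≤ 1 ∧
      (∀ r, 0 < r → |profile s R χ₁ r| ≤ C ∧ |profileDeriv s R χ₁ r| ≤ C) ∧
      ∀ β, 0 < β → β < β₂ → β * C ≤ 1 / 2 ∧ IsExponent R B (derivExponent s R χ₁ β) ∧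
        IsExponent R B (radiusExponent s R χ₁ β) ∧ ∀ r, 0 < r →
          |2 * (derivExponent s R χ₁ β r).im| ≤ 1 ∧ |2 * (radiusExponent s R χ₁ β r).im| ≤ 1 ∧
          |(derivExponent s R χ₁ β r + ((d : ℂ) - 1) * radiusExponent s R χ₁ β r).im| < Real.pi := by
  obtain ⟨Ca, ha0, ha⟩ := (hasLogPowTail_profile hs0 hR hχ₁ h0 h1).exists_isBoundedProfile hR
    (by linarith) fun r => profile_eq_zero hs0 hR hχ₁ h0 h1
  obtain ⟨Cb, hb0, hb⟩ := (hasLogPowTail_profileDeriv hs0 hR hχ₁ h0 h1).exists_isBoundedProfile hR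
    (by linarith) fun r => profileDeriv_eq_zero hs0 hR hχ₁ h0 h1
  set C := max Ca Cb with hC
  have hC0 : 0 ≤ C := ha0.trans (le_max_left _ _)
  have ha' := ha.mono (le_max_left Ca Cb)
  have hb' := hb.mono (le_max_right Ca Cb)
  set σ : ℝ := 1 / (2 * s) with hσ
  -- `m` dominates the coefficients of `l`, of `τ` and of `l + (d-1) τ` at once; the threshold on
  -- `β` makes `m · (3/2) β C ≤ 1/2`.
  set m : ℝ := |σ - 1| + 1 + |σ| + (d + 1) * |σ| with hm
  have hm1 : 1 ≤ m := by
    have := abs_nonneg (σ - 1)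
    have : 0 ≤ |σ| + (d + 1) * |σ| := by positivity
    linarith
  set B₀ := 1 + C + C ^ 2 with hB₀
  have hB₀n : 0 ≤ B₀ := by positivity
  refine ⟨m * B₀, C, (3 * m * (C + 1))⁻¹, hC0, by positivity, ?_, fun r hr =>
    ⟨ha'.abs_le r hr, hb'.abs_le r hr⟩, ?_⟩
  · apply inv_le_one_of_one_le₀
    nlinarith
  intro β hβ hβ2
  have hβm : β * (3 * m * (C + 1)) ≤ 1 := by
    have h := mul_le_mul_of_nonneg_right hβ2.le (by positivity : 0 ≤ 3 * m * (C + 1))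
    rwa [inv_mul_cancel₀ (by positivity)] at h
  have hβC : m * (3 / 2 * (β * C)) ≤ 1 / 2 := by
    have : 0 ≤ β * m := by positivity
    nlinarith
  have hβC0 : 0 ≤ β * C := by positivity
  have hβC' : β * C ≤ 1 / 2 := by nlinarith
  have hβ1 : β ≤ 1 := by
    have : 1 ≤ 3 * m * (C + 1) := by nlinarith
    nlinarith
  have x0 := isExponent_logExponent ha' hβ.le hβ1 hβC'
  have x1 := isExponent_logExponent hb' hβ.le hβ1 hβC'
  refine ⟨hβC', (x0.linear_comb x1 _ _).mono (mul_le_mul_of_nonneg_right ?_ hB₀n),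
    (x0.linear_comb x1 _ _).mono (mul_le_mul_of_nonneg_right ?_ hB₀n), fun r hr => ?_⟩
  · rw [abs_one]
    have : 0 ≤ |σ| + (d + 1) * |σ| := by positivity
    linarith
  · rw [abs_zero]
    have : 0 ≤ |σ - 1| + (d + 1) * |σ| := by positivity
    linarith
  have n0 : ‖logExponent β (profile s R χ₁) r‖ ≤ 3 / 2 * (β * C) :=
    norm_logExponent_le hβ.le (ha'.abs_le r hr) hβC'
  have n1 : ‖logExponent β (profileDeriv s R χ₁) r‖ ≤ 3 / 2 * (β * C) :=
    norm_logExponent_le hβ.le (hb'.abs_le r hr) hβC'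
  have y0 : |(derivExponent s R χ₁ β r).im| ≤ (|σ - 1| + |1|) * (3 / 2 * (β * C)) :=
    abs_im_linear_comb_le n0 n1
  have y1 : |(radiusExponent s R χ₁ β r).im| ≤ (|σ| + |0|) * (3 / 2 * (β * C)) :=
    abs_im_linear_comb_le n0 n1
  rw [abs_one] at y0
  rw [abs_zero, add_zero] at y1
  have p1 : 0 ≤ |σ| * (3 / 2 * (β * C)) := by positivity
  have p2 : 0 ≤ (|σ - 1| + 1) * (3 / 2 * (β * C)) := by positivity
  have p3 : 0 ≤ (d : ℝ) * (|σ| * (3 / 2 * (β * C))) := by positivity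
  have hsum : m * (3 / 2 * (β * C)) = (|σ - 1| + 1) * (3 / 2 * (β * C))
      + |σ| * (3 / 2 * (β * C)) + (d : ℝ) * (|σ| * (3 / 2 * (β * C)))
      + |σ| * (3 / 2 * (β * C)) := by rw [hm]; ring
  refine ⟨?_, ?_, ?_⟩
  · rw [abs_mul, abs_two]; linarith
  · rw [abs_mul, abs_two]; linarith
  · have e : (derivExponent s R χ₁ β r + ((d : ℂ) - 1) * radiusExponent s R χ₁ β r).im
        = (derivExponent s R χ₁ β r).im + ((d : ℝ) - 1) * (radiusExponent s R χ₁ β r).im := by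
      rw [Complex.add_im, show ((d : ℂ) - 1) = (((d : ℝ) - 1 : ℝ) : ℂ) by push_cast; rfl,
        Complex.im_ofReal_mul]
    rw [e]
    have hd : |(d : ℝ) - 1| ≤ d + 1 := by
      have : (0 : ℝ) ≤ d := d.cast_nonneg
      rw [abs_le]; constructor <;> linarith
    have h2 : |((d : ℝ) - 1) * (radiusExponent s R χ₁ β r).im|
        ≤ (d + 1) * (|σ| * (3 / 2 * (β * C))) := by
      rw [abs_mul]; gcongr
    have h3 := abs_add_le (derivExponent s R χ₁ β r).im
      (((d : ℝ) - 1) * (radiusExponent s R χ₁ β r).im)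
    have := Real.pi_gt_three
    linarith

/-- For `s < 1`, `g₁ = 0 ≤ g`. For `s = 1`, `g₁ = r^{-2}` and `g = 2 r^{-2} log r`, and `g₁ ≤ g`
means `r ≥ √e`: the support condition on `χ'`. -/
theorem im_sq_exp_exponents_nonpos {s R : ℝ} {χ₁ : ℝ → ℝ} (hs0 : 0 < s) (hs1 : s ≤ 1)
    (hχ₁ : ContDiff ℝ ∞ χ₁) (hmem : ∀ t, χ₁ t ∈ Set.Icc (0 : ℝ) 1) {β r : ℝ} (hβ : 0 ≤ β)
    (hr : 0 < r) (h : χ₁ (r ^ (2 * s) / R ^ (2 * s)) = 1)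
    (hsupp : s = 1 → Real.sqrt (Real.exp 1) ≤ r) :
    (Complex.exp (derivExponent s R χ₁ β r - radiusExponent s R χ₁ β r) ^ 2).im ≤ 0 := by
  rw [derivExponent_sub_radiusExponent]
  have hy : 0 < r ^ (-(2 * s)) := by positivity
  refine im_sq_exp_sub_nonpos hβ ?_ ?_
  · rw [profileDeriv_eq_of_cutoff_eq_one hs0 hχ₁ hmem hr h]
    split_ifs <;> positivity
  · rw [profileDeriv_eq_of_cutoff_eq_one hs0 hχ₁ hmem hr h, profile_of_cutoff_eq_one h]
    rcases hs1.lt_or_eq with hs | rfl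
    · simp only [hs, if_true, zero_mul]
      positivity
    · simp only [lt_irrefl, if_false]
      have h2 : 1 / 2 ≤ Real.log r := by
        rw [Real.le_log_iff_exp_le hr]
        refine le_trans (le_of_eq ?_) (hsupp rfl)
        rw [Real.sqrt_eq_rpow, ← Real.exp_mul, one_mul]
      rw [div_one]
      exact mul_le_mul_of_nonneg_right (by linarith) hy.le

/-- The potential part of `H_θ - z`, paired with the multiplier. -/
theorem exists_potential_lower_bound {d : ℕ} {s : ℝ} (hs0 : 0 < s) (hs1 : s ≤ 1)
    {q : EuclideanSpace ℝ (Fin d) → ℝ} (hq : LongRange s q)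
    {χ₁ : ℝ → ℝ} (hχ₁ : ContDiff ℝ ∞ χ₁) (hχ₁_mem : ∀ t, χ₁ t ∈ Set.Icc (0 : ℝ) 1)
    (hχ₁_zero : ∀ t, t ≤ 1 → χ₁ t = 0) (hχ₁_one : ∀ t, 2 ≤ t → χ₁ t = 1)
    {E μ : ℝ} (hμ : 0 < μ) {χ χ' : ℝ → ℝ} {ε D : ℝ} (hχ : IsPartition χ χ' ε D)
    {α : ℝ} (hα : 0 < α)
    (hforbidden : ∀ x : EuclideanSpace ℝ (Fin d), ‖x‖ ∈ radialSupp χ →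
      α ≤ -(1 / 2) * ‖x‖ ^ (2 * s) + q x - E)
    {γ : ℝ} (hγ : 0 < γ)
    (hvirial_lt : s < 1 → ∀ x : EuclideanSpace ℝ (Fin d), ‖x‖ ∈ radialSupp χ' →
      γ ≤ 1 - s - 2 * (1 - 2 * s) * ‖x‖ ^ (-(2 * s)) * (q x - E)
        - ‖x‖ ^ (1 - 2 * s) * radialDeriv q x - μ)
    (hvirial_one : s = 1 → ∀ x : EuclideanSpace ℝ (Fin d), ‖x‖ ∈ radialSupp χ' →
      γ ≤ 1 + 2 * (‖x‖ ^ 2)⁻¹ * (Real.log ‖x‖ - 1) * (q x - E)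
        - ‖x‖⁻¹ * Real.log ‖x‖ * radialDeriv q x - μ)
    {R : ℝ} (hR : 0 < R)
    (hχR : ∀ r ∈ radialSupp χ', χ₁ (r ^ (2 * s) / R ^ (2 * s)) = 1)
    {β₀ : ℝ} (hβ₀ : 0 < β₀) {Q : ℂ → EuclideanSpace ℝ (Fin d) → ℂ}
    (hQ : IsAnalyticDistortion s R χ₁ q β₀ Q) :
    ∃ K β₂ : ℝ, 0 ≤ K ∧ 0 < β₂ ∧ ∀ β, 0 < β → β < β₂ → ∀ x, x ≠ 0 →
      β * γ - K * β ^ 2 ≤ (multiplier χ χ' (derivExponent s R χ₁ β) ‖x‖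
        * (-(1 / 2) * radiusPow s R χ₁ (Complex.I * β) ‖x‖ + Q (Complex.I * β) x
          - (E - Complex.I * β * μ))).re := by
  obtain ⟨B, C₀, β₂, hC₀, hβ₂, hβ₂1, hprof, hexp⟩ :=
    exists_exponent_bounds d hs0 hR hχ₁ hχ₁_zero hχ₁_one
  obtain ⟨C₁, hC₁, hQexp⟩ := hQ.exists_expansion hs0 hβ₀ (hq.1.differentiable (by simp))
  obtain ⟨C₂, hC₂, hqb⟩ := hq.exists_abs_le_one_add hs0 hs1
  obtain ⟨Λ₁, hΛ₁⟩ := exists_sq_mul_one_add_le hs0 hR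
    (hasLogPowTail_profile hs0 hR hχ₁ hχ₁_zero hχ₁_one)
  obtain ⟨Λ₂, hΛ₂⟩ := exists_sq_mul_one_add_le hs0 hR
    (hasLogPowTail_profileDeriv hs0 hR hχ₁ hχ₁_zero hχ₁_one)
  set σ : ℝ := 1 / (2 * s) - 1 with hσ
  set C := max C₁ C₂ with hC
  have hCn : 0 ≤ C := hC₁.trans (le_max_left _ _)
  set c := 32 * (|σ| + 1) ^ 2 + 2 * (|σ| + 1) * C₀ + C₀ with hc
  have hcn : 0 ≤ c := by positivity
  set Λ := Λ₁ + Λ₂ with hΛ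
  have hΛn : 0 ≤ Λ := by
    have h1 : 0 ≤ profile s R χ₁ 1 ^ 2 * (1 + (1 : ℝ) ^ (2 * s)) := by positivity
    have h2 : 0 ≤ profileDeriv s R χ₁ 1 ^ 2 * (1 + (1 : ℝ) ^ (2 * s)) := by positivity
    linarith [hΛ₁ 1 one_pos, hΛ₂ 1 one_pos]
  set K := c * Λ * (c + C + μ) + C + 2 * c * Λ * (1 + 2 * C + |E|) + c * C with hK
  have hKn : 0 ≤ K := by positivity
  -- The bound `β < α/(γ + C)` gives `α - Cβ ≥ βγ`, so the forbidden region also satisfies the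
  -- estimate with `βγ`.
  refine ⟨K, min β₂ (min β₀ (α / (γ + C))), hKn, by positivity, ?_⟩
  intro β hβ hβlt x hx
  have hβ2 := hβlt.trans_le (min_le_left _ _)
  have hβ0 := (hβlt.trans_le (min_le_right _ _)).trans_le (min_le_left _ _)
  have hβα := (hβlt.trans_le (min_le_right _ _)).trans_le (min_le_right _ _)
  rw [lt_div_iff₀ (by positivity)] at hβα
  obtain ⟨hβC, -, -, hrr⟩ := hexp β hβ hβ2
  have hr : 0 < ‖x‖ := norm_pos_iff.2 hx
  obtain ⟨hl1, -, -⟩ := hrr _ hr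
  obtain ⟨hg, hg₁⟩ := hprof _ hr
  obtain ⟨q1, q2⟩ := hQexp β hβ hβ0 x hx
  have q1' : ‖Q (Complex.I * β) x - q x‖ ≤ C * β :=
    q1.trans (mul_le_mul_of_nonneg_right (le_max_left _ _) hβ.le)
  have qre : |(Q (Complex.I * β) x).re - q x| ≤ C * β := by
    have := (Complex.abs_re_le_norm _).trans q1'
    simpa using this
  have qim : |(Q (Complex.I * β) x).im| ≤ C * β := by
    have := (Complex.abs_im_le_norm _).trans q1'
    simpa using this
  set W := -(1 / 2) * radiusPow s R χ₁ (Complex.I * β) ‖x‖ + Q (Complex.I * β) x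
          - (E - Complex.I * β * μ) with hW
  have eW : W = -(1 / 2) * (((‖x‖ ^ (2 * s) : ℝ) : ℂ)
      * (1 + Complex.I * β * (profile s R χ₁ ‖x‖ : ℝ))) + Q (Complex.I * β) x
          - (E - Complex.I * β * μ) := by rw [hW, radiusPow_eq _ hr]
  have eW' : W = ((-(1 / 2) * ‖x‖ ^ (2 * s) - E : ℝ) : ℂ) + Q (Complex.I * β) x
      + ((-(1 / 2) * (β * (‖x‖ ^ (2 * s) * profile s R χ₁ ‖x‖)) + β * μ : ℝ) : ℂ) * Complex.I := by
    rw [eW]; push_cast; ring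
  have hWre : W.re = -(1 / 2) * ‖x‖ ^ (2 * s) + (Q (Complex.I * β) x).re - E := by
    rw [eW', Complex.add_re, Complex.add_re, Complex.ofReal_re, Complex.re_ofReal_mul,
      Complex.I_re]
    ring
  have hWim : W.im = -(1 / 2) * (β * (‖x‖ ^ (2 * s) * profile s R χ₁ ‖x‖))
      + (Q (Complex.I * β) x).im + β * μ := by
    rw [eW', Complex.add_im, Complex.add_im, Complex.ofReal_im, Complex.im_ofReal_mul,
      Complex.I_im]
    ring
  rw [multiplier_mul_re]
  set κ := 2 * (derivExponent s R χ₁ β ‖x‖).im with hκ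
  have hrot : (Complex.exp ((κ : ℂ) * Complex.I) * W).im
      = Real.cos κ * W.im + Real.sin κ * W.re := by
    rw [Complex.mul_im, Complex.exp_ofReal_mul_I_re, Complex.exp_ofReal_mul_I_im]
  rw [hrot]
  have hKβ : 0 ≤ K * β ^ 2 := by positivity
  -- Forbidden region: the multiplier is real there, and `Re W ≥ α - Cβ`.
  have b1 : χ ‖x‖ ^ 2 * (β * γ - K * β ^ 2) ≤ χ ‖x‖ ^ 2 * W.re := by
    by_cases h0 : χ ‖x‖ = 0
    · simp [h0]
    refine mul_le_mul_of_nonneg_left ?_ (sq_nonneg _)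
    have h1 := hforbidden x (subset_closure ⟨hr.le, h0⟩)
    have h2 := (abs_le.1 qre).1
    rw [hWre]
    linarith
  -- Virial region: multiplication by `i exp(iκ)` selects `-Im(exp(iκ) W)`.
  have b2 : χ' ‖x‖ ^ 2 * (β * γ - K * β ^ 2)
      ≤ χ' ‖x‖ ^ 2 * (-(Real.cos κ * W.im) - Real.sin κ * W.re) := by
    by_cases h0 : χ' ‖x‖ = 0
    · simp [h0]
    refine mul_le_mul_of_nonneg_left ?_ (sq_nonneg _)
    have hmem' : ‖x‖ ∈ radialSupp χ' := subset_closure ⟨hr.le, h0⟩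
    obtain ⟨k1, k2⟩ := phase_expansion (s := s) (R := R) (χ₁ := χ₁) hβ.le hβC hg hg₁
    have hcc : 32 * (|σ| + 1) ^ 2 ≤ c := by
      have : 0 ≤ 2 * (|σ| + 1) * C₀ + C₀ := by positivity
      linarith
    have hG : 0 ≤ profile s R χ₁ ‖x‖ ^ 2 + profileDeriv s R χ₁ ‖x‖ ^ 2 := by positivity
    have hcle : 32 * (|σ| + 1) ^ 2 * β ^ 2 * (profile s R χ₁ ‖x‖ ^ 2 + profileDeriv s R χ₁ ‖x‖ ^ 2)
        ≤ c * β ^ 2 * (profile s R χ₁ ‖x‖ ^ 2 + profileDeriv s R χ₁ ‖x‖ ^ 2) := by gcongr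
    have hκ₁ : |2 * (σ * profile s R χ₁ ‖x‖ + profileDeriv s R χ₁ ‖x‖)| ≤ c := by
      rw [abs_mul, abs_two]
      have h1 : |σ * profile s R χ₁ ‖x‖ + profileDeriv s R χ₁ ‖x‖| ≤ |σ| * C₀ + C₀ := by
        refine (abs_add_le _ _).trans (add_le_add ?_ hg₁)
        rw [abs_mul]; gcongr
      have h2 : 0 ≤ 32 * (|σ| + 1) ^ 2 := by positivity
      linarith
    have hgc : |profile s R χ₁ ‖x‖| ≤ c := by
      have h2 : 0 ≤ 32 * (|σ| + 1) ^ 2 + 2 * (|σ| + 1) * C₀ := by positivity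
      linarith
    have hv := virial_eq hs0 hs1 hχ₁ hχ₁_mem hx (hχR _ hmem') (fun hs => hvirial_lt hs x hmem')
      (fun hs => hvirial_one hs x hmem')
    have h := rotated_potential_lower_bound (Λ := Λ) hβ (hβ2.le.trans hβ₂1)
      (by positivity : 0 ≤ ‖x‖ ^ (2 * s)) hμ.le hCn hcn hG hv qre qim
      (q2.trans (mul_le_mul_of_nonneg_right (le_max_left _ _) (sq_nonneg β))) hl1 (k1.trans hcle)
      (k2.trans hcle) hκ₁ hgc
      ((hqb x).trans (mul_le_mul_of_nonneg_right (le_max_right _ _) (by positivity)))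
      ((add_mul _ _ _).trans_le (add_le_add (hΛ₁ _ hr) (hΛ₂ _ hr)))
    rw [hWre, hWim]
    exact h
  have hsum := hχ.sq_add_sq ‖x‖ hr.le
  calc β * γ - K * β ^ 2 = (χ ‖x‖ ^ 2 + χ' ‖x‖ ^ 2) * (β * γ - K * β ^ 2) := by rw [hsum, one_mul]
    _ ≤ χ ‖x‖ ^ 2 * W.re - χ' ‖x‖ ^ 2 * (Real.cos κ * W.im + Real.sin κ * W.re) := by linarith

/-! ### From pointwise coercivity to the closed operator -/

section HilbertSpace

variable {X : Type*} [MeasurableSpace X] {ν : Measure X}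

theorem integral_norm_mul_norm_le (u v : Lp ℂ 2 ν) :
    Integrable (fun x => ‖u x‖ * ‖v x‖) ν ∧ ∫ x, ‖u x‖ * ‖v x‖ ∂ν ≤ ‖u‖ * ‖v‖ ∧
      Integrable (fun x => ‖u x‖ ^ 2) ν ∧ ∫ x, ‖u x‖ ^ 2 ∂ν = ‖u‖ ^ 2 := by
  let N : Lp ℂ 2 ν → Lp ℝ 2 ν := fun w => (Lp.memLp w).norm.toLp _
  have hN : ∀ w, N w =ᵐ[ν] fun x => ‖w x‖ := fun w => (Lp.memLp w).norm.coeFn_toLp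
  have hn : ∀ w, ‖N w‖ = ‖w‖ := fun w => by
    rw [Lp.norm_toLp, eLpNorm_norm, Lp.norm_def]
  have key : ∀ w w' : Lp ℂ 2 ν, Integrable (fun x => ‖w x‖ * ‖w' x‖) ν ∧
      inner ℝ (N w) (N w') = ∫ x, ‖w x‖ * ‖w' x‖ ∂ν := by
    intro w w'
    have e : (fun x => inner ℝ (N w x) (N w' x)) =ᵐ[ν] fun x => ‖w x‖ * ‖w' x‖ := by
      filter_upwards [hN w, hN w'] with x h1 h2
      rw [h1, h2]
      simp [mul_comm]
    refine ⟨(L2.integrable_inner (𝕜 := ℝ) (N w) (N w')).congr e, ?_⟩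
    rw [L2.inner_def]
    exact integral_congr_ae e
  refine ⟨(key u v).1, ?_, ?_, ?_⟩
  · rw [← (key u v).2, ← hn u, ← hn v]
    exact real_inner_le_norm _ _
  · simpa [sq] using (key u u).1
  · have h := (key u u).2
    rw [real_inner_self_eq_norm_sq, hn] at h
    rw [h]
    simp [sq]

/-- A pointwise coercivity estimate, up to a function of zero mean, gives a lower bound in `L²`. -/
theorem mul_norm_le_of_pointwise {u v : Lp ℂ 2 ν} {Z : X → ℝ} (hZ : Integrable Z ν)
    (hZ0 : ∫ x, Z x ∂ν = 0) {c : ℝ} (h : ∀ᵐ x ∂ν, Z x + c * ‖u x‖ ^ 2 ≤ ‖u x‖ * ‖v x‖) :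
    c * ‖u‖ ≤ ‖v‖ := by
  obtain ⟨i1, e1, i2, e2⟩ := integral_norm_mul_norm_le u v
  have h1 := integral_mono_ae (hZ.add (i2.const_mul c)) i1 h
  simp only [Pi.add_apply] at h1
  rw [integral_add hZ (i2.const_mul c), hZ0, integral_const_mul, e2, zero_add] at h1
  rcases (norm_nonneg u).eq_or_lt with h0 | h0
  · rw [← h0]; simp
  · have h2 := h1.trans e1
    have h3 : ‖u‖ * (c * ‖u‖) ≤ ‖u‖ * ‖v‖ := by linarith
    exact le_of_mul_le_mul_left h3 h0

end HilbertSpace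

theorem mul_norm_le_of_mem_closure {X : Type*} [NormedAddCommGroup X] [NormedSpace ℂ X] {c : ℝ}
    {z : ℂ} {S : Set (X × X)} (h : ∀ u f, (u, f) ∈ S → c * ‖u‖ ≤ ‖f - z • u‖) {u f : X}
    (huf : (u, f) ∈ closure S) : c * ‖u‖ ≤ ‖f - z • u‖ := by
  have hcl : IsClosed {p : X × X | c * ‖p.1‖ ≤ ‖p.2 - z • p.1‖} :=
    isClosed_le (continuous_const.mul continuous_fst.norm)
      (continuous_snd.sub (continuous_fst.const_smul z)).norm
  exact closure_minimal (fun p hp => h p.1 p.2 hp) hcl huf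

/-- The norm inequality for `(u, f)` in the closure follows from the one on `C_c^∞`. -/
theorem norm_le_of_mem_distortedGraph {d : ℕ} {s R : ℝ} {χ₁ : ℝ → ℝ}
    {Q : ℂ → EuclideanSpace ℝ (Fin d) → ℂ} {ħ : ℝ} {θ z : ℂ} {c : ℝ}
    (h : ∀ u f : Lp ℂ 2 (volume : Measure (EuclideanSpace ℝ (Fin d))),
      ∀ φ : EuclideanSpace ℝ (Fin d) → ℂ, ContDiff ℝ ∞ φ → HasCompactSupport φ →
      u =ᵐ[volume] φ → f =ᵐ[volume] distortedExpr s R χ₁ Q ħ θ φ → c * ‖u‖ ≤ ‖f - z • u‖)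
    {u f : Lp ℂ 2 (volume : Measure (EuclideanSpace ℝ (Fin d)))}
    (huf : (u, f) ∈ distortedGraph s R χ₁ Q ħ θ) : c * ‖u‖ ≤ ‖f - z • u‖ := by
  refine mul_norm_le_of_mem_closure (fun u f hp => ?_) huf
  obtain ⟨φ, h1, h2, h3, h4⟩ := hp
  exact h u f φ h1 h2 h3 h4

/-- Pointwise algebra behind the coercivity estimate. -/
theorem coercivity_pointwise {M V W A φ F : ℂ} {ħ Z K₁ K₂ c : ℝ} (hM : ‖M‖ ≤ 1)
    (hV : ‖V‖ ≤ K₂)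
    (hA : Z - K₁ * ‖φ‖ ^ 2 ≤ -(M * (starRingEnd ℂ) φ * A).re) (hW : c ≤ (M * W).re)
    (hF : F = -((ħ : ℂ) ^ 2 / 2) * (A + V * φ) + W * φ) :
    ħ ^ 2 / 2 * Z + (c - (K₁ + K₂) / 2 * ħ ^ 2) * ‖φ‖ ^ 2 ≤ ‖φ‖ * ‖F‖ := by
  have h1 : (M * (starRingEnd ℂ) φ * F).re ≤ ‖φ‖ * ‖F‖ := by
    refine (Complex.re_le_norm _).trans ?_
    rw [norm_mul, norm_mul, RCLike.norm_conj]
    have := mul_nonneg (norm_nonneg φ) (norm_nonneg F)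
    nlinarith
  have e : M * (starRingEnd ℂ) φ * F
      = ((-(ħ ^ 2 / 2) : ℝ) : ℂ) * (M * (starRingEnd ℂ) φ * A)
        + ((-(ħ ^ 2 / 2) * ‖φ‖ ^ 2 : ℝ) : ℂ) * (M * V) + ((‖φ‖ ^ 2 : ℝ) : ℂ) * (M * W) := by
    rw [hF, Complex.ofReal_mul, ← conj_mul_self_eq_ofReal]
    push_cast
    ring
  rw [e, Complex.add_re, Complex.add_re, Complex.re_ofReal_mul, Complex.re_ofReal_mul,
    Complex.re_ofReal_mul] at h1
  have hMV : (M * V).re ≤ K₂ := by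
    refine (Complex.re_le_norm _).trans ?_
    rw [norm_mul]
    have := norm_nonneg V
    nlinarith
  have hφ := sq_nonneg ‖φ‖
  have hħ : 0 ≤ ħ ^ 2 / 2 := by positivity
  have t1 := mul_le_mul_of_nonneg_left hA hħ
  have t2 := mul_le_mul_of_nonneg_left hMV (mul_nonneg hħ hφ)
  have t3 := mul_le_mul_of_nonneg_left hW hφ
  linarith

end RepulsiveResonance

end

/-! ### Assembly of the resolvent estimate -/

open RepulsiveResonance in
theorem theorem2p1 (d : ℕ) (hd : 1 ≤ d) (s : ℝ) (hs0 : 0 < s) (hs1 : s ≤ 1)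
    (q : EuclideanSpace ℝ (Fin d) → ℝ) (hq : RepulsiveResonance.LongRange s q)
    -- the fixed cut-off in the distortion
    (χ₁ : ℝ → ℝ) (hχ₁ : ContDiff ℝ ∞ χ₁) (hχ₁_mem : ∀ t, χ₁ t ∈ Set.Icc (0 : ℝ) 1)
    (hχ₁_zero : ∀ t, t ≤ 1 → χ₁ t = 0) (hχ₁_one : ∀ t, 2 ≤ t → χ₁ t = 1)
    (E μ : ℝ) (hμ : 0 < μ)
    -- (i)
    (χ χ' : ℝ → ℝ) (hχ : ContDiffOn ℝ 1 χ (Set.Ici 0)) (hχ' : ContDiffOn ℝ 1 χ' (Set.Ici 0))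
    (hχ_mem : ∀ r, 0 ≤ r → χ r ∈ Set.Icc (0 : ℝ) 1)
    (hχ'_mem : ∀ r, 0 ≤ r → χ' r ∈ Set.Icc (0 : ℝ) 1)
    (hsq : ∀ r, 0 ≤ r → χ r ^ 2 + χ' r ^ 2 = 1)
    (hχ_near : ∀ᶠ r in 𝓝[≥] (0 : ℝ), χ r = 1)
    (hsupp : s = 1 → ∀ r ∈ RepulsiveResonance.radialSupp χ', Real.sqrt (Real.exp 1) ≤ r)
    -- (ii)
    (α : ℝ) (hα : 0 < α)
    (hforbidden : ∀ x : EuclideanSpace ℝ (Fin d), ‖x‖ ∈ RepulsiveResonance.radialSupp χ →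
      α ≤ -(1 / 2) * ‖x‖ ^ (2 * s) + q x - E)
    -- (iii)
    (γ : ℝ) (hγ : 0 < γ)
    (hvirial_lt : s < 1 → ∀ x : EuclideanSpace ℝ (Fin d),
      ‖x‖ ∈ RepulsiveResonance.radialSupp χ' →
      γ ≤ 1 - s - 2 * (1 - 2 * s) * ‖x‖ ^ (-(2 * s)) * (q x - E)
        - ‖x‖ ^ (1 - 2 * s) * RepulsiveResonance.radialDeriv q x - μ)
    (hvirial_one : s = 1 → ∀ x : EuclideanSpace ℝ (Fin d),
      ‖x‖ ∈ RepulsiveResonance.radialSupp χ' →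
      γ ≤ 1 + 2 * (‖x‖ ^ 2)⁻¹ * (Real.log ‖x‖ - 1) * (q x - E)
        - ‖x‖⁻¹ * Real.log ‖x‖ * RepulsiveResonance.radialDeriv q x - μ)
    -- `χ_R = 1` on the support of `χ'`
    (R : ℝ) (hR : 0 < R)
    (hχR : ∀ r ∈ RepulsiveResonance.radialSupp χ', χ₁ (r ^ (2 * s) / R ^ (2 * s)) = 1)
    -- analyticity of `q_θ`
    (β₀ : ℝ) (hβ₀ : 0 < β₀) (Q : ℂ → EuclideanSpace ℝ (Fin d) → ℂ)
    (hQ : RepulsiveResonance.IsAnalyticDistortion s R χ₁ q β₀ Q) :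
    ∃ c K β₁ : ℝ, 0 < c ∧ 0 < K ∧ 0 < β₁ ∧ β₁ ≤ β₀ ∧ ∃ C : ℝ → ℝ → ℝ,
      ∀ β ∈ Set.Ioo 0 β₁, ∀ ħ : ℝ, 0 < ħ →
        |C β ħ - (1 - c * β) * min α (β * γ)| ≤ K * β ^ 2 + K * ħ ^ 2 ∧
        ∀ u f : Lp ℂ 2 (volume : Measure (EuclideanSpace ℝ (Fin d))),
          (u, f) ∈ RepulsiveResonance.distortedGraph s R χ₁ Q ħ (Complex.I * (β : ℂ)) →
          C β ħ * ‖u‖ ≤ ‖f - ((E : ℂ) - Complex.I * (β : ℂ) * (μ : ℂ)) • u‖ := by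
  obtain ⟨N, hN⟩ := hq.exists_forbidden_subset hd hs0 hs1 hα hforbidden
  obtain ⟨ε, D, hpart⟩ := exists_isPartition hχ hχ' hsq hχ_near hN
  obtain ⟨B, C₀, β₂, -, hβ₂, -, -, hexp⟩ := exists_exponent_bounds d hs0 hR hχ₁ hχ₁_zero hχ₁_one
  obtain ⟨K₁, hK₁, hkin⟩ := exists_kinetic_lower_bound d hR hpart B
  obtain ⟨K₂, hK₂, hV⟩ := exists_norm_distortionPotential_le d hR B
  obtain ⟨K₃, β₃, hK₃, hβ₃, hpot⟩ := exists_potential_lower_bound hs0 hs1 hq hχ₁ hχ₁_mem hχ₁_zero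
    hχ₁_one hμ hpart hα hforbidden hγ hvirial_lt hvirial_one hR hχR hβ₀ hQ
  -- With `c = 1` the comparison value is `(1 - β) βγ`, since `β < α/γ` makes `βγ` the minimum; the
  -- discrepancy `γ β²` is absorbed by the summand `γ` of `K`.
  refine ⟨1, K₃ + γ + (K₁ + K₂) / 2, min β₀ (min β₂ (min β₃ (α / γ))), one_pos, by positivity,
    by positivity, min_le_left _ _, fun β ħ => β * γ - K₃ * β ^ 2 - (K₁ + K₂) / 2 * ħ ^ 2, ?_⟩
  rintro β ⟨hβ, hβlt⟩ ħ hħ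
  rw [lt_min_iff, lt_min_iff, lt_min_iff, lt_div_iff₀ hγ] at hβlt
  obtain ⟨-, hβ2, hβ3, hβα⟩ := hβlt
  constructor
  · rw [min_eq_right hβα.le]
    have h1 : 0 ≤ K₃ * β ^ 2 := by positivity
    have h2 : 0 ≤ γ * β ^ 2 := by positivity
    have h3 : 0 ≤ (K₁ + K₂) / 2 * ħ ^ 2 := by positivity
    have h4 : 0 ≤ (K₁ + K₂) / 2 * β ^ 2 := by positivity
    have h5 : 0 ≤ (K₃ + γ) * ħ ^ 2 := by positivity
    rw [abs_le]
    constructor <;> linarith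
  intro u f huf
  refine norm_le_of_mem_distortedGraph ?_ huf
  intro u f φ hφ hφc hu hf
  obtain ⟨-, hl, hτ, hrr⟩ := hexp β hβ hβ2
  have hne : ∀ r, 0 < r → r ∈ radialSupp χ' → _ := fun r hr hmem => im_sq_exp_exponents_nonpos
    hs0 hs1 hχ₁ hχ₁_mem hβ.le hr (hχR r hmem) (fun hs => hsupp hs r hmem)
  obtain ⟨Z, hZ, hZ0, hZx⟩ := hkin _ _ hl hτ (fun r hr => (hrr r hr).1) (fun r hr => (hrr r hr).2.1)
    (fun r hr h0 => hne r hr (subset_closure ⟨hr.le, h0⟩)) φ hφ hφc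
  refine mul_norm_le_of_pointwise (hZ.const_mul (ħ ^ 2 / 2))
    (by rw [integral_const_mul, hZ0, mul_zero]) ?_
  -- As `d ≥ 1` the origin is a null set, so the singularity of polar coordinates can be ignored.
  have : Nonempty (Fin d) := ⟨⟨0, hd⟩⟩
  have hx0 : ∀ᵐ x ∂(volume : Measure (EuclideanSpace ℝ (Fin d))), x ≠ 0 :=
    Measure.ae_ne volume 0
  filter_upwards [hu, hf, hx0, Lp.coeFn_sub f (((E : ℂ) - Complex.I * (β : ℂ) * (μ : ℂ)) • u),
    Lp.coeFn_smul ((E : ℂ) - Complex.I * (β : ℂ) * (μ : ℂ)) u] with x hux hfx hx hsub hsmul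
  have hr : 0 < ‖x‖ := norm_pos_iff.2 hx
  have hg : ∀ r, 0 < r → DifferentiableAt ℝ (profile s R χ₁) r := fun r hr =>
    (((hasLogPowTail_profile hs0 hR hχ₁ hχ₁_zero hχ₁_one).contDiffOn r hr).contDiffAt
      (Ioi_mem_nhds hr)).differentiableAt (by simp)
  have hrad : ∀ r, 0 < r → radius s R χ₁ (Complex.I * β) r
      = r * Complex.exp (radiusExponent s R χ₁ β r) := fun r hr => by
    rw [radius_I_mul hs0 β hr, radiusExponent]; simp
  have hder : ∀ r, 0 < r → radiusDeriv s R χ₁ (Complex.I * β) r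
      = Complex.exp (derivExponent s R χ₁ β r) := fun r hr => by
    rw [radiusDeriv_I_mul hs0 β hr (hg r hr), derivExponent]
    congr 1; push_cast; ring
  have hrel : ∀ r, 0 < r → Complex.exp (derivExponent s R χ₁ β r)
      = Complex.exp (radiusExponent s R χ₁ β r)
        * (1 + r * deriv (radiusExponent s R χ₁ β) r) := fun r hr => by
    have e : radiusExponent s R χ₁ β
        = fun r => ((1 / (2 * s) : ℝ) : ℂ) * logExponent β (profile s R χ₁) r := by
      funext r; rw [radiusExponent]; simp
    have e2 : deriv (radiusExponent s R χ₁ β) r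
        = ((1 / (2 * s) : ℝ) : ℂ) * deriv (logExponent β (profile s R χ₁)) r := by
      rw [e, ((hasDerivAt_logExponent β (hg r hr).hasDerivAt).differentiableAt.hasDerivAt.const_mul
        _).deriv]
    rw [e2, one_add_mul_deriv_logExponent β (hg r hr), ← derivExponent_sub_radiusExponent,
      ← Complex.exp_add]
    congr 1; ring
  refine coercivity_pointwise (norm_multiplier_le hpart (derivExponent s R χ₁ β) hr.le)
    (hV _ _ hl hτ ‖x‖ hr) (by rw [hux]; exact hZx x hx) (hpot β hβ hβ3 x hx) ?_
  rw [hsub, Pi.sub_apply, hsmul, Pi.smul_apply, hfx, hux, distortedExpr,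
    distortedLaplacian_eq hd hl.contDiffOn hτ.contDiffOn hrad hder hrel
      (fun r hr => (hrr r hr).2.2) hφ hx, smul_eq_mul]
  ring
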